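/- Let $d>0$, $\alpha_0>0$, and let $\Omega=\mathbb R\times(0,d)$. Let $\alpha\in W^{1,\infty}(\mathbb R)$ be real-valued with $\alpha(x)>0$ for all $x\in\mathbb R$, and let $H_\alpha$ be the Robin Laplacian in the complex Hilbert space $L^2(\Omega)$: $H_\alpha\psi=-\Delta\psi$, with domain $D(H_\alpha)$ consisting of all $\psi\in W^{2,2}(\Omega)$ that satisfy, in the sense of traces, $$-\partial_y\psi(x,0)+\alpha(x)\psi(x,0)=0,\qquad \partial_y\psi(x,d)+\alpha(x)\psi(x,d)=0\qquad\text{for almost every } x\in\mathbb R .$$ Let $E_1(\alpha_0)$ be the first transversal eigenvalue, i.e. the least $E\in\mathbb R$ for which the problem $-u''=Eu$ on $(0,d)$, $-u'(0)+\alpha_0u(0)=0$, $u'(d)+\alpha_0u(d)=0$ has a nontrivial solution. Suppose that $\alpha-\alpha_0\in L^1(\mathbb R)$ and $\int_{\mathbb R}(\alpha(x)-\alpha_0)\,dx<0$. Then the set of real points of the spectrum $\sigma(H_\alpha)$ is non-empty and bounded below, and $$\inf\sigma(H_\alpha)<E_1(\alpha_0).$$ Moreover, $H_\alpha$ has a discrete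 eigenvalue below the essential spectrum: there is a real number $r<E_1(\alpha_0)$ that is an isolated point of $\sigma(H_\alpha)$ and an eigenvalue of $H_\alpha$ of finite multiplicity, and that satisfies $r<s$ for every real $s\in\sigma_{\mathrm{ess}}(H_\alpha)$. (Here $\sigma_{\mathrm{ess}}(H_\alpha)$ is the set of all points of $\sigma(H_\alpha)$ that are not isolated eigenvalues of finite multiplicity.) -/

import Mathlib

open MeasureTheory Set
open scoped ContDiff

/-! ### Spectrum of an unbounded operator in a complex Hilbert space -/

section Spectrum

variable {E : Type*} [NormedAddCommGroup E] [InnerProductSpace ℂ E]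

/-- `z` is in the resolvent set of `T` when `T - z : D(T) → E` is a bijection whose inverse is a
bounded operator on `E`. -/
def UnboundedOp.resolventSet (T : E →ₗ.[ℂ] E) : Set ℂ :=
  {z | ∃ R : E →L[ℂ] E,
    (∀ f : E, ∃ h : R f ∈ T.domain, T ⟨R f, h⟩ - z • R f = f) ∧
    (∀ u : T.domain, R (T u - z • (u : E)) = u)}

/-- The spectrum: the complement of the resolvent set. -/
def UnboundedOp.spectrum (T : E →ₗ.[ℂ] E) : Set ℂ :=
  (UnboundedOp.resolventSet T)ᶜ

/-- The eigenspace `ker (T - z)`, as a subspace of the Hilbert space. -/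
def UnboundedOp.eigenspace (T : E →ₗ.[ℂ] E) (z : ℂ) : Submodule ℂ E :=
  (LinearMap.ker (T.toFun - z • T.domain.subtype)).map T.domain.subtype

/-- The discrete spectrum: the isolated points of the spectrum that are eigenvalues of finite
multiplicity. -/
def UnboundedOp.discreteSpectrum (T : E →ₗ.[ℂ] E) : Set ℂ :=
  {z | z ∈ UnboundedOp.spectrum T ∧
    (∃ ε > 0, ∀ w ∈ UnboundedOp.spectrum T, ‖w - z‖ < ε → w = z) ∧
    UnboundedOp.eigenspace T z ≠ ⊥ ∧
    FiniteDimensional ℂ (UnboundedOp.eigenspace T z)}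

/-- The essential spectrum: the rest of the spectrum. -/
def UnboundedOp.essentialSpectrum (T : E →ₗ.[ℂ] E) : Set ℂ :=
  UnboundedOp.spectrum T \ UnboundedOp.discreteSpectrum T

end Spectrum

/-! ### The strip and its Sobolev spaces -/

/-- The open strip `Ω = ℝ × (0, d)`. -/
def strip (d : ℝ) : Set (ℝ × ℝ) := {p | 0 < p.2 ∧ p.2 < d}

/-- The complex Hilbert space `L²(Ω)`. -/
abbrev L2Strip (d : ℝ) : Type := Lp ℂ 2 (volume.restrict (strip d))

/-- `g ∈ L²(Ω)` is the weak derivative of `f ∈ L²(Ω)` in the direction `v`: for all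
`φ ∈ C_c^∞(Ω)` one has `∫_Ω f ∂_v φ = - ∫_Ω g φ`. -/
def IsWeakDeriv (d : ℝ) (v : ℝ × ℝ) (f g : L2Strip d) : Prop :=
  ∀ φ : ℝ × ℝ → ℝ, ContDiff ℝ ∞ φ → HasCompactSupport φ → tsupport φ ⊆ strip d →
    ∫ p in strip d, (fderiv ℝ φ p v) • f p = - ∫ p in strip d, φ p • g p

open Classical in
/-- The weak derivative of `f` in the direction `v` (with value `0` if there is none in
`L²(Ω)`). -/
noncomputable def weakDeriv (d : ℝ) (v : ℝ × ℝ) (f : L2Strip d) : L2Strip d :=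
  if h : ∃ g, IsWeakDeriv d v f g then h.choose else 0

theorem isOpen_strip (d : ℝ) : IsOpen (strip d) :=
  (isOpen_lt continuous_const continuous_snd).inter (isOpen_lt continuous_snd continuous_const)

theorem integrable_smul_L2Strip (d : ℝ) (φ : ℝ × ℝ → ℝ) (hφ : Continuous φ)
    (hc : HasCompactSupport φ) (f : L2Strip d) :
    Integrable (fun p => φ p • f p) (volume.restrict (strip d)) := by
  have h1 : MemLp φ 2 (volume.restrict (strip d)) := (hφ.memLp_of_hasCompactSupport hc)
  exact memLp_one_iff_integrable.1 (MemLp.smul (p := 2) (q := 2) (r := 1) (Lp.memLp f) h1)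

theorem integrable_fderiv_smul_L2Strip (d : ℝ) (v : ℝ × ℝ) (φ : ℝ × ℝ → ℝ) (hφ : ContDiff ℝ ∞ φ)
    (hc : HasCompactSupport φ) (f : L2Strip d) :
    Integrable (fun p => (fderiv ℝ φ p v) • f p) (volume.restrict (strip d)) := by
  refine integrable_smul_L2Strip d _ ?_ (hc.fderiv_apply ℝ v) f
  exact (hφ.continuous_fderiv (by simp)).clm_apply continuous_const

theorem IsWeakDeriv.add {d : ℝ} {v : ℝ × ℝ} {f g f' g' : L2Strip d}
    (h : IsWeakDeriv d v f g) (h' : IsWeakDeriv d v f' g') :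
    IsWeakDeriv d v (f + f') (g + g') := by
  intro φ hφ hc hs
  have e1 : ∫ p in strip d, (fderiv ℝ φ p v) • (f + f' : L2Strip d) p
      = ∫ p in strip d, ((fderiv ℝ φ p v) • f p + (fderiv ℝ φ p v) • f' p) := by
    refine integral_congr_ae ?_
    filter_upwards [Lp.coeFn_add f f'] with p hp
    rw [hp, Pi.add_apply, smul_add]
  have e2 : ∫ p in strip d, φ p • (g + g' : L2Strip d) p
      = ∫ p in strip d, (φ p • g p + φ p • g' p) := by
    refine integral_congr_ae ?_
    filter_upwards [Lp.coeFn_add g g'] with p hp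
    rw [hp, Pi.add_apply, smul_add]
  rw [e1, e2, integral_add (integrable_fderiv_smul_L2Strip d v φ hφ hc f)
    (integrable_fderiv_smul_L2Strip d v φ hφ hc f'),
    integral_add (integrable_smul_L2Strip d φ hφ.continuous hc g)
    (integrable_smul_L2Strip d φ hφ.continuous hc g'), h φ hφ hc hs, h' φ hφ hc hs]
  ring

theorem IsWeakDeriv.smul {d : ℝ} {v : ℝ × ℝ} {f g : L2Strip d} (c : ℂ)
    (h : IsWeakDeriv d v f g) : IsWeakDeriv d v (c • f) (c • g) := by
  intro φ hφ hc hs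
  have e1 : ∫ p in strip d, (fderiv ℝ φ p v) • (c • f : L2Strip d) p
      = ∫ p in strip d, c • ((fderiv ℝ φ p v) • f p) := by
    refine integral_congr_ae ?_
    filter_upwards [Lp.coeFn_smul c f] with p hp
    rw [hp, Pi.smul_apply, smul_comm]
  have e2 : ∫ p in strip d, φ p • (c • g : L2Strip d) p
      = ∫ p in strip d, c • (φ p • g p) := by
    refine integral_congr_ae ?_
    filter_upwards [Lp.coeFn_smul c g] with p hp
    rw [hp, Pi.smul_apply, smul_comm]
  rw [e1, e2, integral_smul, integral_smul, h φ hφ hc hs, smul_neg]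

/-- Weak derivatives are unique. -/
theorem IsWeakDeriv.unique {d : ℝ} {v : ℝ × ℝ} {f g g' : L2Strip d}
    (h : IsWeakDeriv d v f g) (h' : IsWeakDeriv d v f g') : g = g' := by
  have key : ∀ᵐ p, p ∈ strip d → (g p - g' p) = 0 := by
    refine (isOpen_strip d).ae_eq_zero_of_integral_contDiff_smul_eq_zero
      (f := fun p => g p - g' p) ?_ ?_
    · have hl : ∀ k : L2Strip d, LocallyIntegrableOn k (strip d) volume := fun k =>
        locallyIntegrableOn_of_locallyIntegrable_restrict
          ((Lp.memLp k).locallyIntegrable (by norm_num))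
      exact (hl g).sub (hl g')
    · intro φ hφ hc hs
      have e : ∫ p, φ p • (g p - g' p) = ∫ p in strip d, (φ p • g p - φ p • g' p) := by
        rw [← setIntegral_eq_integral_of_forall_compl_eq_zero (s := strip d)]
        · simp only [smul_sub]
        · intro p hp
          have : φ p = 0 := image_eq_zero_of_notMem_tsupport (fun hh => hp (hs hh))
          simp [this]
      rw [e, integral_sub (integrable_smul_L2Strip d φ hφ.continuous hc g)
        (integrable_smul_L2Strip d φ hφ.continuous hc g'), sub_eq_zero]
      have := (h φ hφ hc hs).symm.trans (h' φ hφ hc hs)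
      exact neg_injective this
  refine Lp.ext ?_
  rw [Filter.EventuallyEq, ae_restrict_iff' (isOpen_strip d).measurableSet]
  filter_upwards [key] with p hp hps
  exact sub_eq_zero.1 (hp hps)

theorem IsWeakDeriv.weakDeriv_eq {d : ℝ} {v : ℝ × ℝ} {f g : L2Strip d}
    (h : IsWeakDeriv d v f g) : weakDeriv d v f = g := by
  have hex : ∃ g, IsWeakDeriv d v f g := ⟨g, h⟩
  rw [weakDeriv, dif_pos hex]
  exact hex.choose_spec.unique h

theorem isWeakDeriv_zero (d : ℝ) (v : ℝ × ℝ) : IsWeakDeriv d v 0 0 := by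
  simpa using IsWeakDeriv.smul 0 (f := (0 : L2Strip d)) (g := 0) (v := v)
    (by
      intro φ hφ hc hs
      have hz : ∀ ψ : ℝ × ℝ → ℝ, ∫ p in strip d, ψ p • (0 : L2Strip d) p = 0 := by
        intro ψ
        rw [integral_eq_zero_of_ae]
        filter_upwards [Lp.coeFn_zero ℂ 2 (volume.restrict (strip d))] with p hp
        rw [hp]; simp
      rw [hz, hz, neg_zero])

/-- The Sobolev space `W^{1,2}(Ω)`: both first order weak derivatives exist in `L²(Ω)`. -/
def W12 (d : ℝ) : Submodule ℂ (L2Strip d) where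
  carrier := {f | (∃ g, IsWeakDeriv d (1, 0) f g) ∧ (∃ g, IsWeakDeriv d (0, 1) f g)}
  add_mem' := by
    rintro f f' ⟨⟨a, ha⟩, ⟨b, hb⟩⟩ ⟨⟨a', ha'⟩, ⟨b', hb'⟩⟩
    exact ⟨⟨_, ha.add ha'⟩, ⟨_, hb.add hb'⟩⟩
  zero_mem' := ⟨⟨0, isWeakDeriv_zero d _⟩, ⟨0, isWeakDeriv_zero d _⟩⟩
  smul_mem' := by
    rintro c f ⟨⟨a, ha⟩, ⟨b, hb⟩⟩
    exact ⟨⟨_, ha.smul c⟩, ⟨_, hb.smul c⟩⟩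

/-- The weak partial derivative `∂_x f` of a function `f ∈ W^{1,2}(Ω)`. -/
noncomputable def weakDx (d : ℝ) : W12 d →ₗ[ℂ] L2Strip d where
  toFun f := weakDeriv d (1, 0) f
  map_add' := by
    rintro ⟨f, ⟨a, ha⟩, _⟩ ⟨f', ⟨a', ha'⟩, _⟩
    change weakDeriv d (1, 0) (f + f') = weakDeriv d (1, 0) f + weakDeriv d (1, 0) f'
    rw [(ha.add ha').weakDeriv_eq, ha.weakDeriv_eq, ha'.weakDeriv_eq]
  map_smul' := by
    rintro c ⟨f, ⟨a, ha⟩, _⟩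
    change weakDeriv d (1, 0) (c • f) = c • weakDeriv d (1, 0) f
    rw [(ha.smul c).weakDeriv_eq, ha.weakDeriv_eq]

/-- The weak partial derivative `∂_y f` of a function `f ∈ W^{1,2}(Ω)`. -/
noncomputable def weakDy (d : ℝ) : W12 d →ₗ[ℂ] L2Strip d where
  toFun f := weakDeriv d (0, 1) f
  map_add' := by
    rintro ⟨f, _, ⟨a, ha⟩⟩ ⟨f', _, ⟨a', ha'⟩⟩
    change weakDeriv d (0, 1) (f + f') = weakDeriv d (0, 1) f + weakDeriv d (0, 1) f'
    rw [(ha.add ha').weakDeriv_eq, ha.weakDeriv_eq, ha'.weakDeriv_eq]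
  map_smul' := by
    rintro c ⟨f, _, ⟨a, ha⟩⟩
    change weakDeriv d (0, 1) (c • f) = c • weakDeriv d (0, 1) f
    rw [(ha.smul c).weakDeriv_eq, ha.weakDeriv_eq]

/-- `f ∈ W^{2,2}(Ω)`: `f` and its two first order weak derivatives belong to `W^{1,2}(Ω)`. -/
structure MemW22 (d : ℝ) (f : L2Strip d) : Prop where
  mem : f ∈ W12 d
  dx_mem : weakDx d ⟨f, mem⟩ ∈ W12 d
  dy_mem : weakDy d ⟨f, mem⟩ ∈ W12 d

/-- `g : ℝ → ℂ` is the trace on the line `y = c` (`c ∈ [0, d]`) of `f ∈ W^{1,2}(Ω)`.  A function in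
`W^{1,2}(Ω)` has a representative `F` whose restriction to almost every vertical segment
`{x} × [0, d]` is continuous (even absolutely continuous); these restrictions are unique for
almost every `x`, and the trace is `x ↦ F (x, c)`. -/
def IsTrace (d c : ℝ) (f : L2Strip d) (g : ℝ → ℂ) : Prop :=
  ∃ F : ℝ × ℝ → ℂ, F =ᵐ[volume.restrict (strip d)] f ∧
    ∀ᵐ x : ℝ, ContinuousOn (fun y => F (x, y)) (Icc 0 d) ∧ F (x, c) = g x

theorem IsTrace.add {d c : ℝ} {f f' : L2Strip d} {g g' : ℝ → ℂ}
    (h : IsTrace d c f g) (h' : IsTrace d c f' g') : IsTrace d c (f + f') (g + g') := by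
  obtain ⟨F, hF, hc⟩ := h
  obtain ⟨F', hF', hc'⟩ := h'
  refine ⟨F + F', (hF.add hF').trans (Lp.coeFn_add f f').symm, ?_⟩
  filter_upwards [hc, hc'] with x hx hx'
  exact ⟨hx.1.add hx'.1, by simp [hx.2, hx'.2]⟩

theorem IsTrace.smul {d c : ℝ} {f : L2Strip d} {g : ℝ → ℂ} (a : ℂ)
    (h : IsTrace d c f g) : IsTrace d c (a • f) (a • g) := by
  obtain ⟨F, hF, hc⟩ := h
  refine ⟨a • F, (hF.const_smul a).trans (Lp.coeFn_smul a f).symm, ?_⟩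
  filter_upwards [hc] with x hx
  exact ⟨hx.1.const_smul a, by simp [hx.2]⟩

theorem isTrace_zero (d c : ℝ) : IsTrace d c 0 0 :=
  ⟨0, (Lp.coeFn_zero ℂ 2 (volume.restrict (strip d))).symm,
    Filter.Eventually.of_forall fun _ => ⟨continuousOn_const, rfl⟩⟩

/-! ### The Robin Laplacian -/

/-- The Robin boundary conditions with coupling function `α`, in the sense of traces:
`-∂_y ψ(x,0) + α(x) ψ(x,0) = 0` and `∂_y ψ(x,d) + α(x) ψ(x,d) = 0`.
Here `ψy` is the derivative `∂_y ψ`. -/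
def RobinBC (d : ℝ) (α : ℝ → ℝ) (ψ ψy : L2Strip d) : Prop :=
  ∃ t₀ n₀ t₁ n₁ : ℝ → ℂ,
    IsTrace d 0 ψ t₀ ∧ IsTrace d 0 ψy n₀ ∧ IsTrace d d ψ t₁ ∧ IsTrace d d ψy n₁ ∧
    (∀ᵐ x : ℝ, - n₀ x + (α x : ℂ) * t₀ x = 0) ∧
    (∀ᵐ x : ℝ, n₁ x + (α x : ℂ) * t₁ x = 0)

theorem RobinBC.add {d : ℝ} {α : ℝ → ℝ} {ψ ψy ψ' ψy' : L2Strip d}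
    (h : RobinBC d α ψ ψy) (h' : RobinBC d α ψ' ψy') : RobinBC d α (ψ + ψ') (ψy + ψy') := by
  obtain ⟨t₀, n₀, t₁, n₁, h1, h2, h3, h4, h5, h6⟩ := h
  obtain ⟨s₀, m₀, s₁, m₁, k1, k2, k3, k4, k5, k6⟩ := h'
  refine ⟨_, _, _, _, h1.add k1, h2.add k2, h3.add k3, h4.add k4, ?_, ?_⟩
  · filter_upwards [h5, k5] with x hx kx
    simp only [Pi.add_apply]
    linear_combination hx + kx
  · filter_upwards [h6, k6] with x hx kx
    simp only [Pi.add_apply]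
    linear_combination hx + kx

theorem RobinBC.smul {d : ℝ} {α : ℝ → ℝ} {ψ ψy : L2Strip d} (c : ℂ)
    (h : RobinBC d α ψ ψy) : RobinBC d α (c • ψ) (c • ψy) := by
  obtain ⟨t₀, n₀, t₁, n₁, h1, h2, h3, h4, h5, h6⟩ := h
  refine ⟨_, _, _, _, h1.smul c, h2.smul c, h3.smul c, h4.smul c, ?_, ?_⟩
  · filter_upwards [h5] with x hx
    simp only [Pi.smul_apply, smul_eq_mul]
    linear_combination c * hx
  · filter_upwards [h6] with x hx
    simp only [Pi.smul_apply, smul_eq_mul]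
    linear_combination c * hx

theorem MemW22.add {d : ℝ} {f f' : L2Strip d} (h : MemW22 d f) (h' : MemW22 d f') :
    MemW22 d (f + f') where
  mem := (W12 d).add_mem h.mem h'.mem
  dx_mem := by
    have := (W12 d).add_mem h.dx_mem h'.dx_mem
    rwa [← map_add] at this
  dy_mem := by
    have := (W12 d).add_mem h.dy_mem h'.dy_mem
    rwa [← map_add] at this

theorem MemW22.smul {d : ℝ} {f : L2Strip d} (c : ℂ) (h : MemW22 d f) : MemW22 d (c • f) where
  mem := (W12 d).smul_mem c h.mem
  dx_mem := by
    have := (W12 d).smul_mem c h.dx_mem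
    rwa [← map_smul] at this
  dy_mem := by
    have := (W12 d).smul_mem c h.dy_mem
    rwa [← map_smul] at this

theorem memW22_zero (d : ℝ) : MemW22 d 0 where
  mem := (W12 d).zero_mem
  dx_mem := by
    have : weakDx d ⟨0, (W12 d).zero_mem⟩ = 0 := (weakDx d).map_zero
    rw [this]; exact (W12 d).zero_mem
  dy_mem := by
    have : weakDy d ⟨0, (W12 d).zero_mem⟩ = 0 := (weakDy d).map_zero
    rw [this]; exact (W12 d).zero_mem

/-- The domain `D(H_α)`: the functions in `W^{2,2}(Ω)` that satisfy the Robin boundary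
conditions. -/
def robinDomain (d : ℝ) (α : ℝ → ℝ) : Submodule ℂ (L2Strip d) where
  carrier := {ψ | ∃ h : MemW22 d ψ, RobinBC d α ψ (weakDy d ⟨ψ, h.mem⟩)}
  add_mem' := by
    rintro f f' ⟨h, hb⟩ ⟨h', hb'⟩
    refine ⟨h.add h', ?_⟩
    have := hb.add hb'
    rwa [← map_add] at this
  zero_mem' := by
    refine ⟨memW22_zero d, ?_⟩
    have e : weakDy d ⟨0, (W12 d).zero_mem⟩ = 0 := (weakDy d).map_zero
    rw [e]
    exact ⟨0, 0, 0, 0, isTrace_zero d 0, isTrace_zero d 0, isTrace_zero d d, isTrace_zero d d,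
      by simp, by simp⟩
  smul_mem' := by
    rintro c f ⟨h, hb⟩
    refine ⟨h.smul c, ?_⟩
    have := hb.smul c
    rwa [← map_smul] at this

/-- The Robin Laplacian `H_α ψ = -Δψ = -(∂_x ∂_x ψ + ∂_y ∂_y ψ)` on `D(H_α)`. -/
noncomputable def robinLaplacian (d : ℝ) (α : ℝ → ℝ) : L2Strip d →ₗ.[ℂ] L2Strip d where
  domain := robinDomain d α
  toFun :=
    { toFun := fun ψ =>
        -(weakDx d ⟨weakDx d ⟨ψ, ψ.2.1.mem⟩, ψ.2.1.dx_mem⟩ +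
          weakDy d ⟨weakDy d ⟨ψ, ψ.2.1.mem⟩, ψ.2.1.dy_mem⟩)
      map_add' := by
        intro ψ ψ'
        have ex : (⟨weakDx d ⟨((ψ + ψ' : robinDomain d α) : L2Strip d), (ψ + ψ').2.1.mem⟩,
            (ψ + ψ').2.1.dx_mem⟩ : W12 d) = ⟨weakDx d ⟨ψ, ψ.2.1.mem⟩, ψ.2.1.dx_mem⟩ +
            ⟨weakDx d ⟨ψ', ψ'.2.1.mem⟩, ψ'.2.1.dx_mem⟩ :=
          Subtype.ext ((weakDx d).map_add ⟨ψ, ψ.2.1.mem⟩ ⟨ψ', ψ'.2.1.mem⟩)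
        have ey : (⟨weakDy d ⟨((ψ + ψ' : robinDomain d α) : L2Strip d), (ψ + ψ').2.1.mem⟩,
            (ψ + ψ').2.1.dy_mem⟩ : W12 d) = ⟨weakDy d ⟨ψ, ψ.2.1.mem⟩, ψ.2.1.dy_mem⟩ +
            ⟨weakDy d ⟨ψ', ψ'.2.1.mem⟩, ψ'.2.1.dy_mem⟩ :=
          Subtype.ext ((weakDy d).map_add ⟨ψ, ψ.2.1.mem⟩ ⟨ψ', ψ'.2.1.mem⟩)
        rw [ex, ey, map_add, map_add]
        abel
      map_smul' := by
        intro c ψ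
        have ex : (⟨weakDx d ⟨((c • ψ : robinDomain d α) : L2Strip d), (c • ψ).2.1.mem⟩,
            (c • ψ).2.1.dx_mem⟩ : W12 d) = c • ⟨weakDx d ⟨ψ, ψ.2.1.mem⟩, ψ.2.1.dx_mem⟩ :=
          Subtype.ext ((weakDx d).map_smul c ⟨ψ, ψ.2.1.mem⟩)
        have ey : (⟨weakDy d ⟨((c • ψ : robinDomain d α) : L2Strip d), (c • ψ).2.1.mem⟩,
            (c • ψ).2.1.dy_mem⟩ : W12 d) = c • ⟨weakDy d ⟨ψ, ψ.2.1.mem⟩, ψ.2.1.dy_mem⟩ :=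
          Subtype.ext ((weakDy d).map_smul c ⟨ψ, ψ.2.1.mem⟩)
        rw [ex, ey, map_smul, map_smul, ← smul_add, ← smul_neg]
        rfl }

/-! ### The coupling function and the transversal problem -/

/-- `α ∈ W^{1,∞}(ℝ)`: `α` is essentially bounded and has an essentially bounded weak
derivative. -/
def MemW1Infty (α : ℝ → ℝ) : Prop :=
  MemLp α ⊤ volume ∧ ∃ β : ℝ → ℝ, MemLp β ⊤ volume ∧
    ∀ φ : ℝ → ℝ, ContDiff ℝ ∞ φ → HasCompactSupport φ →
      ∫ x, α x * deriv φ x = - ∫ x, β x * φ x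

/-- The eigenvalues of the transversal problem with constant coupling `a`: the numbers `E` for
which `-u'' = E u` on `(0, d)`, `-u'(0) + a u(0) = 0`, `u'(d) + a u(d) = 0` has a nontrivial
solution. -/
def transversalEigenvalues (d a : ℝ) : Set ℝ :=
  {E | ∃ u : ℝ → ℝ, ContDiff ℝ 2 u ∧ (∃ y ∈ Ioo 0 d, u y ≠ 0) ∧
    (∀ y ∈ Ioo 0 d, - deriv (deriv u) y = E * u y) ∧
    - deriv u 0 + a * u 0 = 0 ∧ deriv u d + a * u d = 0}

/-- The first transversal eigenvalue `E₁(a)`: the least transversal eigenvalue (the infimum is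
attained for `d > 0`, `a > 0`). -/
noncomputable def firstTransversalEigenvalue (d a : ℝ) : ℝ :=
  sInf (transversalEigenvalues d a)

/-! ### Spectral theory of a positive operator that is small off a finite dimensional space -/

section AbstractSpectral

variable {E : Type*} [NormedAddCommGroup E] [InnerProductSpace ℂ E]

/-! Write `α₀ = k tan (k d / 2)` with `0 < k d < π`. The transversal ground state is `cos (k (y - d
/ 2))`, with energy `k²`; only `k² ≤ E₁(α₀)` is needed (`sq_le_firstTransversalEigenvalue`). The
operator `H + 1` belongs to the form `q(u) = ‖u‖² + ‖∇u‖² + ∫ α (|u(x,0)|² + |u(x,d)|²)` on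
`W^{1,2}(Ω)`. Its inverse `R` is bounded and positive, and `‖u‖² ≤ ‖R‖ q(u)`. Points of the spectrum
of `H` other than `-1` correspond to points of the spectrum of `R` under `z ↦ (z + 1)⁻¹`, so the
candidate for the lowest point is `‖R‖⁻¹ - 1`.

Two estimates carry the theorem. First, a long plateau in `x` times the transversal ground state has
`q(u) < (k² + 1) ‖u‖²`: the plateau costs arbitrarily little kinetic energy, while its boundary
energy relative to `α₀` tends to a positive multiple of `∫ (α - α₀) < 0` (`exists_trial_function`).
Hence `‖R‖ > (k² + 1)⁻¹`. Second, the same inequality persists for some `k' < k`. Since `α` is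
Lipschitz up to a null set and `α - α₀` is integrable, `α` exceeds `k' tan (k' d / 2)` outside a
bounded interval. Outside, the transversal inequality on fibres bounds the form below; inside, a
Poincaré inequality on small rectangles does so after finitely many orthogonality conditions
(`exists_finiteDimensional_form_lower_bound`). Thus `R` has norm at most `(k'² + 1)⁻¹ < ‖R‖` off a
finite dimensional space.

A positive operator of this kind is a compact perturbation of one with norm below `‖R‖`. The
Fredholm alternative then makes `‖R‖` an isolated eigenvalue of finite multiplicity
(`norm_isolated_eigenvalue`), and `UnboundedOp.lowest_mem_discreteSpectrum` transfers this to `H`.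
Neither the spectral theorem nor the min-max principle is used.

The remaining work identifies the form inverse with the inverse of the operator defined through
`W^{2,2}` and traces. Functions with a vertical weak derivative are primitives on almost every
fibre, which makes traces bounded operators of the function and its derivative. Horizontal
difference quotients give `∂_x ∇u ∈ L²`, because the translation commutator of `α` is controlled by
its Lipschitz constant. The equation then gives `∂_y ∂_y u`, and testing with functions that do not
vanish on the boundary gives the Robin conditions (`form_solution_mem_domain`). -/

theorem isCompactOperator_comp_starProjection (B : E →L[ℂ] E) (W : Submodule ℂ E)
    [FiniteDimensional ℂ W] : IsCompactOperator (B * W.starProjection) := by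
  have h : IsCompactOperator W.orthogonalProjectionOnto := by
    have : ProperSpace W := FiniteDimensional.proper ℂ W
    exact isCompactOperator_of_locallyCompactSpace_dom W.orthogonalProjectionOnto
  exact h.clm_comp (B.comp W.subtypeL)

/-- With `R = (T + 1)⁻¹` one has `(T - z) R = 1 - (z + 1) R`, so `R (1 - (z + 1) R)⁻¹` is the
inverse of `T - z`. The form with `1 - (z + 1) R` also covers `z = -1`. -/
theorem UnboundedOp.mem_resolventSet_of_isUnit {T : E →ₗ.[ℂ] E} {R : E →L[ℂ] E}
    (h1 : ∀ f, ∃ h : R f ∈ T.domain, T ⟨R f, h⟩ + R f = f)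
    (h2 : ∀ u : T.domain, R (T u + u) = u) {z : ℂ}
    (hz : IsUnit (1 - (z + 1) • R : E →L[ℂ] E)) : z ∈ UnboundedOp.resolventSet T := by
  obtain ⟨U, hU⟩ := hz
  have hl : ∀ f, (↑U⁻¹ : E →L[ℂ] E) f - (z + 1) • R ((↑U⁻¹ : E →L[ℂ] E) f) = f := fun f => by
    have := congrArg (fun B : E →L[ℂ] E => B f) U.mul_inv
    simpa [hU] using this
  have hr : ∀ f, (↑U⁻¹ : E →L[ℂ] E) (f - (z + 1) • R f) = f := fun f => by
    have := congrArg (fun B : E →L[ℂ] E => B f) U.inv_mul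
    simpa [hU] using this
  refine ⟨R * (↑U⁻¹ : E →L[ℂ] E), fun f => ?_, fun u => ?_⟩
  · obtain ⟨h, hT⟩ := h1 ((↑U⁻¹ : E →L[ℂ] E) f)
    refine ⟨h, ?_⟩
    have h3 := hl f
    change T ⟨R ((↑U⁻¹ : E →L[ℂ] E) f), h⟩ - z • R ((↑U⁻¹ : E →L[ℂ] E) f) = f
    rw [eq_sub_of_add_eq hT]
    nth_rewrite 4 [← h3]
    module
  · have h3 := h2 u
    have e : T u - z • (u : E) = (T u + u) - (z + 1) • R (T u + u) := by
      rw [h3]; module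
    rw [e, mul_apply_eq_comp, hr, h3]

variable [CompleteSpace E]

/-- Fredholm alternative for a compact perturbation of an operator of norm less than `‖z‖`. -/
theorem isUnit_of_compact_perturbation {A C : E →L[ℂ] E} {z : ℂ} (hA : ‖A‖ < ‖z‖)
    (hC : IsCompactOperator C) (hinj : ∀ u, (A + C) u = z • u → u = 0) :
    IsUnit (algebraMap ℂ (E →L[ℂ] E) z - (A + C)) := by
  have hu : IsUnit (algebraMap ℂ (E →L[ℂ] E) z - A) := by
    have hz : ‖A‖ * ‖(1 : E →L[ℂ] E)‖ < ‖z‖ := by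
      refine lt_of_le_of_lt ?_ hA
      exact mul_le_of_le_one_right (norm_nonneg _) ContinuousLinearMap.norm_id_le
    exact spectrum.mem_resolventSet_iff.1 (spectrum.mem_resolventSet_of_norm_lt_mul hz)
  obtain ⟨U, hU⟩ := hu
  -- Factoring out the invertible `U = z - A` leaves `1 - D` with `D` compact, so the only
  -- obstruction to invertibility is an eigenvector of `D` for the eigenvalue `1`.
  set D : E →L[ℂ] E := (↑U⁻¹ : E →L[ℂ] E) * C with hD
  have hDc : IsCompactOperator D := hC.clm_comp (↑U⁻¹ : E →L[ℂ] E)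
  have hfac : algebraMap ℂ (E →L[ℂ] E) z - (A + C) = U * (1 - D) := by
    rw [hD, mul_sub, mul_one, ← mul_assoc, Units.mul_inv, one_mul, hU]; abel
  rw [hfac]
  refine U.isUnit.mul ?_
  rcases hDc.hasEigenvalue_or_mem_resolventSet (one_ne_zero (α := ℂ)) with h | h
  · exfalso
    obtain ⟨u, hu⟩ := h.exists_hasEigenvector
    apply hu.2
    apply hinj
    have h1 : D u = u := by simpa using hu.apply_eq_smul
    have h2 : (algebraMap ℂ (E →L[ℂ] E) z - (A + C)) u = 0 := by
      rw [hfac, mul_apply_eq_comp, sub_apply,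
        one_apply_eq_self, h1, sub_self, map_zero]
    rw [sub_apply, sub_eq_zero] at h2
    rw [← h2, Algebra.algebraMap_eq_smul_one]; simp
  · have := spectrum.mem_resolventSet_iff.1 h
    rwa [map_one] at this

/-- A positive operator `R` whose restriction to `Wᗮ` has norm less than `‖R‖` has `‖R‖` as an
isolated eigenvalue of finite multiplicity. -/
theorem norm_isolated_eigenvalue {R : E →L[ℂ] E} (hR : 0 ≤ R) (W : Submodule ℂ E)
    [FiniteDimensional ℂ W] {m : ℝ} (hm0 : 0 ≤ m) (hm : m < ‖R‖)
    (hW : ∀ f ∈ Wᗮ, ‖R f‖ ≤ m * ‖f‖) :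
    (∃ u, u ≠ 0 ∧ R u = (‖R‖ : ℂ) • u) ∧
    FiniteDimensional ℂ (LinearMap.ker ((R - (‖R‖ : ℂ) • 1 : E →L[ℂ] E) : E →ₗ[ℂ] E)) ∧
    ∃ δ > 0, ∀ z : ℂ, ‖z - ‖R‖‖ < δ → z ≠ ‖R‖ → IsUnit (algebraMap ℂ (E →L[ℂ] E) z - R) := by
  set M : ℝ := ‖R‖ with hM
  have hMpos : 0 < M := hm0.trans_lt hm
  have hMne : (M : ℂ) ≠ 0 := by exact_mod_cast hMpos.ne'
  -- Split `R` along `Wᗮ` and `W`: the first part has norm at most `m < ‖R‖`, the second has finite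
  -- rank.
  set A : E →L[ℂ] E := R * Wᗮ.starProjection with hAdef
  have hAn : ‖A‖ < ‖(M : ℂ)‖ := by
    have h1 : ‖A‖ ≤ m := by
      refine ContinuousLinearMap.opNorm_le_bound _ hm0 fun f => ?_
      refine (hW _ (Wᗮ.starProjection_apply_mem f)).trans ?_
      gcongr
      exact Submodule.norm_starProjection_apply_le _ _
    rw [Complex.norm_real, Real.norm_of_nonneg hMpos.le]
    exact h1.trans_lt hm
  have hK := isCompactOperator_comp_starProjection R W
  have hsum : R = A + R * W.starProjection := by
    rw [hAdef, ← mul_add, Submodule.starProjection_orthogonal']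
    simp
  have : Nontrivial (E →L[ℂ] E) := ⟨R, 0, by rintro h; rw [hM, h, norm_zero] at hMpos; exact hMpos.false⟩
  -- For a nonnegative element of a C⋆-algebra the norm lies in the spectrum; the Fredholm
  -- alternative upgrades this spectral point to an eigenvalue.
  have hspec : (M : ℂ) ∈ spectrum ℂ R := by
    have := CStarAlgebra.norm_mem_spectrum_of_nonneg (A := E →L[ℂ] E) hR
    exact spectrum.algebraMap_mem ℂ this
  have heig : ∃ u, u ≠ 0 ∧ R u = (M : ℂ) • u := by
    by_contra hcon
    push Not at hcon
    apply hspec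
    rw [spectrum.mem_resolventSet_iff, hsum]
    refine isUnit_of_compact_perturbation hAn hK fun u hu => ?_
    by_contra hne
    rw [← hsum] at hu
    exact hcon u hne hu
  set N := LinearMap.ker ((R - (M : ℂ) • 1 : E →L[ℂ] E) : E →ₗ[ℂ] E) with hN
  have hNmem : ∀ u, u ∈ N ↔ R u = (M : ℂ) • u := fun u => by
    rw [hN, LinearMap.mem_ker]
    simp [sub_eq_zero]
  -- The projection onto `W` is injective on the eigenspace: an eigenvector in `Wᗮ` would satisfy `M
  -- ‖u‖ ≤ m ‖u‖` with `m < M`.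
  have hfin : FiniteDimensional ℂ N := by
    let ι : N →ₗ[ℂ] W := (W.orthogonalProjectionOnto : E →ₗ[ℂ] W).comp N.subtype
    refine FiniteDimensional.of_injective ι ?_
    rw [injective_iff_map_eq_zero]
    rintro ⟨u, hu⟩ hz
    have huW : u ∈ Wᗮ := by
      rw [← Submodule.orthogonalProjectionOnto_eq_zero_iff]; exact hz
    have h1 := hW u huW
    rw [(hNmem u).1 hu, norm_smul, Complex.norm_real, Real.norm_of_nonneg hMpos.le] at h1
    have : ‖u‖ = 0 := by
      by_contra hne
      have : 0 < ‖u‖ := lt_of_le_of_ne (norm_nonneg _) (Ne.symm hne)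
      nlinarith
    exact Subtype.ext (norm_eq_zero.1 this)
  refine ⟨heig, hfin, ?_⟩
  set Q : E →L[ℂ] E := N.starProjection with hQ
  have hQN : ∀ u, Q u ∈ N := fun u => N.starProjection_apply_mem u
  have hQid : ∀ u ∈ N, Q u = u := fun u hu => N.starProjection_eq_self_iff.2 hu
  have hRQ : R * Q = (M : ℂ) • Q := by
    ext u; exact (hNmem _).1 (hQN u)
  have hQR : Q * R = (M : ℂ) • Q := by
    have h := congrArg star hRQ
    have hRs : star R = R := (IsSelfAdjoint.of_nonneg hR)
    have hQs : star Q = Q := (isSelfAdjoint_starProjection N)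
    simpa [star_mul, hRs, hQs] using h
  have hQQ : Q * Q = Q := by
    ext u; exact hQid _ (hQN u)
  -- Deflation: removing the eigenspace turns `M` into a regular point of `R'`, and regular points
  -- form an open set.
  set R' : E →L[ℂ] E := R - (M : ℂ) • Q with hR'
  have hR'Q : R' * Q = 0 := by
    rw [hR', sub_mul, hRQ, smul_mul_assoc, hQQ, sub_self]
  have hQR' : Q * R' = 0 := by
    rw [hR', mul_sub, hQR, mul_smul_comm, hQQ, sub_self]
  have hres : (M : ℂ) ∈ resolventSet ℂ R' := by
    rw [spectrum.mem_resolventSet_iff]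
    have hcomp : IsCompactOperator (R * W.starProjection - (M : ℂ) • Q : E →L[ℂ] E) := by
      have h2 := isCompactOperator_comp_starProjection (1 : E →L[ℂ] E) N
      rw [one_mul] at h2
      exact hK.sub (h2.smul (M : ℂ))
    have e : R' = A + (R * W.starProjection - (M : ℂ) • Q) := by
      rw [hR']; nth_rewrite 1 [hsum]; abel
    rw [e]
    refine isUnit_of_compact_perturbation hAn hcomp fun u hu => ?_
    rw [← e] at hu
    have h0 : Q u = 0 := by
      have h1 : Q (R' u) = 0 := by
        rw [← mul_apply_eq_comp, hQR']; rfl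
      rw [hu, map_smul] at h1
      exact (smul_eq_zero.1 h1).resolve_left hMne
    have h2 : R u = (M : ℂ) • u := by
      rw [← hu, hR']; simp [h0]
    rw [← hQid u ((hNmem u).2 h2), h0]
  obtain ⟨δ, hδ, hball⟩ := Metric.isOpen_iff.1 (spectrum.isOpen_resolventSet (𝕜 := ℂ) R') _ hres
  -- The radius `M` keeps `z` away from `0`, since the factorization below divides by `z`.
  refine ⟨min δ M, lt_min hδ hMpos, fun z hz hzM => ?_⟩
  have hz0 : z ≠ 0 := by
    rintro rfl
    have := hz.trans_le (min_le_right _ _)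
    rw [zero_sub, norm_neg, Complex.norm_real, Real.norm_of_nonneg hMpos.le] at this
    exact this.false
  have hu1 : IsUnit (algebraMap ℂ (E →L[ℂ] E) z - R') := by
    rw [← spectrum.mem_resolventSet_iff]
    apply hball
    rw [Metric.mem_ball, dist_eq_norm]
    exact hz.trans_le (min_le_left _ _)
  have hzM' : z - M ≠ 0 := sub_ne_zero.2 hzM
  -- Regularity passes from `R'` back to `R` because `R' Q = 0`; the second factor has the explicit
  -- inverse `1 + (M / (z - M)) Q`, which exists exactly because `z ≠ M`.
  have hfac : algebraMap ℂ (E →L[ℂ] E) z - R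
      = (algebraMap ℂ (E →L[ℂ] E) z - R') * (1 - ((M : ℂ) / z) • Q) := by
    rw [mul_sub, mul_one, mul_smul_comm, sub_mul, hR'Q, Algebra.algebraMap_eq_smul_one,
      smul_mul_assoc, one_mul, sub_zero, smul_smul, div_mul_cancel₀ _ hz0, hR']
    abel
  rw [hfac]
  refine hu1.mul ?_
  have hc : ∀ a b : ℂ, (1 - a • Q) * (1 + b • Q) = 1 + (b - a - a * b) • Q := by
    intro a b
    rw [sub_mul, mul_add, mul_add, smul_mul_smul_comm, hQQ, one_mul, one_mul, mul_one, sub_smul,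
      sub_smul]
    abel
  have hc' : ∀ a b : ℂ, (1 + b • Q) * (1 - a • Q) = 1 + (b - a - a * b) • Q := by
    intro a b
    rw [add_mul, mul_sub, mul_sub, smul_mul_smul_comm, hQQ, one_mul, one_mul, mul_one, sub_smul,
      sub_smul, mul_comm b a]
    abel
  have hab : (M / (z - M) : ℂ) - M / z - M / z * (M / (z - M)) = 0 := by
    field_simp
    ring
  exact ⟨⟨1 - ((M : ℂ) / z) • Q, 1 + ((M : ℂ) / (z - M)) • Q, by rw [hc, hab]; simp,
    by rw [hc', hab]; simp⟩, rfl⟩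

/-- If `(T + 1)⁻¹` exists as a bounded positive operator `R` and `R` is small off a finite
dimensional subspace, then `‖R‖⁻¹ - 1` is the lowest point of the real spectrum of `T`, and it is
a discrete eigenvalue. -/
theorem UnboundedOp.lowest_mem_discreteSpectrum {T : E →ₗ.[ℂ] E} {R : E →L[ℂ] E}
    (h1 : ∀ f, ∃ h : R f ∈ T.domain, T ⟨R f, h⟩ + R f = f)
    (h2 : ∀ u : T.domain, R (T u + u) = u) (hR : 0 ≤ R) (W : Submodule ℂ E)
    [FiniteDimensional ℂ W] {m : ℝ} (hm0 : 0 ≤ m) (hm : m < ‖R‖)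
    (hW : ∀ f ∈ Wᗮ, ‖R f‖ ≤ m * ‖f‖) :
    ((‖R‖⁻¹ - 1 : ℝ) : ℂ) ∈ UnboundedOp.discreteSpectrum T ∧
    ∀ s : ℝ, (s : ℂ) ∈ UnboundedOp.spectrum T → ‖R‖⁻¹ - 1 ≤ s := by
  obtain ⟨⟨u, hu0, hu⟩, hfin, δ, hδ, hiso⟩ := norm_isolated_eigenvalue hR W hm0 hm hW
  set M : ℝ := ‖R‖ with hM
  have hMpos : 0 < M := hm0.trans_lt hm
  have hMne : (M : ℂ) ≠ 0 := by exact_mod_cast hMpos.ne'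
  have hnt : Nontrivial (E →L[ℂ] E) :=
    ⟨R, 0, by rintro h; rw [hM, h, norm_zero] at hMpos; exact hMpos.false⟩
  have hTeig : ∀ v : E, (∃ h : v ∈ T.domain, T ⟨v, h⟩ = ((M⁻¹ - 1 : ℝ) : ℂ) • v) ↔
      R v = (M : ℂ) • v := by
    intro v
    constructor
    · rintro ⟨h, hv⟩
      have h3 := h2 ⟨v, h⟩
      rw [hv] at h3
      have e : ((M⁻¹ - 1 : ℝ) : ℂ) • v + v = (M : ℂ)⁻¹ • v := by push_cast; module
      simp only [e, map_smul] at h3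
      rw [inv_smul_eq_iff₀ hMne] at h3
      exact h3
    · intro hv
      obtain ⟨h, hT⟩ := h1 ((M : ℂ)⁻¹ • v)
      have e : R ((M : ℂ)⁻¹ • v) = v := by rw [map_smul, hv, inv_smul_smul₀ hMne]
      have h' : v ∈ T.domain := e ▸ h
      refine ⟨h', ?_⟩
      have e2 : (⟨R ((M : ℂ)⁻¹ • v), h⟩ : T.domain) = ⟨v, h'⟩ := Subtype.ext e
      rw [e2, e] at hT
      rw [eq_sub_of_add_eq hT]; push_cast; module
  have heigspace : UnboundedOp.eigenspace T ((M⁻¹ - 1 : ℝ) : ℂ) =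
      LinearMap.ker ((R - (M : ℂ) • 1 : E →L[ℂ] E) : E →ₗ[ℂ] E) := by
    ext v
    have hr : v ∈ LinearMap.ker ((R - (M : ℂ) • 1 : E →L[ℂ] E) : E →ₗ[ℂ] E) ↔
        R v = (M : ℂ) • v := by
      rw [LinearMap.mem_ker]; simp [sub_eq_zero]
    rw [hr, ← hTeig v, UnboundedOp.eigenspace, Submodule.mem_map]
    constructor
    · rintro ⟨⟨w, hw⟩, hk, rfl⟩
      refine ⟨hw, ?_⟩
      rw [LinearMap.mem_ker, LinearMap.sub_apply, sub_eq_zero] at hk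
      exact hk
    · rintro ⟨h, hv⟩
      refine ⟨⟨v, h⟩, ?_, rfl⟩
      rw [LinearMap.mem_ker, LinearMap.sub_apply, sub_eq_zero]
      exact hv
  have humem : u ∈ UnboundedOp.eigenspace T ((M⁻¹ - 1 : ℝ) : ℂ) := by
    rw [heigspace, LinearMap.mem_ker]; simp [hu]
  have hspec : ((M⁻¹ - 1 : ℝ) : ℂ) ∈ UnboundedOp.spectrum T := by
    rintro ⟨S, -, hS⟩
    obtain ⟨h, hv⟩ := (hTeig u).2 hu
    have h3 := hS ⟨u, h⟩
    rw [hv, sub_self, map_zero] at h3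
    exact hu0 h3.symm
  -- Spectral mapping for the resolvent: `1 - (z + 1) R = (z + 1) ((z + 1)⁻¹ - R)`.
  have hinv : ∀ z : ℂ, z + 1 ≠ 0 →
      IsUnit (algebraMap ℂ (E →L[ℂ] E) (z + 1)⁻¹ - R) → z ∈ UnboundedOp.resolventSet T := by
    intro z hz hun
    apply UnboundedOp.mem_resolventSet_of_isUnit h1 h2
    have e : (1 - (z + 1) • R : E →L[ℂ] E)
        = algebraMap ℂ (E →L[ℂ] E) (z + 1) * (algebraMap ℂ (E →L[ℂ] E) (z + 1)⁻¹ - R) := by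
      rw [mul_sub, ← map_mul, mul_inv_cancel₀ hz, map_one, Algebra.algebraMap_eq_smul_one,
        smul_mul_assoc, one_mul]
    rw [e]
    exact ((isUnit_iff_ne_zero.2 hz).map (algebraMap ℂ (E →L[ℂ] E))).mul hun
  refine ⟨⟨hspec, ?_, ?_, ?_⟩, ?_⟩
  · have hcont : ContinuousAt (fun z : ℂ => (z + 1)⁻¹) ((M⁻¹ - 1 : ℝ) : ℂ) := by
      apply ContinuousAt.inv₀ (by fun_prop)
      push_cast
      simpa using hMne
    have hval : (((M⁻¹ - 1 : ℝ) : ℂ) + 1)⁻¹ = M := by push_cast; simp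
    rw [Metric.continuousAt_iff] at hcont
    obtain ⟨ε, hε, hc⟩ := hcont δ hδ
    -- The candidate eigenvalue lies at distance `M⁻¹` from `-1`, so this radius excludes the pole
    -- of `w ↦ (w + 1)⁻¹`.
    refine ⟨min ε M⁻¹, lt_min hε (inv_pos.2 hMpos), fun w hw hd => ?_⟩
    by_contra hne
    apply hw
    have hw1 : w + 1 ≠ 0 := by
      intro h0
      have h3 := hd.trans_le (min_le_right _ _)
      have : w - ((M⁻¹ - 1 : ℝ) : ℂ) = -((M⁻¹ : ℝ) : ℂ) := by
        rw [eq_neg_of_add_eq_zero_left h0]; push_cast; ring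
      rw [this, norm_neg, Complex.norm_real, Real.norm_of_nonneg (inv_pos.2 hMpos).le] at h3
      exact h3.false
    apply hinv w hw1
    apply hiso
    · have := hc (x := w) (by rw [dist_eq_norm]; exact hd.trans_le (min_le_left _ _))
      rwa [hval, dist_eq_norm] at this
    · intro h3
      apply hne
      rw [← hval] at h3
      have := inv_injective h3
      exact add_right_cancel this
  · intro hbot
    rw [hbot] at humem
    exact hu0 ((Submodule.mem_bot ℂ).1 humem)
  · rw [heigspace]; exact hfin
  · intro s hs
    by_contra hlt
    push Not at hlt
    apply hs
    by_cases hs1 : (s : ℂ) + 1 = 0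
    · apply UnboundedOp.mem_resolventSet_of_isUnit h1 h2
      rw [hs1]; simp
    apply hinv _ hs1
    by_contra hns
    -- The spectrum of the positive operator `R` lies in `[0, M]`, so `0 ≤ (s + 1)⁻¹ ≤ M`, which
    -- forces `s ≥ M⁻¹ - 1`.
    have hmem : ((s : ℂ) + 1)⁻¹ ∈ _root_.spectrum ℂ R := hns
    have hmemR : ((s + 1)⁻¹ : ℝ) ∈ _root_.spectrum ℝ R := by
      rw [← spectrum.algebraMap_mem_iff ℂ]
      simpa using hmem
    have hnn : 0 ≤ (s + 1)⁻¹ := spectrum_nonneg_of_nonneg hR hmemR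
    have hle : ‖((s + 1)⁻¹ : ℝ)‖ ≤ M :=
      (spectrum.norm_le_norm_mul_of_mem hmemR).trans
        (mul_le_of_le_one_right (norm_nonneg _) ContinuousLinearMap.norm_id_le)
    rw [Real.norm_of_nonneg hnn] at hle
    have hs1' : s + 1 ≠ 0 := by exact_mod_cast hs1
    have hspos : 0 < s + 1 := lt_of_le_of_ne (inv_nonneg.1 hnn) (Ne.symm hs1')
    have := inv_anti₀ (inv_pos.2 hspos) hle
    rw [inv_inv] at this
    linarith

end AbstractSpectral

/-! ### One dimensional inequalities -/

section OneDim

open intervalIntegral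

/-- Integration by parts for two primitives of integrable functions. -/
theorem integral_primitive_mul_add {a b : ℝ} (hab : a ≤ b) {g₁ g₂ : ℝ → ℂ}
    (h₁ : IntervalIntegrable g₁ volume a b) (h₂ : IntervalIntegrable g₂ volume a b) (t₁ t₂ : ℂ) :
    ∫ y in a..b, ((t₁ + ∫ s in a..y, g₁ s) * g₂ y + g₁ y * (t₂ + ∫ s in a..y, g₂ s))
      = (t₁ + ∫ s in a..b, g₁ s) * (t₂ + ∫ s in a..b, g₂ s) - t₁ * t₂ := by
  set μ := volume.restrict (Ioc a b) with hμ
  have i₁ : Integrable g₁ μ := (intervalIntegrable_iff_integrableOn_Ioc_of_le hab).1 h₁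
  have i₂ : Integrable g₂ μ := (intervalIntegrable_iff_integrableOn_Ioc_of_le hab).1 h₂
  have hA : ∀ y ∈ Ioc a b, ∫ s in a..y, g₁ s = ∫ s, (Iic y).indicator g₁ s ∂μ := by
    intro y hy
    rw [integral_of_le hy.1.le, MeasureTheory.integral_indicator measurableSet_Iic, hμ,
      Measure.restrict_restrict measurableSet_Iic]
    congr 2
    ext s; simp only [mem_Ioc, mem_inter_iff, mem_Iic]
    constructor
    · rintro ⟨h, h'⟩; exact ⟨h', h, h'.trans hy.2⟩
    · rintro ⟨h', h, _⟩; exact ⟨h, h'⟩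
  have hB : ∀ y ∈ Ioc a b, ∫ s in a..y, g₂ s = ∫ s, (Iio y).indicator g₂ s ∂μ := by
    intro y hy
    rw [integral_of_le hy.1.le, MeasureTheory.integral_indicator measurableSet_Iio, hμ,
      Measure.restrict_restrict measurableSet_Iio, MeasureTheory.integral_Ioc_eq_integral_Ioo]
    congr 2
    ext s; simp only [mem_Ioo, mem_Ioc, mem_inter_iff, mem_Iio]
    constructor
    · rintro ⟨h, h'⟩; exact ⟨h', h, h'.le.trans hy.2⟩
    · rintro ⟨h', h, _⟩; exact ⟨h, h'⟩
  have hp : Integrable (fun p : ℝ × ℝ => g₁ p.1 * g₂ p.2) (μ.prod μ) := i₁.mul_prod i₂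
  -- Fubini on the square: the two iterated integrals run over the two triangles below and above the
  -- diagonal. Taking `Iic` in one and `Iio` in the other makes the triangles exact complements.
  set S : Set (ℝ × ℝ) := {p | p.1 ≤ p.2} with hS
  have hSm : MeasurableSet S := measurableSet_le measurable_fst measurable_snd
  have hk₁ := hp.indicator hSm
  have hk₂ := hp.indicator hSm.compl
  have e₁ : ∫ y, (∫ s, (Iic y).indicator g₁ s ∂μ) * g₂ y ∂μ
      = ∫ p, S.indicator (fun p : ℝ × ℝ => g₁ p.1 * g₂ p.2) p ∂(μ.prod μ) := by
    rw [integral_prod_symm _ hk₁]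
    refine integral_congr_ae (.of_forall fun y => ?_)
    simp only
    rw [← MeasureTheory.integral_mul_const]
    refine integral_congr_ae (.of_forall fun s => ?_)
    by_cases h : s ≤ y <;> simp [hS, h]
  have e₂ : ∫ s, g₁ s * (∫ y, (Iio s).indicator g₂ y ∂μ) ∂μ
      = ∫ p, Sᶜ.indicator (fun p : ℝ × ℝ => g₁ p.1 * g₂ p.2) p ∂(μ.prod μ) := by
    rw [integral_prod _ hk₂]
    refine integral_congr_ae (.of_forall fun y => ?_)
    simp only
    rw [← MeasureTheory.integral_const_mul]
    refine integral_congr_ae (.of_forall fun s => ?_)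
    by_cases h : s < y <;> simp [hS, h]
  have e₃ : (∫ p, S.indicator (fun p : ℝ × ℝ => g₁ p.1 * g₂ p.2) p ∂(μ.prod μ))
      + ∫ p, Sᶜ.indicator (fun p : ℝ × ℝ => g₁ p.1 * g₂ p.2) p ∂(μ.prod μ)
      = (∫ s, g₁ s ∂μ) * ∫ s, g₂ s ∂μ := by
    rw [← MeasureTheory.integral_add hk₁ hk₂, ← integral_prod_mul]
    refine integral_congr_ae (.of_forall fun p => ?_)
    exact congrFun (indicator_self_add_compl S _) p
  have c₁ : IntervalIntegrable (fun y => (∫ s in a..y, g₁ s) * g₂ y) volume a b :=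
    h₂.continuousOn_mul (continuousOn_primitive_interval'
      h₁ left_mem_uIcc)
  have c₂ : IntervalIntegrable (fun y => g₁ y * ∫ s in a..y, g₂ s) volume a b :=
    h₁.mul_continuousOn (continuousOn_primitive_interval'
      h₂ left_mem_uIcc)
  have e₄ : ∫ y in a..b, (∫ s in a..y, g₁ s) * g₂ y
      = ∫ y, (∫ s, (Iic y).indicator g₁ s ∂μ) * g₂ y ∂μ := by
    rw [integral_of_le hab]
    exact setIntegral_congr_fun measurableSet_Ioc fun y hy => by simp only [hA y hy]
  have e₅ : ∫ y in a..b, g₁ y * ∫ s in a..y, g₂ s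
      = ∫ y, g₁ y * (∫ s, (Iio y).indicator g₂ s ∂μ) ∂μ := by
    rw [integral_of_le hab]
    exact setIntegral_congr_fun measurableSet_Ioc fun y hy => by simp only [hB y hy]
  have e₆ : ∫ y in a..b, ((t₁ + ∫ s in a..y, g₁ s) * g₂ y + g₁ y * (t₂ + ∫ s in a..y, g₂ s))
      = (∫ y in a..b, (t₁ * g₂ y + g₁ y * t₂)) + ((∫ y in a..b, (∫ s in a..y, g₁ s) * g₂ y)
        + ∫ y in a..b, g₁ y * ∫ s in a..y, g₂ s) := by
    rw [← integral_add c₁ c₂, ← integral_add ((h₂.const_mul t₁).add (h₁.mul_const t₂)) (c₁.add c₂)]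
    refine integral_congr fun y _ => ?_
    ring
  rw [e₆, e₄, e₅, e₁, e₂, e₃, integral_add (h₂.const_mul t₁) (h₁.mul_const t₂),
    intervalIntegral.integral_const_mul, intervalIntegral.integral_mul_const, integral_of_le hab, integral_of_le hab]
  ring

/-- The Cauchy-Schwarz inequality for the integral over a finite measure space. -/
theorem norm_integral_sq_le {X : Type*} [MeasurableSpace X] {μ : Measure X} [IsFiniteMeasure μ]
    {g : X → ℂ} (hg : MemLp g 2 μ) :
    ‖∫ x, g x ∂μ‖ ^ 2 ≤ μ.real univ * ∫ x, ‖g x‖ ^ 2 ∂μ := by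
  have h2 : Integrable (fun x => ‖g x‖ ^ 2) μ := (memLp_two_iff_integrable_sq_norm hg.1).1 hg
  have h1 : Integrable (fun x => ‖g x‖) μ := (hg.integrable (by norm_num)).norm
  have hle : ‖∫ x, g x ∂μ‖ ≤ ∫ x, ‖g x‖ ∂μ := norm_integral_le_integral_norm _
  set I := ∫ x, ‖g x‖ ∂μ
  have hI : 0 ≤ I := integral_nonneg fun _ => norm_nonneg _
  set m := μ.real univ with hm
  have hm0 : 0 ≤ m := measureReal_nonneg
  -- The quadratic polynomial `l ↦ ∫ (‖g‖ - l)²` is nonnegative; its minimum, at `l = I / m`, gives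
  -- the claim.
  have hq : ∀ l : ℝ, 0 ≤ (∫ x, ‖g x‖ ^ 2 ∂μ) - 2 * l * I + l ^ 2 * m := by
    intro l
    have e : (∫ x, ‖g x‖ ^ 2 ∂μ) - 2 * l * I + l ^ 2 * m = ∫ x, (‖g x‖ - l) ^ 2 ∂μ := by
      have : ∀ x, (‖g x‖ - l) ^ 2 = (‖g x‖ ^ 2 - 2 * l * ‖g x‖) + l ^ 2 := fun x => by ring
      simp_rw [this]
      have h3 : Integrable (fun x => 2 * l * ‖g x‖) μ := h1.const_mul _
      have h4 : Integrable (fun x => ‖g x‖ ^ 2 - 2 * l * ‖g x‖) μ := h2.sub h3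
      rw [MeasureTheory.integral_add h4 (integrable_const _),
        MeasureTheory.integral_sub h2 h3, MeasureTheory.integral_const_mul,
        MeasureTheory.integral_const]
      simp [hm, mul_comm, I]
    rw [e]
    exact integral_nonneg fun _ => sq_nonneg _
  have hsq : ‖∫ x, g x ∂μ‖ ^ 2 ≤ I ^ 2 := by gcongr
  refine hsq.trans ?_
  rcases hm0.eq_or_lt with h0 | hpos
  · have : μ = 0 := by
      rw [← Measure.measure_univ_eq_zero]
      exact (measureReal_eq_zero_iff).1 (hm ▸ h0.symm)
    have hI0 : I = 0 := by simp [I, this]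
    rw [hI0, ← h0]; simp
  · have := hq (I / m)
    have e : (∫ x, ‖g x‖ ^ 2 ∂μ) - 2 * (I / m) * I + (I / m) ^ 2 * m
        = ((m * ∫ x, ‖g x‖ ^ 2 ∂μ) - I ^ 2) / m := by field_simp; ring
    rw [e] at this
    have := (div_nonneg_iff.1 this)
    rcases this with h | h
    · linarith [h.1]
    · linarith [h.2]

/-- The Poincaré inequality on an interval. -/
theorem integral_sub_average_sq_le {a b : ℝ} (hab : a < b) {g : ℝ → ℂ}
    (hg : MemLp g 2 (volume.restrict (Ioo a b))) (t : ℂ) {w : ℝ → ℂ}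
    (hw : ∀ᵐ y ∂volume.restrict (Ioo a b), w y = t + ∫ s in a..y, g s) :
    ∫ y in Ioo a b, ‖w y - (b - a : ℝ)⁻¹ • ∫ s in Ioo a b, w s‖ ^ 2
      ≤ (b - a) ^ 2 * ∫ s in Ioo a b, ‖g s‖ ^ 2 := by
  set μ := volume.restrict (Ioo a b) with hμ
  have hba : 0 < b - a := sub_pos.2 hab
  have hvol : μ.real univ = b - a := by simp [hμ, measureReal_def, hba.le]
  have hgi : Integrable g μ := hg.integrable (by norm_num)
  have hgi' : IntervalIntegrable g volume a b := by
    rw [intervalIntegrable_iff_integrableOn_Ioo_of_le hab.le]; exact hgi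
  set v : ℝ → ℂ := fun y => t + ∫ s in a..y, g s with hv
  have hvc : ContinuousOn v (uIcc a b) :=
    continuousOn_const.add (continuousOn_primitive_interval' hgi' left_mem_uIcc)
  have hvi : Integrable v μ := by
    have := (hvc.intervalIntegrable (μ := volume))
    rw [intervalIntegrable_iff_integrableOn_Ioo_of_le hab.le] at this
    exact this
  set G := ∫ s, ‖g s‖ ^ 2 ∂μ with hG
  have hG0 : 0 ≤ G := integral_nonneg fun _ => sq_nonneg _
  have hgsq : Integrable (fun s => ‖g s‖ ^ 2) μ := (memLp_two_iff_integrable_sq_norm hg.1).1 hg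
  have hdiff' : ∀ y ∈ Ioo a b, ∀ z ∈ Ioo a b, y ≤ z → ‖v y - v z‖ ^ 2 ≤ (b - a) * G := by
    intro y hy z hz hyz
    have hsub : Ioo y z ⊆ Ioo a b := Ioo_subset_Ioo hy.1.le hz.2.le
    have hIcc : ∀ y ∈ Ioo a b, IntervalIntegrable g volume a y := fun y hy =>
      hgi'.mono_set (by rw [uIcc_of_le hab.le, uIcc_of_le hy.1.le]; exact Icc_subset_Icc_right hy.2.le)
    have e : v z - v y = ∫ s in Ioo y z, g s := by
      rw [← MeasureTheory.integral_Ioc_eq_integral_Ioo, ← integral_of_le hyz]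
      simp only [hv, add_sub_add_left_eq_sub]
      exact integral_interval_sub_left (hIcc z hz) (hIcc y hy)
    rw [norm_sub_rev, e]
    refine (norm_integral_sq_le (hg.mono_measure (Measure.restrict_mono hsub le_rfl))).trans ?_
    have : (volume.restrict (Ioo y z)).real univ = z - y := by
      simp [measureReal_def, sub_nonneg.2 hyz]
    rw [this]
    refine mul_le_mul (by linarith [hy.1, hz.2]) ?_ (integral_nonneg fun _ => sq_nonneg _) hba.le
    exact setIntegral_mono_set hgsq (.of_forall fun _ => sq_nonneg _) hsub.eventuallyLE
  have hdiff : ∀ y ∈ Ioo a b, ∀ z ∈ Ioo a b, ‖v y - v z‖ ≤ Real.sqrt ((b - a) * G) := by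
    intro y hy z hz
    apply Real.le_sqrt_of_sq_le
    rcases le_total y z with h | h
    · exact hdiff' y hy z hz h
    · rw [norm_sub_rev]; exact hdiff' z hz y hy h
  have hmean : ∫ s, w s ∂μ = ∫ s, v s ∂μ := integral_congr_ae hw
  rw [hmean]
  -- The deviation from the mean is the mean of the differences `v y - v s`, each bounded by
  -- Cauchy-Schwarz on the segment between the two points.
  have hpt : ∀ y ∈ Ioo a b, ‖v y - (b - a : ℝ)⁻¹ • ∫ s, v s ∂μ‖ ^ 2 ≤ (b - a) * G := by
    intro y hy
    have e : v y - (b - a : ℝ)⁻¹ • ∫ s, v s ∂μ = (b - a : ℝ)⁻¹ • ∫ s, (v y - v s) ∂μ := by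
      rw [MeasureTheory.integral_sub (integrable_const _) hvi, MeasureTheory.integral_const, hvol,
        smul_sub, smul_smul, inv_mul_cancel₀ hba.ne', one_smul]
    have h1 : ‖∫ s, (v y - v s) ∂μ‖ ≤ Real.sqrt ((b - a) * G) * μ.real univ := by
      apply MeasureTheory.norm_integral_le_of_norm_le_const
      rw [hμ]
      filter_upwards [ae_restrict_mem measurableSet_Ioo] with z hz
      exact hdiff y hy z hz
    rw [hvol] at h1
    have h2 : ‖v y - (b - a : ℝ)⁻¹ • ∫ s, v s ∂μ‖ ≤ Real.sqrt ((b - a) * G) := by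
      rw [e, norm_smul, norm_inv, Real.norm_of_nonneg hba.le, inv_mul_le_iff₀ hba, mul_comm]
      exact h1
    calc _ ≤ Real.sqrt ((b - a) * G) ^ 2 := by gcongr
      _ = _ := Real.sq_sqrt (by positivity)
  have hfin : ∫ y, ‖w y - (b - a : ℝ)⁻¹ • ∫ s, v s ∂μ‖ ^ 2 ∂μ ≤ ∫ y, (b - a) * G ∂μ := by
    apply integral_mono_of_nonneg (.of_forall fun _ => sq_nonneg _) (integrable_const _)
    filter_upwards [hw, (ae_restrict_mem measurableSet_Ioo : ∀ᵐ y ∂μ, y ∈ Ioo a b)] with y hy hy'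
    simp only [hy]
    exact hpt y hy'
  refine hfin.trans (le_of_eq ?_)
  rw [MeasureTheory.integral_const, hvol, smul_eq_mul]; ring

/-- The ground state energy inequality for the transversal problem with coupling
`k tan (k d / 2)`. -/
theorem transversal_inequality {d k : ℝ} (hd : 0 < d) (hk : 0 < k) (hkd : k * d < Real.pi)
    {g : ℝ → ℂ} (hg : MemLp g 2 (volume.restrict (Ioo 0 d))) (t : ℂ) {w : ℝ → ℂ}
    (hw : ∀ y, w y = t + ∫ s in (0 : ℝ)..y, g s) :
    k ^ 2 * ∫ y in Ioo 0 d, ‖w y‖ ^ 2 ≤ (∫ y in Ioo 0 d, ‖g y‖ ^ 2)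
      + k * Real.tan (k * d / 2) * (‖w 0‖ ^ 2 + ‖w d‖ ^ 2) := by
  have hgi' : IntervalIntegrable g volume 0 d := by
    rw [intervalIntegrable_iff_integrableOn_Ioo_of_le hd.le]; exact hg.integrable (by norm_num)
  have hgsq : IntervalIntegrable (fun y => ‖g y‖ ^ 2) volume 0 d := by
    rw [intervalIntegrable_iff_integrableOn_Ioo_of_le hd.le]
    exact (memLp_two_iff_integrable_sq_norm hg.1).1 hg
  have hgc : IntervalIntegrable (fun y => star (g y)) volume 0 d := by
    rw [intervalIntegrable_iff_integrableOn_Ioo_of_le hd.le] at hgi' ⊢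
    exact Complex.conjCLE.toContinuousLinearMap.integrable_comp hgi'
  have hwc : ContinuousOn w (uIcc 0 d) := by
    rw [show w = _ from funext hw]
    exact continuousOn_const.add (continuousOn_primitive_interval' hgi' left_mem_uIcc)
  -- `h` is the logarithmic derivative of the ground state `cos (k (y - d / 2))`, smooth on `[0, d]`
  -- because `k d < π`. It solves the Riccati equation `h' = -k² - h²`, and its values at `0` and
  -- `d` are plus and minus the coupling constant.
  set h : ℝ → ℝ := fun y => -k * Real.tan (k * (y - d / 2)) with hh
  have hcos : ∀ y ∈ Icc 0 d, Real.cos (k * (y - d / 2)) ≠ 0 := by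
    intro y hy
    apply ne_of_gt
    apply Real.cos_pos_of_mem_Ioo
    constructor <;> nlinarith [hy.1, hy.2]
  have hder : ∀ y ∈ Icc 0 d, HasDerivAt h (-k ^ 2 - h y ^ 2) y := by
    intro y hy
    have h1 := (Real.hasDerivAt_tan (hcos y hy)).comp y
      (((hasDerivAt_id y).sub_const (d / 2)).const_mul k)
    have h2 := h1.const_mul (-k)
    refine h2.congr_deriv ?_
    simp only [hh]
    rw [Real.tan_eq_sin_div_cos]
    have h3 := Real.sin_sq_add_cos_sq (k * (y - d / 2))
    have h4 := hcos y hy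
    generalize Real.cos (k * (y - d / 2)) = c at *
    generalize Real.sin (k * (y - d / 2)) = s at *
    field_simp
    linear_combination h3
  have hhc : ContinuousOn h (uIcc 0 d) := by
    rw [uIcc_of_le hd.le]
    exact fun y hy => (hder y hy).continuousAt.continuousWithinAt
  set h' : ℝ → ℝ := fun y => -k ^ 2 - h y ^ 2 with hh'
  have hh'c : ContinuousOn h' (uIcc 0 d) := continuousOn_const.sub (hhc.pow 2)
  have hh'i : IntervalIntegrable (fun y => (h' y : ℂ)) volume 0 d :=
    (Complex.continuous_ofReal.comp_continuousOn hh'c).intervalIntegrable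
  have hprim : ∀ y ∈ Icc 0 d, (h y : ℂ) = h 0 + ∫ s in (0 : ℝ)..y, (h' s : ℂ) := by
    intro y hy
    have hsub : uIcc 0 y ⊆ Icc 0 d := by
      rw [uIcc_of_le hy.1]; exact Icc_subset_Icc_right hy.2
    have := integral_eq_sub_of_hasDerivAt (fun s hs => hder s (hsub hs))
      ((hh'c.mono (by rw [uIcc_of_le hd.le]; exact hsub)).intervalIntegrable)
    rw [intervalIntegral.integral_ofReal, this]
    push_cast; ring
  set p : ℝ → ℂ := fun y => w y * star (g y) + g y * star (w y) with hp
  have hpi : IntervalIntegrable p volume 0 d :=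
    (hgc.continuousOn_mul hwc).add (hgi'.mul_continuousOn (continuous_star.comp_continuousOn hwc))
  have hwsq : ∀ y ∈ Icc 0 d, ((‖w y‖ ^ 2 : ℝ) : ℂ) = ((‖w 0‖ ^ 2 : ℝ) : ℂ) + ∫ s in (0 : ℝ)..y, p s := by
    intro y hy
    have hsub : uIcc 0 y ⊆ uIcc 0 d := by
      rw [uIcc_of_le hy.1, uIcc_of_le hd.le]; exact Icc_subset_Icc_right hy.2
    have h1 := integral_primitive_mul_add hy.1 (hgi'.mono_set hsub) (hgc.mono_set hsub) t (star t)
    have hst : ∀ z, star (w z) = star t + ∫ s in (0 : ℝ)..z, star (g s) := by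
      intro z
      rw [hw z, star_add]
      congr 1
      simp only [intervalIntegral, star_sub]
      simp only [RCLike.star_def, integral_conj]
    have hw0 : w 0 = t := by rw [hw]; simp
    simp only [← hw, ← hst] at h1
    have h2 : ∀ z : ℂ, ((‖z‖ ^ 2 : ℝ) : ℂ) = z * star z := fun z => by
      rw [RCLike.star_def, Complex.mul_conj, Complex.normSq_eq_norm_sq]
    rw [hp, h1, h2, h2, hw0]; ring
  have key := integral_primitive_mul_add hd.le hpi hh'i ((‖w 0‖ ^ 2 : ℝ) : ℂ) (h 0)
  have h0d : (0:ℝ) ≤ d := hd.le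
  rw [← hwsq d ⟨h0d, le_rfl⟩, ← hprim d ⟨h0d, le_rfl⟩] at key
  have key2 : ∫ y in (0 : ℝ)..d, (‖w y‖ ^ 2 * h' y + 2 * (g y * star (w y)).re * h y)
      = ‖w d‖ ^ 2 * h d - ‖w 0‖ ^ 2 * h 0 := by
    have e : (∫ y in (0 : ℝ)..d, (((‖w y‖ ^ 2 * h' y + 2 * (g y * star (w y)).re * h y : ℝ) : ℂ)))
        = ((‖w d‖ ^ 2 * h d - ‖w 0‖ ^ 2 * h 0 : ℝ) : ℂ) := by
      push_cast at key ⊢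
      rw [← key]
      refine integral_congr fun y hy => ?_
      rw [uIcc_of_le h0d] at hy
      have h3 := hwsq y hy
      push_cast at h3
      rw [← h3, ← hprim y hy]
      have h4 : p y = ((2 * (g y * star (w y)).re : ℝ) : ℂ) := by
        have : w y * star (g y) = star (g y * star (w y)) := by simp [mul_comm]
        rw [hp]; simp only [this]
        rw [add_comm, RCLike.star_def, Complex.add_conj]
      rw [h4]; push_cast; ring
    rw [intervalIntegral.integral_ofReal] at e
    exact_mod_cast e
  have hint1 : IntervalIntegrable (fun y => ‖w y‖ ^ 2) volume 0 d :=
    (hwc.norm.pow 2).intervalIntegrable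
  have hint2 : IntervalIntegrable (fun y => ‖w y‖ ^ 2 * h' y + 2 * (g y * star (w y)).re * h y)
      volume 0 d := by
    refine ((hwc.norm.pow 2).mul hh'c).intervalIntegrable.add ?_
    refine IntervalIntegrable.mul_continuousOn ?_ hhc
    refine IntervalIntegrable.const_mul ?_ 2
    have := hgi'.mul_continuousOn (continuous_star.comp_continuousOn hwc)
    rw [intervalIntegrable_iff_integrableOn_Ioo_of_le hd.le] at this ⊢
    exact this.re
  -- Expanding `|g - h w|² ≥ 0` and using the Riccati equation, the integrand is `(|w|² h)' + k²
  -- |w|² ≤ |g|²`; the exact derivative was integrated in `key2`.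
  have hmono : ∫ y in (0 : ℝ)..d, ((‖w y‖ ^ 2 * h' y + 2 * (g y * star (w y)).re * h y)
      + k ^ 2 * ‖w y‖ ^ 2) ≤ ∫ y in (0 : ℝ)..d, ‖g y‖ ^ 2 := by
    refine integral_mono_on h0d (hint2.add (hint1.const_mul _)) hgsq fun y hy => ?_
    have h5 : ‖g y - (h y : ℂ) * w y‖ ^ 2
        = ‖g y‖ ^ 2 - 2 * (g y * star (w y)).re * h y + h y ^ 2 * ‖w y‖ ^ 2 := by
      simp only [← Complex.normSq_eq_norm_sq, Complex.normSq_apply, Complex.sub_re, Complex.sub_im,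
        Complex.mul_re, Complex.mul_im, Complex.ofReal_re, Complex.ofReal_im, RCLike.star_def,
        Complex.conj_re, Complex.conj_im]
      ring
    have h6 : 0 ≤ ‖g y - (h y : ℂ) * w y‖ ^ 2 := sq_nonneg _
    rw [h5] at h6
    simp only [hh']
    linarith
  rw [integral_add hint2 (hint1.const_mul _), key2, intervalIntegral.integral_const_mul] at hmono
  have hh0 : h 0 = k * Real.tan (k * d / 2) := by
    simp only [hh]
    rw [show k * (0 - d / 2) = -(k * d / 2) by ring, Real.tan_neg]; ring
  have hhd : h d = -(k * Real.tan (k * d / 2)) := by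
    simp only [hh]
    rw [show k * (d - d / 2) = k * d / 2 by ring]; ring
  rw [hh0, hhd, integral_of_le h0d, integral_of_le h0d, MeasureTheory.integral_Ioc_eq_integral_Ioo,
    MeasureTheory.integral_Ioc_eq_integral_Ioo] at hmono
  linarith

/-- After multiplication by the cosine the equation reads `k sin (k d / 2) - a cos (k d / 2) = 0`,
which is continuous up to `k = π / d`; the left side goes from `-a` to `π / d`. -/
theorem exists_transversal_wavenumber {d a : ℝ} (hd : 0 < d) (ha : 0 < a) :
    ∃ k, 0 < k ∧ k * d < Real.pi ∧ k * Real.tan (k * d / 2) = a := by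
  have hpi := Real.pi_pos
  set F : ℝ → ℝ := fun k => k * Real.sin (k * d / 2) - a * Real.cos (k * d / 2) with hF
  have hFc : ContinuousOn F (Icc 0 (Real.pi / d)) := by fun_prop
  have h0 : F 0 = -a := by simp [hF]
  have h1 : F (Real.pi / d) = Real.pi / d := by
    simp only [hF]
    rw [div_mul_cancel₀ _ hd.ne', Real.sin_pi_div_two, Real.cos_pi_div_two]; ring
  have hpd : 0 < Real.pi / d := by positivity
  obtain ⟨k, hk, hk0⟩ := intermediate_value_Ioo hpd.le hFc
    (show (0 : ℝ) ∈ Ioo (F 0) (F (Real.pi / d)) by rw [h0, h1]; exact ⟨by linarith, hpd⟩)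
  have hkd : k * d < Real.pi := (lt_div_iff₀ hd).1 hk.2
  have hkd0 : 0 < k * d := mul_pos hk.1 hd
  refine ⟨k, hk.1, hkd, ?_⟩
  have hc : Real.cos (k * d / 2) ≠ 0 :=
    (Real.cos_pos_of_mem_Ioo ⟨by linarith, by linarith⟩).ne'
  rw [Real.tan_eq_sin_div_cos, mul_div_assoc', div_eq_iff hc]
  simp only [hF] at hk0
  linarith

theorem transversal_coupling_strictMono {d k k' : ℝ} (hd : 0 < d) (hk' : 0 < k') (h : k' < k)
    (hkd : k * d < Real.pi) : k' * Real.tan (k' * d / 2) < k * Real.tan (k * d / 2) := by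
  have h0 : 0 < k' * d := mul_pos hk' hd
  have h1 : k' * d < k * d := by nlinarith
  have ht : Real.tan (k' * d / 2) < Real.tan (k * d / 2) :=
    Real.tan_lt_tan_of_lt_of_lt_pi_div_two (by linarith [Real.pi_pos]) (by linarith) (by linarith)
  have hp : 0 < Real.tan (k' * d / 2) := Real.tan_pos_of_pos_of_lt_pi_div_two (by linarith) (by linarith)
  nlinarith

/-- Put an eigenfunction `u` into `transversal_inequality`: integration by parts and the boundary
conditions turn the right side into `E ∫ u²`. The cosine is exhibited as an eigenfunction because
the lower bound for the infimum requires a nonempty set. -/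
theorem sq_le_firstTransversalEigenvalue {d k : ℝ} (hd : 0 < d) (hk : 0 < k)
    (hkd : k * d < Real.pi) :
    k ^ 2 ≤ firstTransversalEigenvalue d (k * Real.tan (k * d / 2)) := by
  have hc0 : 0 < Real.cos (k * d / 2) :=
    Real.cos_pos_of_mem_Ioo ⟨by nlinarith [Real.pi_pos, mul_pos hk hd], by linarith⟩
  refine le_csInf ?_ ?_
  · set u : ℝ → ℝ := fun y => Real.cos (k * (y - d / 2)) with hu
    have hlin : ∀ y, HasDerivAt (fun y => k * (y - d / 2)) k y := fun y => by
      simpa using ((hasDerivAt_id y).sub_const (d / 2)).const_mul k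
    have hd1 : deriv u = fun y => -k * Real.sin (k * (y - d / 2)) := by
      ext y
      rw [((hlin y).cos).deriv]; ring
    have hd2 : deriv (deriv u) = fun y => -k ^ 2 * u y := by
      rw [hd1]; ext y
      rw [(((hlin y).sin).const_mul (-k)).deriv]; simp only [hu]; ring
    refine ⟨k ^ 2, u, by fun_prop, ⟨d / 2, ⟨by linarith, by linarith⟩, by simp [hu]⟩, ?_, ?_, ?_⟩
    · intro y _; rw [hd2]; ring
    · rw [hd1]; simp only [hu]
      rw [show k * (0 - d / 2) = -(k * d / 2) by ring, Real.sin_neg, Real.cos_neg,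
        Real.tan_eq_sin_div_cos]
      field_simp; ring
    · rw [hd1]; simp only [hu]
      rw [show k * (d - d / 2) = k * d / 2 by ring, Real.tan_eq_sin_div_cos]
      field_simp; ring
  · rintro E ⟨u, hu, ⟨y₀, hy₀, hne⟩, hode, hb0, hbd⟩
    have hu1 : Differentiable ℝ u := hu.differentiable (by norm_num)
    have hu' : ContDiff ℝ 1 (deriv u) := by
      have : ContDiff ℝ (1 + 1) u := by norm_num; exact hu
      exact (contDiff_succ_iff_deriv.1 this).2.2
    have hu2 : Differentiable ℝ (deriv u) := hu'.differentiable (by norm_num)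
    have hc1 : Continuous (deriv u) := hu'.continuous
    have hc2 : Continuous (deriv (deriv u)) := hu'.continuous_deriv (by norm_num)
    have hcc : Continuous u := hu.continuous
    have hprim : ∀ y, (u y : ℂ) = u 0 + ∫ s in (0 : ℝ)..y, ((deriv u s : ℝ) : ℂ) := by
      intro y
      rw [intervalIntegral.integral_ofReal, integral_deriv_eq_sub (fun x _ => hu1 x)
        (hc1.intervalIntegrable _ _)]
      push_cast; ring
    have hmem : MemLp (fun s => ((deriv u s : ℝ) : ℂ)) 2 (volume.restrict (Ioo 0 d)) := by
      have hcont : Continuous (fun s => ((deriv u s : ℝ) : ℂ)) := by fun_prop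
      obtain ⟨C, hC⟩ := isCompact_Icc.exists_bound_of_continuousOn (s := Icc (0:ℝ) d) hcont.continuousOn
      refine MemLp.of_bound hcont.aestronglyMeasurable C ?_
      filter_upwards [ae_restrict_mem measurableSet_Ioo] with y hy
      exact hC y (Ioo_subset_Icc_self hy)
    have h1 := transversal_inequality hd hk hkd hmem (u 0 : ℂ) hprim
    simp only [Complex.norm_real, Real.norm_eq_abs, sq_abs] at h1
    rw [← MeasureTheory.integral_Ioc_eq_integral_Ioo, ← MeasureTheory.integral_Ioc_eq_integral_Ioo,
      ← integral_of_le hd.le, ← integral_of_le hd.le] at h1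
    have h2 := integral_mul_deriv_eq_deriv_mul (a := 0) (b := d) (u := u) (v := deriv u)
      (u' := deriv u) (v' := deriv (deriv u))
      (fun x _ => (hu1 x).hasDerivAt) (fun x _ => (hu2 x).hasDerivAt)
      (hc1.intervalIntegrable _ _) (hc2.intervalIntegrable _ _)
    have h3 : ∫ x in (0 : ℝ)..d, u x * deriv (deriv u) x = -E * ∫ x in (0 : ℝ)..d, u x ^ 2 := by
      rw [← intervalIntegral.integral_const_mul, integral_of_le hd.le, integral_of_le hd.le,
        MeasureTheory.integral_Ioc_eq_integral_Ioo, MeasureTheory.integral_Ioc_eq_integral_Ioo]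
      refine setIntegral_congr_fun measurableSet_Ioo fun y hy => ?_
      have := hode y hy
      linear_combination -(u y) * this
    have h4 : ∫ x in (0 : ℝ)..d, deriv u x * deriv u x = ∫ x in (0 : ℝ)..d, deriv u x ^ 2 := by
      simp only [sq]
    rw [h3, h4] at h2
    have hpos : 0 < ∫ x in (0 : ℝ)..d, u x ^ 2 := by
      refine integral_pos hd (by fun_prop) (fun x _ => sq_nonneg _) ⟨y₀, Ioo_subset_Icc_self hy₀, ?_⟩
      positivity
    have hbd' : deriv u d = -(k * Real.tan (k * d / 2) * u d) := by linarith
    have hb0' : deriv u 0 = k * Real.tan (k * d / 2) * u 0 := by linarith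
    rw [hbd', hb0'] at h2
    have h5 : k ^ 2 * (∫ x in (0 : ℝ)..d, u x ^ 2) ≤ E * ∫ x in (0 : ℝ)..d, u x ^ 2 := by
      nlinarith
    exact le_of_mul_le_mul_right h5 hpos

end OneDim

/-! ### Absolute continuity on lines -/

section ACL

theorem IsCompact.subset_Icc_of_subset_Ioo {K : Set ℝ} {a b : ℝ} (hK : IsCompact K)
    (h : K ⊆ Ioo a b) : ∃ a' b', a < a' ∧ b' < b ∧ K ⊆ Icc a' b' := by
  rcases K.eq_empty_or_nonempty with rfl | hne
  · exact ⟨a + 1, b - 1, by linarith, by linarith, empty_subset _⟩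
  obtain ⟨m, hm⟩ := hK.exists_isLeast hne
  obtain ⟨M, hM⟩ := hK.exists_isGreatest hne
  exact ⟨m, M, (h hm.1).1, (h hM.1).2, fun x hx => ⟨hm.2 hx, hM.2 hx⟩⟩

/-- The partial primitive `∫_s^b φ(x, y) dy` of a test function is smooth in `(x, s)`. -/
theorem contDiff_partial_primitive {φ : ℝ × ℝ → ℝ} (hφ : ContDiff ℝ ∞ φ)
    (hc : HasCompactSupport φ) {b : ℝ} (hb : ∀ x y, b ≤ y → φ (x, y) = 0) :
    ContDiff ℝ ∞ (fun p : ℝ × ℝ => ∫ y in p.2..b, φ (p.1, y)) := by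
  -- The primitive `∫_s^∞ φ(x, y) dy` is the convolution of the indicator of `(-∞, 0]` with `φ(x,
  -- ·)`, so smoothness in both variables follows from convolution with a parameter.
  have hcv := contDiffOn_convolution_right_with_param (𝕜 := ℝ) (μ := (volume : Measure ℝ))
    (f := (Iic (0 : ℝ)).indicator (fun _ => (1 : ℝ))) (n := ⊤) (ContinuousLinearMap.mul ℝ ℝ)
    (g := fun x y => φ (x, y)) (s := (univ : Set ℝ)) (k := Prod.snd '' tsupport φ) isOpen_univ
    (hc.image continuous_snd) (fun p x _ hx => by
      by_contra hne
      exact hx ⟨(p, x), subset_tsupport _ hne, rfl⟩)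
    ((locallyIntegrable_const (1 : ℝ)).indicator measurableSet_Iic)
    (by exact hφ.contDiffOn)
  rw [univ_prod_univ, contDiffOn_univ] at hcv
  convert! hcv using 1
  ext ⟨x, s⟩
  have hint : Integrable (fun y => φ (x, y)) := by
    apply Continuous.integrable_of_hasCompactSupport (by fun_prop)
    refine HasCompactSupport.intro (hc.image continuous_snd) fun y hy => ?_
    by_contra hne
    exact hy ⟨(x, y), subset_tsupport _ hne, rfl⟩
  have h0 : ∫ y in Ioi b, φ (x, y) = 0 :=
    setIntegral_eq_zero_of_forall_eq_zero fun y hy => hb x y (le_of_lt hy)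
  have h1 := intervalIntegral.integral_Ioi_sub_Ioi' (a := s) (b := b) (f := fun y => φ (x, y))
    hint.integrableOn hint.integrableOn
  rw [h0, sub_zero] at h1
  simp only
  rw [← h1, ← integral_Ici_eq_integral_Ioi]
  rw [convolution_def, ← integral_indicator measurableSet_Ici]
  rw [← integral_sub_left_eq_self _ volume s]
  congr 1
  ext t
  by_cases ht : t ≤ 0 <;> simp [indicator, ht]

/-- A function on `A × (a, b)` with a weak derivative in the second variable is absolutely
continuous on almost every segment `{x} × (a, b)`. -/
theorem exists_primitive_of_weakDeriv_snd {A : Set ℝ} (hA : IsOpen A) {a b : ℝ} (hab : a < b)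
    {f g : ℝ × ℝ → ℂ}
    (hf : Integrable f ((volume.restrict A).prod (volume.restrict (Ioo a b))))
    (hg : Integrable g ((volume.restrict A).prod (volume.restrict (Ioo a b))))
    (hw : ∀ φ : ℝ × ℝ → ℝ, ContDiff ℝ ∞ φ → HasCompactSupport φ → tsupport φ ⊆ A ×ˢ Ioo a b →
      ∫ p in A ×ˢ Ioo a b, (fderiv ℝ φ p (0, 1)) • f p = - ∫ p in A ×ˢ Ioo a b, φ p • g p) :
    ∃ t : ℝ → ℂ, ∀ᵐ p ∂((volume.restrict A).prod (volume.restrict (Ioo a b))),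
      f p = t p.1 + ∫ s in a..p.2, g (p.1, s) := by
  set μ := volume.restrict A with hμ
  set ν := volume.restrict (Ioo a b) with hν
  have hvol : (volume : Measure (ℝ × ℝ)).restrict (A ×ˢ Ioo a b) = μ.prod ν := by
    rw [Measure.volume_eq_prod, Measure.prod_restrict]
  set δ := (b - a) / 3 with hδ
  have hδ0 : 0 < δ := by rw [hδ]; linarith
  -- A smooth cutoff equal to `1` near `a` and `0` near `b`. It makes the primitive of a test
  -- function compactly supported in the open interval.
  set N : ℝ → ℝ := fun s => Real.smoothTransition ((b - δ - s) / δ) with hN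
  have hNs : ContDiff ℝ ∞ N := by
    apply Real.smoothTransition.contDiff.comp
    fun_prop
  have hN1 : ∀ s ≤ a + δ, N s = 1 := fun s hs => by
    apply Real.smoothTransition.one_of_one_le
    rw [le_div_iff₀ hδ0]; linarith
  have hN0 : ∀ s, b - δ ≤ s → N s = 0 := fun s hs => by
    apply Real.smoothTransition.zero_of_nonpos
    exact div_nonpos_of_nonpos_of_nonneg (by linarith) hδ0.le
  have hNb : ∀ s, |N s| ≤ 1 := fun s => by
    rw [abs_of_nonneg (Real.smoothTransition.nonneg _)]
    exact Real.smoothTransition.le_one _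
  have hN'c : Continuous (deriv N) := hNs.continuous_deriv (by simp)
  obtain ⟨C', hC'⟩ : ∃ C, ∀ s ∈ Icc a b, ‖deriv N s‖ ≤ C :=
    isCompact_Icc.exists_bound_of_continuousOn hN'c.continuousOn
  -- This kernel is dual to the corrected primitive `Φ` below: `∫ φ(x, y) κ(y, s) dy = Φ(x, s)`.
  -- Hence `∫ Φ g = ∫ φ G`.
  set κ : ℝ → ℝ → ℝ := fun y s => (Iio y).indicator (fun _ => (1 : ℝ)) s - N s with hκ
  have hκb : ∀ y s, |κ y s| ≤ 2 := fun y s => by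
    have h1 : |(Iio y).indicator (fun _ => (1 : ℝ)) s| ≤ 1 := by
      by_cases h : s < y <;> simp [indicator, h]
    calc |κ y s| ≤ _ + _ := abs_sub _ _
      _ ≤ 2 := by linarith [hNb s]
  have hκm : Measurable (fun p : ℝ × ℝ => κ p.1 p.2) := by
    have : Measurable (fun p : ℝ × ℝ => (Iio p.1).indicator (fun _ => (1 : ℝ)) p.2) := by
      have e : (fun p : ℝ × ℝ => (Iio p.1).indicator (fun _ => (1 : ℝ)) p.2)
          = {p : ℝ × ℝ | p.2 < p.1}.indicator fun _ => 1 := by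
        ext p; simp [indicator]
      rw [e]
      exact measurable_const.indicator (measurableSet_lt measurable_snd measurable_fst)
    exact this.sub (hNs.continuous.measurable.comp measurable_snd)
  set t₀ : ℝ → ℂ := fun x => ∫ s, deriv N s • f (x, s) ∂ν with ht₀
  set G : ℝ × ℝ → ℂ := fun p => ∫ s, κ p.2 s • g (p.1, s) ∂ν with hG
  have hN'f : Integrable (fun p : ℝ × ℝ => deriv N p.2 • f p) (μ.prod ν) := by
    refine hf.bdd_smul C' ((hN'c.comp continuous_snd).aestronglyMeasurable) ?_
    rw [← hvol]
    have : ∀ᵐ p ∂((volume : Measure (ℝ × ℝ)).restrict (A ×ˢ Ioo a b)), p ∈ A ×ˢ Ioo a b :=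
      ae_restrict_mem (hA.measurableSet.prod measurableSet_Ioo)
    filter_upwards [this] with p hp
    exact hC' p.2 (Ioo_subset_Icc_self hp.2)
  have ht₀i : Integrable t₀ μ := hN'f.integral_prod_left
  have hGi : Integrable G (μ.prod ν) := by
    -- The composite permutes `((x, y), s)` into `((x, s), y)`, so that `g(x, s)` is integrable on
    -- the triple product.
    have mp1 := measurePreserving_prodAssoc μ ν ν
    have mp2 := (MeasurePreserving.id μ).prod (Measure.measurePreserving_swap (μ := ν) (ν := ν))
    have mp3 := (measurePreserving_prodAssoc μ ν ν).symm
    have mp := mp3.comp (mp2.comp mp1)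
    have h1 : Integrable (fun q : (ℝ × ℝ) × ℝ => g q.1) ((μ.prod ν).prod ν) := hg.comp_fst ν
    have h2 := mp.integrable_comp_of_integrable h1
    have h3 : Integrable (fun q : (ℝ × ℝ) × ℝ => κ q.1.2 q.2 • g (q.1.1, q.2))
        ((μ.prod ν).prod ν) := by
      refine h2.bdd_smul (φ := fun q : (ℝ × ℝ) × ℝ => κ q.1.2 q.2) 2 ?_
        (.of_forall fun q => hκb _ _)
      exact (hκm.comp ((measurable_snd.comp measurable_fst).prodMk
        measurable_snd)).aestronglyMeasurable
    exact h3.integral_prod_left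
  have hmain : ∀ᵐ p, p ∈ A ×ˢ Ioo a b → f p - (G p - t₀ p.1) = 0 := by
    have hopen : IsOpen (A ×ˢ Ioo a b) := hA.prod isOpen_Ioo
    have hdi : Integrable (fun p => f p - (G p - t₀ p.1)) (μ.prod ν) :=
      hf.sub (hGi.sub (ht₀i.comp_fst ν))
    refine hopen.ae_eq_zero_of_integral_contDiff_smul_eq_zero ?_ fun φ hφ hc hs => ?_
    · rw [← hvol] at hdi
      exact IntegrableOn.locallyIntegrableOn hdi
    have hφ0 : ∀ x y, y ∉ Ioo a b → φ (x, y) = 0 := fun x y hy => by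
      by_contra hne
      exact hy (hs (subset_tsupport _ hne)).2
    obtain ⟨a', b', ha', hb', hK2⟩ := (hc.image continuous_snd).subset_Icc_of_subset_Ioo
      (a := a) (b := b) (by rintro _ ⟨p, hp, rfl⟩; exact (hs hp).2)
    have hφ0' : ∀ x y, y ∉ Icc a' b' → φ (x, y) = 0 := fun x y hy => by
      by_contra hne
      exact hy (hK2 ⟨(x, y), subset_tsupport _ hne, rfl⟩)
    set T : ℝ × ℝ → ℝ := fun p => ∫ y in p.2..b, φ (p.1, y) with hT
    have hTs : ContDiff ℝ ∞ T :=
      contDiff_partial_primitive hφ hc fun x y hy => hφ0 x y fun h => absurd h.2 (not_lt.2 hy)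
    -- `T` has vertical derivative `-φ` but need not vanish near `y = a`; subtracting its value
    -- there times `N` repairs this. Testing with `Φ` yields `∫ φ f = ∫ φ (G - t₀)`, the term `t₀`
    -- coming from `N'`.
    set Φ : ℝ × ℝ → ℝ := fun p => T p - T (p.1, a) * N p.2 with hΦ
    have hΦs : ContDiff ℝ ∞ Φ := by
      refine hTs.sub (ContDiff.mul (hTs.comp ?_) (hNs.comp contDiff_snd))
      fun_prop
    have hφcont : Continuous φ := hφ.continuous
    have hφxc : ∀ x, Continuous fun y => φ (x, y) := fun x => by fun_prop
    have hΦ0 : ∀ p, p ∉ (Prod.fst '' tsupport φ) ×ˢ Icc (min a' (a + δ)) (max b' (b - δ)) →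
        Φ p = 0 := by
      rintro ⟨x, s⟩ hp
      by_cases hx : x ∈ Prod.fst '' tsupport φ
      · have hsn : s ∉ Icc (min a' (a + δ)) (max b' (b - δ)) := fun h => hp ⟨hx, h⟩
        rw [mem_Icc, not_and_or, not_le, not_le, lt_min_iff, max_lt_iff] at hsn
        rcases hsn with ⟨h1, h2⟩ | ⟨h1, h2⟩
        · have h3 : T (x, s) = T (x, a) := by
            simp only [hT]
            rw [← intervalIntegral.integral_add_adjacent_intervals
              ((hφxc x).intervalIntegrable s a) ((hφxc x).intervalIntegrable a b)]
            rw [intervalIntegral.integral_zero_ae, zero_add]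
            refine .of_forall fun y hy => hφ0' x y fun h => ?_
            have h4 := hy.2
            rw [← not_lt] at h4
            exact h4 (lt_of_lt_of_le (max_lt h1 ha') h.1)
          simp only [hΦ]
          rw [h3, hN1 s h2.le]; ring
        · have h3 : T (x, s) = 0 := by
            simp only [hT]
            refine intervalIntegral.integral_zero_ae (.of_forall fun y hy => hφ0' x y fun h => ?_)
            have h4 := hy.1
            rw [← not_le] at h4
            exact h4 (h.2.trans (le_min h1.le hb'.le))
          simp only [hΦ]
          rw [h3, hN0 s h2.le]; ring
      · have h3 : ∀ y, φ (x, y) = 0 := fun y => by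
          by_contra hne
          exact hx ⟨(x, y), subset_tsupport _ hne, rfl⟩
        simp [hΦ, hT, h3]
    have hKc : IsCompact ((Prod.fst '' tsupport φ) ×ˢ Icc (min a' (a + δ)) (max b' (b - δ))) :=
      (hc.image continuous_fst).prod isCompact_Icc
    have hΦc : HasCompactSupport Φ := HasCompactSupport.intro hKc hΦ0
    have hΦt : tsupport Φ ⊆ A ×ˢ Ioo a b := by
      refine (closure_minimal (fun p hp => by_contra fun h => (show Φ p ≠ 0 from hp) (hΦ0 p h)) hKc.isClosed).trans ?_
      rintro ⟨x, s⟩ ⟨⟨p, hp, hpx⟩, h1, h2⟩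
      refine ⟨hpx ▸ (hs hp).1, ?_, ?_⟩
      · exact lt_of_lt_of_le (lt_min ha' (by linarith)) h1
      · exact lt_of_le_of_lt h2 (max_lt hb' (by linarith))
    have hder : ∀ p, fderiv ℝ Φ p (0, 1) = -φ p - T (p.1, a) * deriv N p.2 := by
      rintro ⟨x, s⟩
      have h1 : HasDerivAt (fun s => Φ (x, s)) (fderiv ℝ Φ (x, s) (0, 1)) s := by
        have h2 : HasFDerivAt Φ (fderiv ℝ Φ (x, s)) (x, s) :=
          (hΦs.differentiable (by simp) _).hasFDerivAt
        have h3 : HasDerivAt (fun s : ℝ => (x, s)) ((0 : ℝ), (1 : ℝ)) s :=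
          (hasDerivAt_const s x).prodMk (hasDerivAt_id s)
        exact h2.comp_hasDerivAt s h3
      have h4 : HasDerivAt (fun s => Φ (x, s)) (-φ (x, s) - T (x, a) * deriv N s) s := by
        have h5 : HasDerivAt (fun s => T (x, s)) (-φ (x, s)) s :=
          intervalIntegral.integral_hasDerivAt_left ((hφxc x).intervalIntegrable _ _)
            ((hφxc x).stronglyMeasurableAtFilter _ _) (hφxc x).continuousAt
        exact h5.sub (((hNs.differentiable (by simp) s).hasDerivAt).const_mul (T (x, a)))
      exact h1.unique h4
    have hw' := hw Φ hΦs hΦc hΦt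
    simp only [hder] at hw'
    rw [hvol] at hw'
    obtain ⟨Cφ, hCφ⟩ := hc.exists_bound_of_continuous hφcont
    have hφb : ∀ k : ℝ × ℝ → ℂ, Integrable k (μ.prod ν) → Integrable (fun p => φ p • k p) (μ.prod ν) :=
      fun k hk => hk.bdd_smul Cφ hφcont.aestronglyMeasurable (.of_forall hCφ)
    have hTa : Continuous fun p : ℝ × ℝ => T (p.1, a) := by
      have := hTs.continuous
      fun_prop
    obtain ⟨CT, hCT⟩ : ∃ C, ∀ p : ℝ × ℝ, ‖T (p.1, a)‖ ≤ C := by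
      have h2 : HasCompactSupport (fun x => T (x, a)) := by
        refine HasCompactSupport.intro (hc.image continuous_fst) fun x hx => ?_
        have h3 : ∀ y, φ (x, y) = 0 := fun y => by
          by_contra hne
          exact hx ⟨(x, y), subset_tsupport _ hne, rfl⟩
        simp [hT, h3]
      have h1 : Continuous (fun x => T (x, a)) := by
        have := hTs.continuous
        fun_prop
      obtain ⟨C, hC⟩ := h2.exists_bound_of_continuous h1
      exact ⟨C, fun p => hC p.1⟩
    have hTN : Integrable (fun p : ℝ × ℝ => T (p.1, a) • (deriv N p.2 • f p)) (μ.prod ν) :=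
      hN'f.bdd_smul CT hTa.aestronglyMeasurable (.of_forall hCT)
    obtain ⟨CΦ, hCΦ⟩ := hΦc.exists_bound_of_continuous hΦs.continuous
    have hΦg : Integrable (fun p => Φ p • g p) (μ.prod ν) :=
      hg.bdd_smul CΦ hΦs.continuous.aestronglyMeasurable (.of_forall hCΦ)
    have e1 : ∫ p, (-φ p - T (p.1, a) * deriv N p.2) • f p ∂(μ.prod ν)
        = -(∫ p, φ p • f p ∂(μ.prod ν)) - ∫ p, T (p.1, a) • (deriv N p.2 • f p) ∂(μ.prod ν) := by
      have hneg : Integrable (fun p => -(φ p • f p)) (μ.prod ν) := (hφb f hf).neg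
      rw [← integral_neg, ← integral_sub hneg hTN]
      congr 1; ext p; simp only [sub_smul, neg_smul, mul_smul]
    rw [e1] at hw'
    have hTx : ∀ x, T (x, a) = ∫ y, φ (x, y) ∂ν := fun x => by
      simp only [hT]
      rw [intervalIntegral.integral_of_le hab.le, integral_Ioc_eq_integral_Ioo]
    have e2 : ∫ p, T (p.1, a) • (deriv N p.2 • f p) ∂(μ.prod ν)
        = ∫ p, φ p • t₀ p.1 ∂(μ.prod ν) := by
      rw [integral_prod _ hTN, integral_prod _ (hφb _ (ht₀i.comp_fst ν))]
      refine integral_congr_ae (.of_forall fun x => ?_)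
      simp only
      rw [integral_smul, integral_smul_const, ← hTx]
    have e3 : ∫ p, Φ p • g p ∂(μ.prod ν) = ∫ p, φ p • G p ∂(μ.prod ν) := by
      rw [integral_prod _ hΦg, integral_prod _ (hφb _ hGi)]
      refine integral_congr_ae ?_
      filter_upwards [hg.prod_right_ae] with x hx
      have hprod : Integrable (fun q : ℝ × ℝ => (φ (x, q.1) * κ q.1 q.2) • g (x, q.2))
          (ν.prod ν) := by
        refine (hx.comp_snd ν).bdd_smul (φ := fun q : ℝ × ℝ => φ (x, q.1) * κ q.1 q.2)
          (Cφ * 2) ?_ (.of_forall fun q => ?_)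
        · exact (((hφxc x).measurable.comp measurable_fst).mul hκm).aestronglyMeasurable
        · rw [norm_mul]
          exact mul_le_mul (hCφ _) (hκb _ _) (norm_nonneg _) ((norm_nonneg _).trans (hCφ (x, 0)))
      have e4 : ∫ y, φ (x, y) • G (x, y) ∂ν
          = ∫ y, ∫ s, (φ (x, y) * κ y s) • g (x, s) ∂ν ∂ν := by
        congr 1; ext y
        simp only [hG]
        rw [← integral_smul]
        simp only [mul_smul]
      rw [e4, integral_integral_swap hprod]
      refine integral_congr_ae ?_
      filter_upwards [ae_restrict_mem measurableSet_Ioo] with s hs'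
      rw [integral_smul_const]
      congr 1
      have hi1 : Integrable (fun y => φ (x, y)) ν :=
        ((hφxc x).continuousOn.integrableOn_Icc).mono_set Ioo_subset_Icc_self
      have hi2 : Integrable (fun y => φ (x, y) * (Iio y).indicator (fun _ => (1 : ℝ)) s) ν := by
        have : (fun y => φ (x, y) * (Iio y).indicator (fun _ => (1 : ℝ)) s)
            = (Ioi s).indicator fun y => φ (x, y) := by
          ext y; by_cases h : s < y <;> simp [h]
        rw [this]; exact hi1.indicator measurableSet_Ioi
      have e5 : ∫ y, φ (x, y) * (Iio y).indicator (fun _ => (1 : ℝ)) s ∂ν = T (x, s) := by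
        have : (fun y => φ (x, y) * (Iio y).indicator (fun _ => (1 : ℝ)) s)
            = (Ioi s).indicator fun y => φ (x, y) := by
          ext y; by_cases h : s < y <;> simp [h]
        rw [this, integral_indicator measurableSet_Ioi, hν,
          Measure.restrict_restrict measurableSet_Ioi]
        simp only [hT]
        rw [intervalIntegral.integral_of_le hs'.2.le, integral_Ioc_eq_integral_Ioo]
        congr 2
        ext y; simp only [mem_inter_iff, mem_Ioi, mem_Ioo]
        exact ⟨fun h => ⟨h.1, h.2.2⟩, fun h => ⟨h.1, hs'.1.trans h.1, h.2⟩⟩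
      simp only [hκ, mul_sub, hΦ]
      rw [integral_sub hi2 (hi1.mul_const _), e5, integral_mul_const, ← hTx]
    rw [e2, e3] at hw'
    have e6 : ∫ p, φ p • (f p - (G p - t₀ p.1))
        = ∫ p, φ p • (f p - (G p - t₀ p.1)) ∂(μ.prod ν) := by
      rw [← hvol]
      refine (setIntegral_eq_integral_of_forall_compl_eq_zero fun p hp => ?_).symm
      have : φ p = 0 := by
        by_contra hne
        exact hp (hs (subset_tsupport _ hne))
      rw [this, zero_smul]
    have hφG := hφb _ hGi
    have hφt := hφb _ (ht₀i.comp_fst ν)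
    rw [e6]
    simp only [smul_sub]
    have hφGt : Integrable (fun p => φ p • G p - φ p • t₀ p.1) (μ.prod ν) := hφG.sub hφt
    rw [integral_sub (hφb f hf) hφGt, integral_sub hφG hφt]
    linear_combination -hw'
  -- By the definition of `κ`, `G` is the primitive of `g` from `a` minus `∫ N g`; all other terms
  -- depend on `x` only.
  refine ⟨fun x => -(∫ s, N s • g (x, s) ∂ν) - t₀ x, ?_⟩
  rw [← hvol]
  have hgx := hg.prod_right_ae
  have hfst : ∀ᵐ p ∂((volume : Measure (ℝ × ℝ)).restrict (A ×ˢ Ioo a b)),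
      Integrable (fun s => g (p.1, s)) ν := by
    rw [hvol]
    exact Measure.quasiMeasurePreserving_fst.ae hgx
  filter_upwards [ae_restrict_of_ae hmain, hfst,
    ae_restrict_mem (hA.measurableSet.prod measurableSet_Ioo)] with p hp hgp hpm
  have h1 := hp hpm
  have h2 : G p = (∫ s in a..p.2, g (p.1, s)) - ∫ s, N s • g (p.1, s) ∂ν := by
    have hi : Integrable (fun s => N s • g (p.1, s)) ν :=
      hgp.bdd_smul 1 hNs.continuous.aestronglyMeasurable (.of_forall hNb)
    have e : ∀ s, (Iio p.2).indicator (fun _ => (1 : ℝ)) s • g (p.1, s)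
        = (Iio p.2).indicator (fun s => g (p.1, s)) s := fun s => by
      by_cases h : s < p.2 <;> simp [h]
    simp only [hG, hκ, sub_smul, e]
    rw [integral_sub (hgp.indicator measurableSet_Iio) hi, integral_indicator measurableSet_Iio,
      hν, Measure.restrict_restrict measurableSet_Iio,
      intervalIntegral.integral_of_le hpm.2.1.le, integral_Ioc_eq_integral_Ioo]
    congr 3
    ext y; simp only [mem_inter_iff, mem_Iio, mem_Ioo]
    exact ⟨fun h => ⟨h.2.1, h.1⟩, fun h => ⟨h.2, h.1, h.2.trans hpm.2.2⟩⟩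
  rw [h2] at h1
  linear_combination h1

/-- Integration by parts against `y - b`, the primitive of `1` that vanishes at the right end. -/
theorem integral_primitive_eq {a b : ℝ} (hab : a ≤ b) {g : ℝ → ℂ}
    (hg : IntervalIntegrable g volume a b) (t : ℂ) :
    ∫ y in a..b, (t + ∫ s in a..y, g s)
      = (b - a : ℂ) * t + ∫ s in a..b, ((b - s : ℝ) : ℂ) * g s := by
  have h1 := integral_primitive_mul_add hab hg (g₂ := fun _ => 1) intervalIntegrable_const t (a - b)
  have hprim : ∀ y, (a - b : ℂ) + ∫ s in a..y, (1 : ℂ) = y - b := fun y => by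
    rw [intervalIntegral.integral_const]; simp
  simp only [hprim, sub_self, mul_zero, zero_sub, mul_one] at h1
  have hi1 : IntervalIntegrable (fun y => t + ∫ s in a..y, g s) volume a b :=
    (continuousOn_const.add (intervalIntegral.continuousOn_primitive_interval'
      hg left_mem_uIcc)).intervalIntegrable
  have hi2 : IntervalIntegrable (fun s => ((b - s : ℝ) : ℂ) * g s) volume a b :=
    hg.continuousOn_mul (by fun_prop)
  have h2 : ∫ y in a..b, ((t + ∫ s in a..y, g s) + g y * (y - b))
      = (∫ y in a..b, (t + ∫ s in a..y, g s)) - ∫ s in a..b, ((b - s : ℝ) : ℂ) * g s := by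
    rw [← intervalIntegral.integral_sub hi1 hi2]
    refine intervalIntegral.integral_congr fun y _ => ?_
    push_cast; ring
  rw [h2] at h1
  linear_combination h1

end ACL

/-! ### Fibre integrals and traces on the strip -/

section Traces

theorem volume_restrict_strip (d : ℝ) : (volume : Measure (ℝ × ℝ)).restrict (strip d)
    = (volume : Measure ℝ).prod (volume.restrict (Ioo 0 d)) := by
  have h : strip d = univ ×ˢ Ioo 0 d := by ext p; simp [strip]
  rw [h, Measure.volume_eq_prod, ← Measure.prod_restrict, Measure.restrict_univ]

theorem MemLp.strip_prod {d : ℝ} {k : ℝ × ℝ → ℂ} (h : MemLp k 2 (volume.restrict (strip d))) :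
    MemLp k 2 ((volume : Measure ℝ).prod (volume.restrict (Ioo 0 d))) := by
  rwa [volume_restrict_strip] at h

theorem integral_strip {d : ℝ} {E : Type*} [NormedAddCommGroup E] [NormedSpace ℝ E]
    {k : ℝ × ℝ → E} (h : Integrable k (volume.restrict (strip d))) :
    ∫ p in strip d, k p = ∫ x : ℝ, ∫ y in Ioo 0 d, k (x, y) := by
  rw [volume_restrict_strip] at h ⊢
  exact integral_prod _ h

/-- Exhaustion by bounded rectangles, on which every element of `L²(Ω)` is integrable. -/
theorem ae_strip_of_forall_nat {d : ℝ} {P : ℝ × ℝ → Prop}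
    (h : ∀ n : ℕ, ∀ᵐ p ∂(volume.restrict (Ioo (-(n : ℝ)) n ×ˢ Ioo 0 d)), P p) :
    ∀ᵐ p ∂(volume.restrict (strip d)), P p := by
  have hU : strip d = ⋃ n : ℕ, Ioo (-(n : ℝ)) n ×ˢ Ioo 0 d := by
    ext p
    simp only [strip, mem_iUnion, mem_prod, mem_Ioo]
    constructor
    · intro hp
      obtain ⟨n, hn⟩ := exists_nat_gt |p.1|
      exact ⟨n, abs_lt.1 hn, hp⟩
    · rintro ⟨n, _, hp⟩; exact hp
  rw [hU, ae_restrict_iUnion_iff]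
  exact h

theorem Lp_norm_sq_eq_integral {X : Type*} [MeasurableSpace X] {μ : Measure X} (f : Lp ℂ 2 μ) :
    ‖f‖ ^ 2 = ∫ x, ‖f x‖ ^ 2 ∂μ := by
  have h := L2.integral_inner_eq_sq_eLpNorm (𝕜 := ℂ) f
  have h1 : (inner ℂ f f : ℂ) = ((‖f‖ ^ 2 : ℝ) : ℂ) := by
    rw [inner_self_eq_norm_sq_to_K]; push_cast; rfl
  rw [L2.inner_def] at h1
  have h2 : ∀ x, (inner ℂ (f x) (f x) : ℂ) = ((‖f x‖ ^ 2 : ℝ) : ℂ) := fun x => by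
    rw [inner_self_eq_norm_sq_to_K]; push_cast; rfl
  simp only [h2] at h1
  rw [integral_complex_ofReal] at h1
  exact_mod_cast h1.symm

theorem memLp_two_prod_right_ae {μ ν : Measure ℝ} [SFinite μ] [SFinite ν] {G : ℝ × ℝ → ℂ}
    (hG : MemLp G 2 (μ.prod ν)) : ∀ᵐ x ∂μ, MemLp (fun s => G (x, s)) 2 ν := by
  have h2 := ((memLp_two_iff_integrable_sq_norm hG.1).1 hG).prod_right_ae
  filter_upwards [h2, hG.1.prodMk_left] with x hx hm
  exact (memLp_two_iff_integrable_sq_norm hm).2 hx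

theorem memLp_integral_right {μ ν : Measure ℝ} [SFinite μ] [IsFiniteMeasure ν] {G : ℝ × ℝ → ℂ}
    (hG : MemLp G 2 (μ.prod ν)) : MemLp (fun x => ∫ s, G (x, s) ∂ν) 2 μ ∧
    ∫ x, ‖∫ s, G (x, s) ∂ν‖ ^ 2 ∂μ ≤ ν.real univ * ∫ p, ‖G p‖ ^ 2 ∂(μ.prod ν) := by
  have h2 := (memLp_two_iff_integrable_sq_norm hG.1).1 hG
  have hm : AEStronglyMeasurable (fun x => ∫ s, G (x, s) ∂ν) μ := hG.1.integral_prod_right'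
  have hi : Integrable (fun x => ν.real univ * ∫ s, ‖G (x, s)‖ ^ 2 ∂ν) μ :=
    h2.integral_prod_left.const_mul _
  have hb : ∀ᵐ x ∂μ, ‖∫ s, G (x, s) ∂ν‖ ^ 2 ≤ ν.real univ * ∫ s, ‖G (x, s)‖ ^ 2 ∂ν := by
    filter_upwards [memLp_two_prod_right_ae hG] with x hx
    exact norm_integral_sq_le hx
  have hint : Integrable (fun x => ‖∫ s, G (x, s) ∂ν‖ ^ 2) μ := by
    refine hi.mono' (hm.norm.pow 2) ?_
    filter_upwards [hb] with x hx
    rwa [Real.norm_of_nonneg (sq_nonneg _)]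
  refine ⟨(memLp_two_iff_integrable_sq_norm hm).2 hint, ?_⟩
  rw [integral_prod _ h2, ← integral_const_mul]
  exact integral_mono_ae hint hi hb

theorem memLp_integral_fiber {d : ℝ} {k : ℝ × ℝ → ℂ} (h : MemLp k 2 (volume.restrict (strip d))) :
    MemLp (fun x => ∫ s in Ioo 0 d, k (x, s)) 2 ∧
    ∫ x, ‖∫ s in Ioo 0 d, k (x, s)‖ ^ 2
      ≤ (volume.restrict (Ioo 0 d)).real univ * ∫ p in strip d, ‖k p‖ ^ 2 := by
  rw [volume_restrict_strip] at h ⊢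
  exact memLp_integral_right h

theorem memLp_weight_smul {d : ℝ} (wt : C(ℝ, ℝ)) (f : L2Strip d) :
    ∃ C, 0 ≤ C ∧ (∀ᵐ p ∂(volume.restrict (strip d)), ‖wt p.2 • f p‖ ≤ C * ‖f p‖) ∧
      MemLp (fun p : ℝ × ℝ => wt p.2 • f p) 2 (volume.restrict (strip d)) := by
  obtain ⟨C, hC⟩ := isCompact_Icc.exists_bound_of_continuousOn (s := Icc 0 d) wt.continuous.continuousOn
  have hb : ∀ᵐ p ∂(volume.restrict (strip d)), ‖wt p.2 • f p‖ ≤ |C| * ‖f p‖ := by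
    filter_upwards [ae_restrict_mem (isOpen_strip d).measurableSet] with p hp
    rw [norm_smul]
    gcongr
    exact (hC p.2 ⟨hp.1.le, hp.2.le⟩).trans (le_abs_self C)
  refine ⟨|C|, abs_nonneg _, hb, ?_⟩
  refine MemLp.of_le_mul (Lp.memLp f) ?_ hb
  exact ((wt.continuous.comp continuous_snd).aestronglyMeasurable).smul (Lp.memLp f).1

theorem memLp_fiberIntegral {d : ℝ} (wt : C(ℝ, ℝ)) (f : L2Strip d) :
    MemLp (fun x => ∫ s in Ioo 0 d, wt s • f (x, s)) 2 := by
  obtain ⟨C, -, -, h⟩ := memLp_weight_smul wt f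
  exact (memLp_integral_fiber h).1

theorem ae_fiber {d : ℝ} {p : ℝ × ℝ → Prop} (h : ∀ᵐ q ∂(volume.restrict (strip d)), p q) :
    ∀ᵐ x : ℝ, ∀ᵐ y ∂(volume.restrict (Ioo 0 d)), p (x, y) := by
  rw [volume_restrict_strip] at h
  exact Measure.ae_ae_of_ae_prod h

theorem ae_fiber_memLp {d : ℝ} (f : L2Strip d) :
    ∀ᵐ x : ℝ, MemLp (fun s => f (x, s)) 2 (volume.restrict (Ioo 0 d)) := by
  exact memLp_two_prod_right_ae (MemLp.strip_prod (Lp.memLp f))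

/-- The operator `f ↦ ∫_0^d wt(y) f(x, y) dy` from `L²(Ω)` to `L²(ℝ)`. -/
noncomputable def fiberIntegral (d : ℝ) (wt : C(ℝ, ℝ)) :
    L2Strip d →L[ℂ] Lp ℂ 2 (volume : Measure ℝ) :=
  LinearMap.mkContinuousOfExistsBound
    { toFun := fun f => (memLp_fiberIntegral wt f).toLp _
      map_add' := by
        intro f g
        rw [← MemLp.toLp_add]
        refine MemLp.toLp_congr _ _ ?_
        filter_upwards [ae_fiber (Lp.coeFn_add f g), ae_fiber_memLp f, ae_fiber_memLp g]
          with x hx hf hg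
        have hi : ∀ k : ℝ → ℂ, MemLp k 2 (volume.restrict (Ioo 0 d)) →
            Integrable (fun s => wt s • k s) (volume.restrict (Ioo 0 d)) := by
          intro k hk
          obtain ⟨C, hC⟩ := isCompact_Icc.exists_bound_of_continuousOn (s := Icc 0 d)
            wt.continuous.continuousOn
          refine (hk.integrable (by norm_num)).bdd_smul C wt.continuous.aestronglyMeasurable ?_
          filter_upwards [ae_restrict_mem measurableSet_Ioo] with y hy
          exact hC y (Ioo_subset_Icc_self hy)
        simp only [Pi.add_apply]
        rw [← integral_add (hi _ hf) (hi _ hg)]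
        refine integral_congr_ae ?_
        filter_upwards [hx] with s hs
        rw [hs, Pi.add_apply, smul_add]
      map_smul' := by
        intro c f
        rw [RingHom.id_apply, ← MemLp.toLp_const_smul]
        refine MemLp.toLp_congr _ _ ?_
        filter_upwards [ae_fiber (Lp.coeFn_smul c f)] with x hx
        simp only [Pi.smul_apply]
        rw [← integral_smul]
        refine integral_congr_ae ?_
        filter_upwards [hx] with s hs
        rw [hs, Pi.smul_apply, smul_comm] }
    (by
      obtain ⟨C, hC⟩ := isCompact_Icc.exists_bound_of_continuousOn (s := Icc 0 d)
        wt.continuous.continuousOn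
      refine ⟨Real.sqrt ((volume.restrict (Ioo 0 d)).real univ * |C| ^ 2), fun f => ?_⟩
      simp only [LinearMap.coe_mk, AddHom.coe_mk]
      rw [← Real.sqrt_sq (norm_nonneg f), ← Real.sqrt_mul (by positivity)]
      apply Real.le_sqrt_of_sq_le
      rw [Lp_norm_sq_eq_integral, Lp_norm_sq_eq_integral]
      obtain ⟨-, -, -, hm⟩ := memLp_weight_smul wt f
      have h1 := (memLp_integral_fiber hm).2
      have h2 : ∫ x, ‖(memLp_fiberIntegral wt f).toLp _ x‖ ^ 2
          = ∫ x, ‖∫ s in Ioo 0 d, wt s • f (x, s)‖ ^ 2 := by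
        refine integral_congr_ae ?_
        filter_upwards [(memLp_fiberIntegral wt f).coeFn_toLp] with x hx
        rw [hx]
      rw [h2]
      refine h1.trans ?_
      rw [mul_assoc]
      refine mul_le_mul_of_nonneg_left ?_ measureReal_nonneg
      rw [← integral_const_mul]
      refine integral_mono_ae ((memLp_two_iff_integrable_sq_norm hm.1).1 hm)
        (((memLp_two_iff_integrable_sq_norm (Lp.memLp f).1).1 (Lp.memLp f)).const_mul _) ?_
      filter_upwards [ae_restrict_mem (isOpen_strip d).measurableSet] with p hp
      rw [norm_smul, mul_pow]
      gcongr
      exact (hC p.2 ⟨hp.1.le, hp.2.le⟩).trans (le_abs_self C))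

theorem coeFn_fiberIntegral (d : ℝ) (wt : C(ℝ, ℝ)) (f : L2Strip d) :
    fiberIntegral d wt f =ᵐ[volume] fun x => ∫ s in Ioo 0 d, wt s • f (x, s) :=
  (memLp_fiberIntegral wt f).coeFn_toLp

/-- For `c ∈ {0, d}`, the trace on the line `y = c` of a function `f` with vertical derivative `g`,
written as a bounded operator of `(f, g)`. -/
noncomputable def traceOp (d c : ℝ) : L2Strip d × L2Strip d →L[ℂ] Lp ℂ 2 (volume : Measure ℝ) :=
  (fiberIntegral d ⟨fun _ => d⁻¹, continuous_const⟩).coprod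
    (fiberIntegral d ⟨fun s => d⁻¹ * (s - (d - c)), by fun_prop⟩)

theorem coeFn_traceOp (d c : ℝ) (f g : L2Strip d) :
    traceOp d c (f, g) =ᵐ[volume] fun x => (∫ s in Ioo 0 d, d⁻¹ • f (x, s))
      + ∫ s in Ioo 0 d, (d⁻¹ * (s - (d - c))) • g (x, s) := by
  have h : traceOp d c (f, g) = fiberIntegral d ⟨fun _ => d⁻¹, continuous_const⟩ f
    + fiberIntegral d ⟨fun s => d⁻¹ * (s - (d - c)), by fun_prop⟩ g := rfl
  rw [h]
  filter_upwards [Lp.coeFn_add (fiberIntegral d ⟨fun _ => d⁻¹, continuous_const⟩ f)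
    (fiberIntegral d ⟨fun s => d⁻¹ * (s - (d - c)), by fun_prop⟩ g), coeFn_fiberIntegral d _ f,
    coeFn_fiberIntegral d ⟨fun s => d⁻¹ * (s - (d - c)), by fun_prop⟩ g] with x h1 h2 h3
  rw [h1, Pi.add_apply, h2, h3]
  rfl

theorem memLp_Ioo_intervalIntegrable {a b : ℝ} (hab : a ≤ b) {g : ℝ → ℂ}
    (hg : MemLp g 2 (volume.restrict (Ioo a b))) : IntervalIntegrable g volume a b := by
  rw [intervalIntegrable_iff_integrableOn_Ioo_of_le hab]
  exact hg.integrable (by norm_num)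

theorem setIntegral_Ioo_eq_interval {a b : ℝ} (hab : a ≤ b) (g : ℝ → ℂ) :
    ∫ s in Ioo a b, g s = ∫ s in a..b, g s := by
  rw [intervalIntegral.integral_of_le hab, integral_Ioc_eq_integral_Ioo]

/-- The trace formula on one fibre. -/
theorem trace_formula {d c : ℝ} (hd : 0 < d) (hc : c = 0 ∨ c = d) {g w : ℝ → ℂ} {t : ℂ}
    (hg : IntervalIntegrable g volume 0 d)
    (hw : ∀ᵐ y ∂(volume.restrict (Ioo 0 d)), w y = t + ∫ s in (0 : ℝ)..y, g s) :
    (∫ s in Ioo 0 d, d⁻¹ • w s) + ∫ s in Ioo 0 d, (d⁻¹ * (s - (d - c))) • g s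
      = t + ∫ s in (0 : ℝ)..c, g s := by
  have hdc : (d : ℂ) ≠ 0 := by exact_mod_cast hd.ne'
  -- The mean of `w` is `t + d⁻¹ ∫ (d - s) g`, and the weight in the second integral trades the
  -- excess for `(c / d) ∫_0^d g`. This equals `∫_0^c g` for `c = 0` and for `c = d`.
  have e1 : ∫ s in Ioo 0 d, d⁻¹ • w s
      = (d : ℂ)⁻¹ * (d * t + ∫ s in (0 : ℝ)..d, ((d - s : ℝ) : ℂ) * g s) := by
    rw [integral_smul, integral_congr_ae hw, setIntegral_Ioo_eq_interval hd.le,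
      integral_primitive_eq hd.le hg, Complex.real_smul]
    push_cast; simp
  have hi : IntervalIntegrable (fun s => ((d - s : ℝ) : ℂ) * g s) volume 0 d :=
    hg.continuousOn_mul (by fun_prop)
  have e2 : ∫ s in Ioo 0 d, (d⁻¹ * (s - (d - c))) • g s
      = (d : ℂ)⁻¹ * (c * (∫ s in (0 : ℝ)..d, g s) - ∫ s in (0 : ℝ)..d, ((d - s : ℝ) : ℂ) * g s) := by
    rw [setIntegral_Ioo_eq_interval hd.le, ← intervalIntegral.integral_const_mul,
      ← intervalIntegral.integral_sub (hg.const_mul _) hi, ← intervalIntegral.integral_const_mul]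
    refine intervalIntegral.integral_congr fun s _ => ?_
    simp only [Complex.real_smul]
    push_cast; ring
  rw [e1, e2]
  rcases hc with rfl | rfl
  · simp only [intervalIntegral.integral_same]
    push_cast
    field_simp
    ring
  · field_simp
    ring

/-- Functions with a vertical weak derivative are absolutely continuous on almost every vertical
segment, with boundary values given by `traceOp`. -/
theorem IsWeakDeriv.ae_eq_primitive {d : ℝ} (hd : 0 < d) {f g : L2Strip d}
    (h : IsWeakDeriv d (0, 1) f g) :
    ∀ᵐ p ∂(volume.restrict (strip d)),
      f p = traceOp d 0 (f, g) p.1 + ∫ s in (0 : ℝ)..p.2, g (p.1, s) := by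
  refine ae_strip_of_forall_nat ?_
  intro n
  set A := Ioo (-(n : ℝ)) n with hA
  have hvol : (volume : Measure (ℝ × ℝ)).restrict (A ×ˢ Ioo 0 d)
      = (volume.restrict A).prod (volume.restrict (Ioo 0 d)) := by
    rw [Measure.volume_eq_prod, Measure.prod_restrict]
  have hsub : A ×ˢ Ioo 0 d ⊆ strip d := fun p hp => hp.2
  have hint : ∀ k : L2Strip d, Integrable k ((volume.restrict A).prod (volume.restrict (Ioo 0 d))) := by
    intro k
    refine MemLp.integrable (q := 2) (by norm_num) ?_
    rw [← hvol]
    exact (Lp.memLp k).mono_measure (Measure.restrict_mono hsub le_rfl)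
  obtain ⟨t, ht⟩ := exists_primitive_of_weakDeriv_snd (A := A) isOpen_Ioo hd (hint f) (hint g) (by
    intro φ hφ hc hs
    have h1 := h φ hφ hc (hs.trans hsub)
    have e : ∀ k : ℝ × ℝ → ℂ, (∀ p, p ∉ tsupport φ → k p = 0) →
        ∫ p in A ×ˢ Ioo 0 d, k p = ∫ p in strip d, k p := by
      intro k hk
      rw [setIntegral_eq_integral_of_forall_compl_eq_zero fun p hp => hk p fun h => hp (hs h),
        setIntegral_eq_integral_of_forall_compl_eq_zero fun p hp => hk p fun h => hp (hsub (hs h))]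
    rw [e _ fun p hp => ?_, e _ fun p hp => ?_, h1]
    · rw [image_eq_zero_of_notMem_tsupport hp, zero_smul]
    · have : fderiv ℝ φ p = 0 := by
        by_contra hne
        exact hp (support_fderiv_subset ℝ hne)
      rw [this]; simp)
  rw [hvol]
  -- The constant of integration found on each bounded piece is the global trace, so the pieces fit
  -- together.
  have h1 : ∀ᵐ x ∂(volume.restrict A), traceOp d 0 (f, g) x = t x := by
    filter_upwards [Measure.ae_ae_of_ae_prod ht, ae_restrict_of_ae (coeFn_traceOp d 0 f g),
      ae_restrict_of_ae (ae_fiber_memLp g)] with x hx htr hgx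
    rw [htr, trace_formula hd (Or.inl rfl) (memLp_Ioo_intervalIntegrable hd.le hgx) hx]
    simp
  filter_upwards [ht, Measure.quasiMeasurePreserving_fst.ae h1] with p hp h2
  rw [hp, h2]

theorem IsWeakDeriv.traceOp_ae {d : ℝ} (hd : 0 < d) {f g : L2Strip d}
    (h : IsWeakDeriv d (0, 1) f g) :
    ∀ᵐ x : ℝ, traceOp d d (f, g) x = traceOp d 0 (f, g) x + ∫ s in (0 : ℝ)..d, g (x, s) := by
  filter_upwards [ae_fiber (h.ae_eq_primitive hd), coeFn_traceOp d d f g, ae_fiber_memLp g]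
    with x hx htr hgx
  rw [htr, trace_formula hd (Or.inr rfl) (memLp_Ioo_intervalIntegrable hd.le hgx) hx]

/-- The continuous representative on vertical lines. -/
noncomputable def vertRep (d : ℝ) (f g : L2Strip d) (p : ℝ × ℝ) : ℂ :=
  traceOp d 0 (f, g) p.1 + ∫ s in (0 : ℝ)..p.2, g (p.1, s)

theorem ae_continuousOn_vertRep {d : ℝ} (hd : 0 < d) (f g : L2Strip d) :
    ∀ᵐ x : ℝ, ContinuousOn (fun y => vertRep d f g (x, y)) (Icc 0 d) := by
  filter_upwards [ae_fiber_memLp g] with x hx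
  simp only [vertRep]
  refine ContinuousOn.add continuousOn_const ?_
  rw [← uIcc_of_le hd.le]
  exact intervalIntegral.continuousOn_primitive_interval'
    (memLp_Ioo_intervalIntegrable hd.le hx) left_mem_uIcc

theorem IsWeakDeriv.vertRep_boundary {d c : ℝ} (hd : 0 < d) (hc : c = 0 ∨ c = d) {f g : L2Strip d}
    (h : IsWeakDeriv d (0, 1) f g) : ∀ᵐ x : ℝ, vertRep d f g (x, c) = traceOp d c (f, g) x := by
  rcases hc with rfl | rfl
  · refine .of_forall fun x => ?_
    simp [vertRep]
  · filter_upwards [h.traceOp_ae hd] with x hx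
    rw [hx]; rfl

/-- Two representatives continuous on the closed fibre that agree almost everywhere on the open one
agree at the ends. Hence traces are unique, and `vertRep` supplies existence. -/
theorem IsWeakDeriv.isTrace_iff {d c : ℝ} (hd : 0 < d) (hc : c = 0 ∨ c = d) {f g : L2Strip d}
    (h : IsWeakDeriv d (0, 1) f g) {t : ℝ → ℂ} :
    IsTrace d c f t ↔ t =ᵐ[volume] traceOp d c (f, g) := by
  have hrep : vertRep d f g =ᵐ[volume.restrict (strip d)] f := by
    filter_upwards [h.ae_eq_primitive hd] with p hp
    rw [hp]; rfl
  have hcm : c ∈ Icc 0 d := by rcases hc with rfl | rfl <;> simp [hd.le]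
  constructor
  · rintro ⟨F, hF, hcont⟩
    filter_upwards [hcont, ae_continuousOn_vertRep hd f g, h.vertRep_boundary hd hc,
      ae_fiber (hF.trans hrep.symm)] with x hx h1 h2 h3
    rw [← hx.2, ← h2]
    have h4 : EqOn (fun y => F (x, y)) (fun y => vertRep d f g (x, y)) (Ioo 0 d) :=
      Measure.eqOn_open_of_ae_eq (μ := volume) h3 isOpen_Ioo (hx.1.mono Ioo_subset_Icc_self)
        (h1.mono Ioo_subset_Icc_self)
    refine h4.of_subset_closure hx.1 h1 Ioo_subset_Icc_self ?_ hcm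
    rw [closure_Ioo hd.ne]
  · intro ht
    refine ⟨vertRep d f g, hrep, ?_⟩
    filter_upwards [ae_continuousOn_vertRep hd f g, h.vertRep_boundary hd hc, ht] with x h1 h2 h3
    exact ⟨h1, by rw [h2, h3]⟩

theorem integrable_conj_mul {X : Type*} [MeasurableSpace X] {μ : Measure X} (f g : Lp ℂ 2 μ) :
    Integrable (fun x => (starRingEnd ℂ) (f x) * g x) μ := by
  have := L2.integrable_inner (𝕜 := ℂ) f g
  refine this.congr (.of_forall fun x => ?_)
  simp only [RCLike.inner_apply]
  ring

theorem inner_eq_integral_conj_mul {X : Type*} [MeasurableSpace X] {μ : Measure X}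
    (f g : Lp ℂ 2 μ) : inner ℂ f g = ∫ x, (starRingEnd ℂ) (f x) * g x ∂μ := by
  rw [L2.inner_def]
  refine integral_congr_ae (.of_forall fun x => ?_)
  simp only [RCLike.inner_apply]
  ring

/-- Green's formula in the vertical direction. -/
theorem IsWeakDeriv.green_vertical {d : ℝ} (hd : 0 < d) {f f' g g' : L2Strip d}
    (h : IsWeakDeriv d (0, 1) f f') (hg : IsWeakDeriv d (0, 1) g g') :
    inner ℂ f g' + inner ℂ f' g = inner ℂ (traceOp d d (f, f')) (traceOp d d (g, g'))
      - inner ℂ (traceOp d 0 (f, f')) (traceOp d 0 (g, g')) := by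
  simp only [inner_eq_integral_conj_mul]
  rw [← integral_add (integrable_conj_mul f g') (integrable_conj_mul f' g),
    ← integral_sub (integrable_conj_mul _ _) (integrable_conj_mul _ _)]
  have hi : Integrable (fun p => (starRingEnd ℂ) (f p) * g' p + (starRingEnd ℂ) (f' p) * g p)
      (volume.restrict (strip d)) := (integrable_conj_mul f g').add (integrable_conj_mul f' g)
  rw [integral_strip hi]
  refine integral_congr_ae ?_
  filter_upwards [ae_fiber (h.ae_eq_primitive hd), ae_fiber (hg.ae_eq_primitive hd),
    h.traceOp_ae hd, hg.traceOp_ae hd, ae_fiber_memLp f', ae_fiber_memLp g'] with x h1 h2 h3 h4 h5 h6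
  have i5 := memLp_Ioo_intervalIntegrable hd.le h5
  have i6 := memLp_Ioo_intervalIntegrable hd.le h6
  have i5' : IntervalIntegrable (fun s => (starRingEnd ℂ) (f' (x, s))) volume 0 d := by
    rw [intervalIntegrable_iff_integrableOn_Ioo_of_le hd.le] at i5 ⊢
    exact Complex.conjCLE.toContinuousLinearMap.integrable_comp i5
  have hconj : ∀ y, (starRingEnd ℂ) (∫ s in (0 : ℝ)..y, f' (x, s))
      = ∫ s in (0 : ℝ)..y, (starRingEnd ℂ) (f' (x, s)) := fun y => by
    simp only [intervalIntegral, map_sub, integral_conj]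
  have key := integral_primitive_mul_add hd.le i5' i6 ((starRingEnd ℂ) (traceOp d 0 (f, f') x))
    (traceOp d 0 (g, g') x)
  rw [h3, h4, map_add, hconj, ← key, ← setIntegral_Ioo_eq_interval hd.le]
  refine integral_congr_ae ?_
  filter_upwards [h1, h2] with y hy1 hy2
  rw [hy1, hy2, map_add, hconj]

end Traces

/-! ### Weak convergence in Hilbert spaces -/

section WeakLimits

open Filter Topology

variable {H : Type*} [NormedAddCommGroup H] [InnerProductSpace ℂ H]

theorem norm_le_of_dense_inner {S : Submodule ℂ H} (hS : Dense (S : Set H)) {w : H} {C : ℝ}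
    (hC : 0 ≤ C) (h : ∀ k ∈ S, ‖inner ℂ k w‖ ≤ C * ‖k‖) : ‖w‖ ≤ C := by
  have hcl : IsClosed {k : H | ‖inner ℂ k w‖ ≤ C * ‖k‖} :=
    isClosed_le (by fun_prop) (by fun_prop)
  have h1 : ‖inner ℂ w w‖ ≤ C * ‖w‖ := hcl.closure_subset_iff.2 h (hS w)
  rw [inner_self_eq_norm_sq_to_K, norm_pow, RCLike.norm_ofReal, abs_norm] at h1
  by_contra hlt
  push Not at hlt
  nlinarith [hC.trans_lt hlt]

/-- For a bounded family, an approximation of `k` from `S` costs an error uniform in the index, so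
weak convergence need only be tested on a dense subspace. -/
theorem tendsto_inner_of_dense {S : Submodule ℂ H} (hS : Dense (S : Set H)) {ι : Type*}
    {l : Filter ι} {u : ι → H} {g : H} {C : ℝ} (hu : ∀ᶠ i in l, ‖u i‖ ≤ C)
    (h : ∀ k ∈ S, Tendsto (fun i => inner ℂ k (u i)) l (𝓝 (inner ℂ k g))) (k : H) :
    Tendsto (fun i => inner ℂ k (u i)) l (𝓝 (inner ℂ k g)) := by
  rw [Metric.tendsto_nhds]
  intro ε hε
  have hB : 0 < |C| + ‖g‖ + 1 := by positivity
  obtain ⟨k₀, hk₀, hkS⟩ := hS.exists_dist_lt k (ε := ε / 2 / (|C| + ‖g‖ + 1)) (by positivity)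
  have h1 := Metric.tendsto_nhds.1 (h k₀ hk₀) (ε / 2) (by positivity)
  filter_upwards [h1, hu] with i hi hui
  rw [dist_eq_norm] at hi hkS ⊢
  have e : (inner ℂ k (u i) - inner ℂ k g : ℂ)
      = inner ℂ (k - k₀) (u i - g) + (inner ℂ k₀ (u i) - inner ℂ k₀ g) := by
    rw [inner_sub_left, inner_sub_right, inner_sub_right]; ring
  rw [e]
  have h2 : ‖(inner ℂ (k - k₀) (u i - g) : ℂ)‖ ≤ ε / 2 := by
    refine (norm_inner_le_norm _ _).trans ?_
    have h3 : ‖u i - g‖ ≤ |C| + ‖g‖ + 1 :=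
      (norm_sub_le _ _).trans (by linarith [hui.trans (le_abs_self C)])
    calc ‖k - k₀‖ * ‖u i - g‖ ≤ ε / 2 / (|C| + ‖g‖ + 1) * (|C| + ‖g‖ + 1) := by gcongr
      _ = ε / 2 := by field_simp
  linarith [norm_add_le (inner ℂ (k - k₀) (u i - g) : ℂ) (inner ℂ k₀ (u i) - inner ℂ k₀ g)]

/-- A bounded family has a weak cluster point. -/
theorem exists_weak_limit [CompleteSpace H] {ι : Type*} {l : Filter ι} [l.NeBot] {u : ι → H}
    {C : ℝ} (hu : ∀ᶠ i in l, ‖u i‖ ≤ C) :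
    ∃ g : H, ∀ k a, Tendsto (fun i => inner ℂ k (u i)) l (𝓝 a) → inner ℂ k g = a := by
  -- An ultrafilter replaces the extraction of subsequences: every bounded scalar family converges
  -- along it. The limits form a bounded functional, represented by the Riesz theorem.
  set U := Ultrafilter.of l with hU
  have hUl : (U : Filter ι) ≤ l := Ultrafilter.of_le l
  have hC : ∀ᶠ i in (U : Filter ι), ‖u i‖ ≤ C := hUl hu
  have hlim : ∀ k : H, ∃ a : ℂ, ‖a‖ ≤ C * ‖k‖ ∧
      Tendsto (fun i => inner ℂ (u i) k) (U : Filter ι) (𝓝 a) := by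
    intro k
    have hmem : Metric.closedBall (0 : ℂ) (C * ‖k‖) ∈ (U.map fun i => (inner ℂ (u i) k : ℂ)) := by
      change ∀ᶠ i in (U : Filter ι), (inner ℂ (u i) k : ℂ) ∈ Metric.closedBall (0 : ℂ) (C * ‖k‖)
      filter_upwards [hC] with i hi
      rw [mem_closedBall_zero_iff]
      refine (norm_inner_le_norm _ _).trans ?_
      gcongr
    obtain ⟨a, ha, hle⟩ := (isCompact_closedBall (0 : ℂ) (C * ‖k‖)).ultrafilter_le_nhds
      (U.map fun i => (inner ℂ (u i) k : ℂ)) (le_principal_iff.2 hmem)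
    exact ⟨a, mem_closedBall_zero_iff.1 ha, hle⟩
  choose L hLb hL using hlim
  let Λ : H →L[ℂ] ℂ := LinearMap.mkContinuous
    { toFun := L
      map_add' := fun x y => by
        refine tendsto_nhds_unique (hL (x + y)) ?_
        simp only [inner_add_right]
        exact (hL x).add (hL y)
      map_smul' := fun c x => by
        refine tendsto_nhds_unique (hL (c • x)) ?_
        simp only [inner_smul_right]
        exact (hL x).const_mul c } C hLb
  refine ⟨(InnerProductSpace.toDual ℂ H).symm Λ, fun k a ha => ?_⟩
  rw [← inner_conj_symm, InnerProductSpace.toDual_symm_apply]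
  have h1 : Tendsto (fun i => (starRingEnd ℂ) (inner ℂ k (u i))) (U : Filter ι)
      (𝓝 ((starRingEnd ℂ) a)) := (Complex.continuous_conj.tendsto a).comp (ha.mono_left hUl)
  simp only [inner_conj_symm] at h1
  have h2 : Λ k = L k := rfl
  rw [h2, tendsto_nhds_unique (hL k) h1, Complex.conj_conj]

end WeakLimits

/-! ### Smooth functions on the strip with bounded horizontal support -/

section BoxFunctions

/-- Smooth functions on the plane that vanish for large `|x|`. -/
structure IsBoxFun (F : ℝ × ℝ → ℝ) : Prop where
  smooth : ContDiff ℝ ∞ F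
  supp : ∃ L, ∀ p, L ≤ |p.1| → F p = 0

theorem IsBoxFun.of_hasCompactSupport {F : ℝ × ℝ → ℝ} (hF : ContDiff ℝ ∞ F)
    (hc : HasCompactSupport F) : IsBoxFun F := by
  refine ⟨hF, ?_⟩
  obtain ⟨L, hL⟩ := (hc.image continuous_fst).isBounded.exists_norm_le
  refine ⟨L + 1, fun p hp => ?_⟩
  by_contra hne
  have := hL p.1 ⟨p, subset_tsupport _ hne, rfl⟩
  rw [Real.norm_eq_abs] at this
  linarith

theorem IsBoxFun.fderiv {F : ℝ × ℝ → ℝ} (hF : IsBoxFun F) (v : ℝ × ℝ) :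
    IsBoxFun fun p => fderiv ℝ F p v := by
  refine ⟨(hF.smooth.fderiv_right (m := ∞) (by simp)).clm_apply contDiff_const, ?_⟩
  obtain ⟨L, hL⟩ := hF.supp
  refine ⟨L + 1, fun p hp => ?_⟩
  have hev : F =ᶠ[nhds p] fun _ => 0 := by
    have hopen : IsOpen {q : ℝ × ℝ | L < |q.1|} := isOpen_lt continuous_const (by fun_prop)
    filter_upwards [hopen.mem_nhds (show L < |p.1| by linarith)] with q hq
    exact hL q (le_of_lt hq)
  rw [hev.fderiv_eq]; simp

theorem IsBoxFun.exists_bound {F : ℝ × ℝ → ℝ} (hF : IsBoxFun F) (d : ℝ) :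
    ∃ C, ∀ p : ℝ × ℝ, p.2 ∈ Icc 0 d → |F p| ≤ C := by
  obtain ⟨L, hL⟩ := hF.supp
  obtain ⟨C, hC⟩ := (isCompact_Icc.prod isCompact_Icc).exists_bound_of_continuousOn
    (s := Icc (-L) L ×ˢ Icc 0 d) hF.smooth.continuous.continuousOn
  refine ⟨max C 0, fun p hp => ?_⟩
  by_cases h : |p.1| ≤ L
  · exact (hC p ⟨abs_le.1 h, hp⟩).trans (le_max_left _ _)
  · rw [hL p (le_of_not_ge h), abs_zero]; exact le_max_right _ _

theorem volume_box_lt_top (L d : ℝ) :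
    volume (strip d ∩ {p : ℝ × ℝ | |p.1| ≤ L}) < ⊤ := by
  have h : strip d ∩ {p : ℝ × ℝ | |p.1| ≤ L} ⊆ Icc (-L) L ×ˢ Icc 0 d := by
    rintro p ⟨hp, hL⟩
    exact ⟨abs_le.1 hL, hp.1.le, hp.2.le⟩
  exact (measure_mono h).trans_lt (isCompact_Icc.prod isCompact_Icc).measure_lt_top

theorem measurableSet_absLe (L : ℝ) : MeasurableSet {p : ℝ × ℝ | |p.1| ≤ L} :=
  measurableSet_le (by fun_prop) measurable_const

theorem memLp_of_bounded_box {d : ℝ} {G : ℝ × ℝ → ℂ}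
    (hm : AEStronglyMeasurable G (volume.restrict (strip d))) {L C : ℝ}
    (hL : ∀ p, L < |p.1| → G p = 0) (hC : ∀ p ∈ strip d, ‖G p‖ ≤ C) :
    MemLp G 2 (volume.restrict (strip d)) := by
  have h1 : G = {p : ℝ × ℝ | |p.1| ≤ L}.indicator G := by
    ext p
    by_cases h : |p.1| ≤ L
    · rw [indicator_of_mem (show p ∈ {p : ℝ × ℝ | |p.1| ≤ L} from h)]
    · rw [indicator_of_notMem (show p ∉ {p : ℝ × ℝ | |p.1| ≤ L} from h), hL p (lt_of_not_ge h)]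
  rw [h1, memLp_indicator_iff_restrict (measurableSet_absLe L),
    Measure.restrict_restrict (measurableSet_absLe L), inter_comm]
  have : IsFiniteMeasure (volume.restrict (strip d ∩ {p : ℝ × ℝ | |p.1| ≤ L})) :=
    ⟨by rw [Measure.restrict_apply_univ]; exact volume_box_lt_top L d⟩
  refine MemLp.of_bound (hm.mono_measure (Measure.restrict_mono inter_subset_left le_rfl)) C ?_
  filter_upwards [ae_restrict_mem ((isOpen_strip d).measurableSet.inter (measurableSet_absLe L))]
    with p hp
  exact hC p hp.1

theorem IsBoxFun.memLp {F : ℝ × ℝ → ℝ} (hF : IsBoxFun F) (d : ℝ) :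
    MemLp (fun p => (F p : ℂ)) 2 (volume.restrict (strip d)) := by
  obtain ⟨L, hL⟩ := hF.supp
  obtain ⟨C, hC⟩ := hF.exists_bound d
  have hcont := hF.smooth.continuous
  refine memLp_of_bounded_box (L := L) (C := C) (by
    exact (Complex.continuous_ofReal.comp hcont).aestronglyMeasurable) ?_ ?_
  · intro p hp; rw [hL p hp.le]; rfl
  · intro p hp
    rw [Complex.norm_real]
    exact hC p ⟨hp.1.le, hp.2.le⟩

/-- A smooth function with bounded horizontal support as an element of `L²(Ω)`. -/
noncomputable def IsBoxFun.toL2 {F : ℝ × ℝ → ℝ} (hF : IsBoxFun F) (d : ℝ) : L2Strip d :=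
  (hF.memLp d).toLp _

theorem IsBoxFun.coeFn_toL2 {F : ℝ × ℝ → ℝ} (hF : IsBoxFun F) (d : ℝ) :
    hF.toL2 d =ᵐ[volume.restrict (strip d)] fun p => (F p : ℂ) :=
  (hF.memLp d).coeFn_toLp

theorem IsBoxFun.inner_toL2 {F : ℝ × ℝ → ℝ} (hF : IsBoxFun F) {d : ℝ} (f : L2Strip d) :
    inner ℂ (hF.toL2 d) f = ∫ p in strip d, F p • f p := by
  rw [inner_eq_integral_conj_mul]
  refine integral_congr_ae ?_
  filter_upwards [hF.coeFn_toL2 d] with p hp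
  rw [hp, Complex.conj_ofReal, Complex.real_smul]

/-- In this form each condition is continuous in `(f, g)` and can be moved by adjoints, which gives
closedness of the weak derivative and its commutation with translations. -/
theorem isWeakDeriv_iff_inner {d : ℝ} {v : ℝ × ℝ} {f g : L2Strip d} :
    IsWeakDeriv d v f g ↔ ∀ φ : ℝ × ℝ → ℝ, ∀ hφ : ContDiff ℝ ∞ φ, ∀ hc : HasCompactSupport φ,
      tsupport φ ⊆ strip d →
      inner ℂ (((IsBoxFun.of_hasCompactSupport hφ hc).fderiv v).toL2 d) f
        = - inner ℂ ((IsBoxFun.of_hasCompactSupport hφ hc).toL2 d) g := by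
  simp only [IsBoxFun.inner_toL2]
  rfl

theorem IsBoxFun.isWeakDeriv {F : ℝ × ℝ → ℝ} (hF : IsBoxFun F) (d : ℝ) (v : ℝ × ℝ) :
    IsWeakDeriv d v (hF.toL2 d) ((hF.fderiv v).toL2 d) := by
  intro φ hφ hc hs
  have hc1 := hφ.continuous
  have hc2 : Continuous fun p => _root_.fderiv ℝ φ p v :=
    (hφ.continuous_fderiv (by simp)).clm_apply continuous_const
  have hF1 := hF.smooth.continuous
  have hF2 := (hF.fderiv v).smooth.continuous
  have e : ∀ k : ℝ × ℝ → ℝ, (∀ p, p ∉ tsupport φ → k p = 0) →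
      ∫ p in strip d, k p = ∫ p, k p := by
    intro k hk
    exact setIntegral_eq_integral_of_forall_compl_eq_zero fun p hp => hk p fun h => hp (hs h)
  have e1 : ∫ p in strip d, (_root_.fderiv ℝ φ p v) • (hF.toL2 d) p
      = ((∫ p, F p * _root_.fderiv ℝ φ p v : ℝ) : ℂ) := by
    rw [← e _ fun p hp => ?_, ← integral_complex_ofReal]
    · refine integral_congr_ae ?_
      filter_upwards [hF.coeFn_toL2 d] with p hp
      rw [hp, Complex.real_smul]; push_cast; ring
    · have : _root_.fderiv ℝ φ p = 0 := by
        by_contra hne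
        exact hp (support_fderiv_subset ℝ hne)
      rw [this]; simp
  have e2 : ∫ p in strip d, φ p • ((hF.fderiv v).toL2 d) p
      = ((∫ p, _root_.fderiv ℝ F p v * φ p : ℝ) : ℂ) := by
    rw [← e _ fun p hp => ?_, ← integral_complex_ofReal]
    · refine integral_congr_ae ?_
      filter_upwards [(hF.fderiv v).coeFn_toL2 d] with p hp
      rw [hp, Complex.real_smul]; push_cast; ring
    · rw [image_eq_zero_of_notMem_tsupport hp, mul_zero]
  rw [e1, e2, integral_mul_fderiv_eq_neg_fderiv_mul_of_integrable]
  · push_cast; rfl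
  · exact (hF2.mul hc1).integrable_of_hasCompactSupport hc.mul_left
  · exact (hF1.mul hc2).integrable_of_hasCompactSupport (hc.fderiv_apply ℝ v).mul_left
  · exact (hF1.mul hc1).integrable_of_hasCompactSupport hc.mul_left
  · exact fun p _ => hF.smooth.differentiable (by simp) p
  · exact fun p _ => hφ.differentiable (by simp) p

/-- The trace of a smooth function is its restriction to the line. -/
theorem IsBoxFun.traceOp_ae {F : ℝ × ℝ → ℝ} (hF : IsBoxFun F) {d c : ℝ} (hd : 0 < d)
    (hc : c = 0 ∨ c = d) :
    traceOp d c (hF.toL2 d, (hF.fderiv (0, 1)).toL2 d) =ᵐ[volume] fun x => (F (x, c) : ℂ) := by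
  filter_upwards [coeFn_traceOp d c (hF.toL2 d) ((hF.fderiv (0, 1)).toL2 d),
    ae_fiber (hF.coeFn_toL2 d), ae_fiber ((hF.fderiv (0, 1)).coeFn_toL2 d)] with x h1 h2 h3
  have hprim : ∀ y, (F (x, y) : ℂ)
      = F (x, 0) + ∫ s in (0 : ℝ)..y, ((_root_.fderiv ℝ F (x, s) (0, 1) : ℝ) : ℂ) := by
    intro y
    have hcont : Continuous fun s => _root_.fderiv ℝ F (x, s) (0, 1) :=
      (hF.fderiv (0, 1)).smooth.continuous.comp (by fun_prop)
    have hder : ∀ s, HasDerivAt (fun s => F (x, s)) (_root_.fderiv ℝ F (x, s) (0, 1)) s := by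
      intro s
      have h4 : HasFDerivAt F (_root_.fderiv ℝ F (x, s)) (x, s) :=
        (hF.smooth.differentiable (by simp) _).hasFDerivAt
      exact h4.comp_hasDerivAt s ((hasDerivAt_const s x).prodMk (hasDerivAt_id s))
    rw [intervalIntegral.integral_ofReal,
      intervalIntegral.integral_eq_sub_of_hasDerivAt (fun s _ => hder s) (hcont.intervalIntegrable _ _)]
    push_cast; ring
  have hcont : Continuous fun s => ((_root_.fderiv ℝ F (x, s) (0, 1) : ℝ) : ℂ) :=
    Complex.continuous_ofReal.comp ((hF.fderiv (0, 1)).smooth.continuous.comp (by fun_prop))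
  have h5 := trace_formula hd hc (hcont.intervalIntegrable 0 d) (.of_forall hprim)
  rw [h1, hprim c, ← h5]
  congr 1
  · refine integral_congr_ae ?_
    filter_upwards [h2] with s hs
    rw [hs]
  · refine integral_congr_ae ?_
    filter_upwards [h3] with s hs
    rw [hs]

/-- The span of the test functions. -/
noncomputable def testSpan (d : ℝ) : Submodule ℂ (L2Strip d) :=
  Submodule.span ℂ {k | ∃ φ : ℝ × ℝ → ℝ, ∃ hφ : ContDiff ℝ ∞ φ, ∃ hc : HasCompactSupport φ,
    tsupport φ ⊆ strip d ∧ k = (IsBoxFun.of_hasCompactSupport hφ hc).toL2 d}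

/-- The hypothesis says that `f` is a weak derivative of `0` in the direction `0`, so uniqueness of
weak derivatives applies. -/
theorem eq_zero_of_inner_test {d : ℝ} {f : L2Strip d}
    (h : ∀ φ : ℝ × ℝ → ℝ, ∀ hφ : ContDiff ℝ ∞ φ, ∀ hc : HasCompactSupport φ,
      tsupport φ ⊆ strip d → inner ℂ ((IsBoxFun.of_hasCompactSupport hφ hc).toL2 d) f = 0) :
    f = 0 := by
  have hw : IsWeakDeriv d 0 0 f := by
    intro φ hφ hc hs
    have := h φ hφ hc hs
    rw [IsBoxFun.inner_toL2] at this
    rw [this]; simp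
  have hw' : IsWeakDeriv d 0 0 0 := isWeakDeriv_zero d 0
  exact hw.unique hw'

theorem dense_testSpan (d : ℝ) : Dense (testSpan d : Set (L2Strip d)) := by
  rw [Submodule.dense_iff_topologicalClosure_eq_top, Submodule.topologicalClosure_eq_top_iff,
    Submodule.eq_bot_iff]
  intro f hf
  refine eq_zero_of_inner_test fun φ hφ hc hs => ?_
  exact (Submodule.mem_orthogonal _ _).1 hf _ (Submodule.subset_span ⟨φ, hφ, hc, hs, rfl⟩)

theorem isClosed_isWeakDeriv (d : ℝ) (v : ℝ × ℝ) :
    IsClosed {q : L2Strip d × L2Strip d | IsWeakDeriv d v q.1 q.2} := by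
  simp only [isWeakDeriv_iff_inner, Set.ofPred_forall]
  refine isClosed_iInter fun φ => isClosed_iInter fun hφ => isClosed_iInter fun hc =>
    isClosed_iInter fun hs => ?_
  exact isClosed_eq (by fun_prop) (by fun_prop)

end BoxFunctions

/-! ### Horizontal translations -/

section Translations

open Filter Topology

theorem measurePreserving_shift (d h : ℝ) :
    MeasurePreserving (fun p : ℝ × ℝ => (p.1 + h, p.2)) (volume.restrict (strip d))
      (volume.restrict (strip d)) := by
  rw [volume_restrict_strip]
  exact (measurePreserving_add_right volume h).prod (MeasurePreserving.id _)

/-- Horizontal translation on `L²(Ω)`. -/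
noncomputable def shift (d h : ℝ) : L2Strip d →ₗᵢ[ℂ] L2Strip d :=
  Lp.compMeasurePreservingₗᵢ ℂ _ (measurePreserving_shift d h)

/-- Translation on `L²(ℝ)`. -/
noncomputable def shiftLine (h : ℝ) :
    Lp ℂ 2 (volume : Measure ℝ) →ₗᵢ[ℂ] Lp ℂ 2 (volume : Measure ℝ) :=
  Lp.compMeasurePreservingₗᵢ ℂ _ (measurePreserving_add_right (volume : Measure ℝ) h)

theorem coeFn_shift (d h : ℝ) (f : L2Strip d) :
    shift d h f =ᵐ[volume.restrict (strip d)] fun p => f (p.1 + h, p.2) :=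
  Lp.coeFn_compMeasurePreserving f (measurePreserving_shift d h)

theorem coeFn_shiftLine (h : ℝ) (f : Lp ℂ 2 (volume : Measure ℝ)) :
    shiftLine h f =ᵐ[volume] fun x => f (x + h) :=
  Lp.coeFn_compMeasurePreserving f (measurePreserving_add_right (volume : Measure ℝ) h)

theorem shift_shift (d h k : ℝ) (f : L2Strip d) : shift d h (shift d k f) = shift d (h + k) f := by
  refine Lp.ext ?_
  filter_upwards [coeFn_shift d h (shift d k f), coeFn_shift d (h + k) f,
    (measurePreserving_shift d h).quasiMeasurePreserving.ae (coeFn_shift d k f)] with p h1 h2 h3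
  rw [h1, h2, h3, add_assoc]

theorem shift_zero (d : ℝ) (f : L2Strip d) : shift d 0 f = f := by
  refine Lp.ext ?_
  filter_upwards [coeFn_shift d 0 f] with p h1
  rw [h1, add_zero]

theorem shiftLine_shiftLine (h k : ℝ) (f : Lp ℂ 2 (volume : Measure ℝ)) :
    shiftLine h (shiftLine k f) = shiftLine (h + k) f := by
  refine Lp.ext ?_
  filter_upwards [coeFn_shiftLine h (shiftLine k f), coeFn_shiftLine (h + k) f,
    (measurePreserving_add_right (volume : Measure ℝ) h).quasiMeasurePreserving.ae
      (coeFn_shiftLine k f)] with p h1 h2 h3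
  rw [h1, h2, h3, add_assoc]

theorem shiftLine_zero (f : Lp ℂ 2 (volume : Measure ℝ)) : shiftLine 0 f = f := by
  refine Lp.ext ?_
  filter_upwards [coeFn_shiftLine 0 f] with p h1
  rw [h1, add_zero]

theorem inner_shift_left (d h : ℝ) (f g : L2Strip d) :
    inner ℂ (shift d h f) g = inner ℂ f (shift d (-h) g) := by
  have e : g = shift d h (shift d (-h) g) := by rw [shift_shift, add_neg_cancel, shift_zero]
  conv_lhs => rw [e]
  rw [LinearIsometry.inner_map_map]

theorem inner_shiftLine_left (h : ℝ) (f g : Lp ℂ 2 (volume : Measure ℝ)) :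
    inner ℂ (shiftLine h f) g = inner ℂ f (shiftLine (-h) g) := by
  have e : g = shiftLine h (shiftLine (-h) g) := by
    rw [shiftLine_shiftLine, add_neg_cancel, shiftLine_zero]
  conv_lhs => rw [e]
  rw [LinearIsometry.inner_map_map]

theorem traceOp_shift (d c h : ℝ) (f g : L2Strip d) :
    traceOp d c (shift d h f, shift d h g) = shiftLine h (traceOp d c (f, g)) := by
  refine Lp.ext ?_
  filter_upwards [coeFn_traceOp d c (shift d h f) (shift d h g), coeFn_shiftLine h (traceOp d c (f, g)),
    (measurePreserving_add_right (volume : Measure ℝ) h).quasiMeasurePreserving.ae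
      (coeFn_traceOp d c f g), ae_fiber (coeFn_shift d h f), ae_fiber (coeFn_shift d h g)]
    with x h1 h2 h3 h4 h5
  rw [h1, h2, h3]
  congr 1
  · refine integral_congr_ae ?_
    filter_upwards [h4] with s hs
    rw [hs]
  · refine integral_congr_ae ?_
    filter_upwards [h5] with s hs
    rw [hs]

theorem IsBoxFun.comp_shift {F : ℝ × ℝ → ℝ} (hF : IsBoxFun F) (h : ℝ) :
    IsBoxFun fun p => F (p.1 + h, p.2) := by
  refine ⟨hF.smooth.comp (by fun_prop), ?_⟩
  obtain ⟨L, hL⟩ := hF.supp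
  refine ⟨L + |h|, fun p hp => hL _ ?_⟩
  have := abs_sub_abs_le_abs_sub p.1 (-h)
  rw [abs_neg, sub_neg_eq_add] at this
  simp only
  linarith

theorem IsBoxFun.toL2_congr {F G : ℝ × ℝ → ℝ} (hF : IsBoxFun F) (hG : IsBoxFun G) (d : ℝ)
    (h : ∀ p, F p = G p) : hF.toL2 d = hG.toL2 d :=
  MemLp.toLp_congr _ _ (.of_forall fun p => by simp only [h p])

theorem IsBoxFun.shift_toL2 {F : ℝ × ℝ → ℝ} (hF : IsBoxFun F) (d h : ℝ) :
    shift d h (hF.toL2 d) = (hF.comp_shift h).toL2 d := by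
  refine Lp.ext ?_
  filter_upwards [coeFn_shift d h (hF.toL2 d), (hF.comp_shift h).coeFn_toL2 d,
    (measurePreserving_shift d h).quasiMeasurePreserving.ae (hF.coeFn_toL2 d)] with p h1 h2 h3
  rw [h1, h2, h3]

theorem fderiv_comp_shift {F : ℝ × ℝ → ℝ} (h : ℝ) (v p : ℝ × ℝ) :
    fderiv ℝ (fun q : ℝ × ℝ => F (q.1 + h, q.2)) p v = fderiv ℝ F (p.1 + h, p.2) v := by
  have e : (fun q : ℝ × ℝ => F (q.1 + h, q.2)) = fun q => F (q + (h, 0)) := by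
    ext q; simp [Prod.add_def]
  rw [e, fderiv_comp_add_right]
  simp [Prod.add_def]

theorem IsBoxFun.shift_fderiv_toL2 {F : ℝ × ℝ → ℝ} (hF : IsBoxFun F) (d h : ℝ) (v : ℝ × ℝ) :
    shift d h ((hF.fderiv v).toL2 d) = ((hF.comp_shift h).fderiv v).toL2 d := by
  rw [IsBoxFun.shift_toL2]
  exact IsBoxFun.toL2_congr _ _ d fun p => (fderiv_comp_shift h v p).symm

theorem tsupport_comp_shift {φ : ℝ × ℝ → ℝ} {d : ℝ} (hc : HasCompactSupport φ)
    (hs : tsupport φ ⊆ strip d) (h : ℝ) :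
    HasCompactSupport (fun p : ℝ × ℝ => φ (p.1 + h, p.2)) ∧
      tsupport (fun p : ℝ × ℝ => φ (p.1 + h, p.2)) ⊆ strip d := by
  let e : ℝ × ℝ ≃ₜ ℝ × ℝ := (Homeomorph.addRight h).prodCongr (Homeomorph.refl ℝ)
  have he : (fun p : ℝ × ℝ => φ (p.1 + h, p.2)) = φ ∘ e := rfl
  refine ⟨he ▸ hc.comp_homeomorph e, ?_⟩
  rw [he, tsupport_comp_eq_preimage φ e]
  intro p hp
  have h' : e p ∈ strip d := hs hp
  exact h'

theorem IsWeakDeriv.translate {d : ℝ} {v : ℝ × ℝ} {f g : L2Strip d} (hfg : IsWeakDeriv d v f g)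
    (h : ℝ) : IsWeakDeriv d v (shift d h f) (shift d h g) := by
  rw [isWeakDeriv_iff_inner] at hfg ⊢
  intro φ hφ hc hs
  obtain ⟨hc', hs'⟩ := tsupport_comp_shift hc hs (-h)
  have hb := IsBoxFun.of_hasCompactSupport hφ hc
  have := hfg _ (hb.comp_shift (-h)).smooth hc' hs'
  rw [← IsBoxFun.shift_fderiv_toL2 hb, ← IsBoxFun.shift_toL2 hb, inner_shift_left, inner_shift_left,
    neg_neg] at this
  exact this

/-- Translates of a smooth function are weakly differentiable in the translation parameter. -/
theorem IsBoxFun.hasDerivAt_inner_shift {F : ℝ × ℝ → ℝ} (hF : IsBoxFun F) {d : ℝ} (f : L2Strip d)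
    (h₀ : ℝ) : HasDerivAt (fun h => inner ℂ (shift d h (hF.toL2 d)) f)
      (inner ℂ (shift d h₀ ((hF.fderiv (1, 0)).toL2 d)) f) h₀ := by
  simp only [IsBoxFun.shift_toL2, IsBoxFun.inner_toL2]
  obtain ⟨L, hL⟩ := (hF.fderiv (1, 0)).supp
  obtain ⟨C, hC⟩ := (hF.fderiv (1, 0)).exists_bound d
  -- For `|h - h₀| < 1` all translated derivatives vanish outside this box of finite measure, on
  -- which `f` is integrable; this dominates differentiation under the integral.
  have hbd : Integrable ({p : ℝ × ℝ | |p.1| ≤ L + |h₀| + 1}.indicator fun p => |C| * ‖f p‖)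
      (volume.restrict (strip d)) := by
    rw [integrable_indicator_iff (measurableSet_absLe _), IntegrableOn,
      Measure.restrict_restrict (measurableSet_absLe _), inter_comm]
    have : IsFiniteMeasure
        (volume.restrict (strip d ∩ {p : ℝ × ℝ | |p.1| ≤ L + |h₀| + 1})) :=
      ⟨by rw [Measure.restrict_apply_univ]; exact volume_box_lt_top _ d⟩
    have hf : MemLp f 2 (volume.restrict (strip d ∩ {p : ℝ × ℝ | |p.1| ≤ L + |h₀| + 1})) :=
      (Lp.memLp f).mono_measure (Measure.restrict_mono inter_subset_left le_rfl)
    exact (hf.integrable (by norm_num)).norm.const_mul _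
  have hmeas : ∀ {G : ℝ × ℝ → ℝ}, IsBoxFun G → ∀ h, AEStronglyMeasurable
      (fun p : ℝ × ℝ => G (p.1 + h, p.2) • f p) (volume.restrict (strip d)) := by
    intro G hG h
    exact ((hG.comp_shift h).smooth.continuous.aestronglyMeasurable).smul (Lp.memLp f).1
  refine (hasDerivAt_integral_of_dominated_loc_of_deriv_le (𝕜 := ℝ)
    (F := fun h (p : ℝ × ℝ) => F (p.1 + h, p.2) • f p)
    (F' := fun h (p : ℝ × ℝ) => _root_.fderiv ℝ F (p.1 + h, p.2) (1, 0) • f p)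
    (bound := {p : ℝ × ℝ | |p.1| ≤ L + |h₀| + 1}.indicator fun p => |C| * ‖f p‖)
    (Metric.ball_mem_nhds h₀ one_pos) (.of_forall fun h => hmeas hF h) ?_
    (hmeas (hF.fderiv (1, 0)) h₀) ?_ hbd ?_).2
  · have h1 := (L2.integrable_inner (𝕜 := ℂ) ((hF.comp_shift h₀).toL2 d) f)
    refine h1.congr ?_
    filter_upwards [(hF.comp_shift h₀).coeFn_toL2 d] with p hp
    rw [hp, RCLike.inner_apply, Complex.conj_ofReal, Complex.real_smul, mul_comm]
  · filter_upwards [ae_restrict_mem (isOpen_strip d).measurableSet] with p hp h hh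
    by_cases hpL : |p.1| ≤ L + |h₀| + 1
    · rw [indicator_of_mem (show p ∈ {p : ℝ × ℝ | |p.1| ≤ L + |h₀| + 1} from hpL), norm_smul]
      gcongr
      exact (hC (p.1 + h, p.2) ⟨hp.1.le, hp.2.le⟩).trans (le_abs_self C)
    · have hz : L ≤ |p.1 + h| := by
        rw [Metric.mem_ball, Real.dist_eq] at hh
        have h1 := abs_sub_abs_le_abs_sub p.1 (-h)
        rw [abs_neg, sub_neg_eq_add] at h1
        have h2 := abs_sub_abs_le_abs_sub h h₀
        linarith
      have hz' : _root_.fderiv ℝ F (p.1 + h, p.2) (1, 0) = 0 := hL (p.1 + h, p.2) hz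
      rw [hz', zero_smul, norm_zero]
      exact indicator_nonneg (fun _ _ => by positivity) _
  · refine .of_forall fun p h _ => ?_
    have h4 : HasFDerivAt F (_root_.fderiv ℝ F (p.1 + h, p.2)) (p.1 + h, p.2) :=
      (hF.smooth.differentiable (by simp) _).hasFDerivAt
    have h5 := h4.comp_hasDerivAt h
      (((hasDerivAt_id h).const_add p.1).prodMk (hasDerivAt_const h p.2))
    exact h5.smul_const (f p)

/-- Differentiating in the translation parameter differentiates the test function in `x`, and the
weak derivative moves this onto `f`, which accounts for the sign. -/
theorem IsWeakDeriv.hasDerivAt_inner_shift_test {d : ℝ} {f g : L2Strip d}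
    (hfg : IsWeakDeriv d (1, 0) f g) {k : L2Strip d} (hk : k ∈ testSpan d) (h : ℝ) :
    HasDerivAt (fun h => inner ℂ (shift d h k) f) (-inner ℂ (shift d h k) g) h := by
  induction hk using Submodule.span_induction with
  | mem k hk =>
    obtain ⟨φ, hφ, hc, hs, rfl⟩ := hk
    have hb := IsBoxFun.of_hasCompactSupport hφ hc
    have h1 := hb.hasDerivAt_inner_shift f h
    obtain ⟨hc', hs'⟩ := tsupport_comp_shift hc hs h
    have h2 := isWeakDeriv_iff_inner.1 hfg _ (hb.comp_shift h).smooth hc' hs'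
    rw [IsBoxFun.shift_fderiv_toL2 hb, h2, ← IsBoxFun.shift_toL2 hb] at h1
    exact h1
  | zero => simpa using hasDerivAt_const h (0 : ℂ)
  | add x y _ _ hx hy =>
    simp only [map_add, inner_add_left, neg_add]
    exact hx.add hy
  | smul a x _ hx =>
    simp only [map_smul, inner_smul_left, ← mul_neg]
    exact hx.const_mul _

/-- The difference quotients of a function are bounded by its horizontal derivative. -/
theorem IsWeakDeriv.norm_shift_sub_le {d : ℝ} {f g : L2Strip d} (hfg : IsWeakDeriv d (1, 0) f g)
    (h : ℝ) : ‖shift d h f - f‖ ≤ |h| * ‖g‖ := by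
  refine norm_le_of_dense_inner (dense_testSpan d) (by positivity) fun k hk => ?_
  -- The mean value inequality for the scalar function `h ↦ ⟨shift h k, f⟩`, between `0` and `-h`.
  have h1 := (convex_univ (𝕜 := ℝ)).norm_image_sub_le_of_norm_hasDerivWithin_le
    (f := fun h => (inner ℂ (shift d h k) f : ℂ)) (C := ‖k‖ * ‖g‖)
    (fun x _ => (hfg.hasDerivAt_inner_shift_test hk x).hasDerivWithinAt)
    (fun x _ => by
      rw [norm_neg]
      refine (norm_inner_le_norm _ _).trans ?_
      rw [LinearIsometry.norm_map]) (mem_univ 0) (mem_univ (-h))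
  rw [inner_shift_left, inner_shift_left, neg_neg, neg_zero, shift_zero, ← inner_sub_right,
    sub_zero, Real.norm_eq_abs, abs_neg] at h1
  linarith

/-- The difference quotients of `f` are bounded by `‖g‖` and converge to `g` when paired with test
functions, hence weakly. -/
theorem IsWeakDeriv.hasDerivAt_inner_shift {d : ℝ} {f g : L2Strip d}
    (hfg : IsWeakDeriv d (1, 0) f g) (k : L2Strip d) :
    HasDerivAt (fun h => inner ℂ k (shift d h f)) (inner ℂ k g) 0 := by
  rw [hasDerivAt_iff_tendsto_slope_zero]
  have e : ∀ (k : L2Strip d) (h : ℝ),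
      (h⁻¹ • ((inner ℂ k (shift d (0 + h) f) : ℂ) - inner ℂ k (shift d 0 f)))
        = inner ℂ k ((h : ℂ)⁻¹ • (shift d h f - f)) := by
    intro k h
    rw [inner_smul_right, inner_sub_right, zero_add, shift_zero, Complex.real_smul]
    push_cast; rfl
  simp only [e]
  refine tendsto_inner_of_dense (C := ‖g‖) (dense_testSpan d) ?_ (fun k hk => ?_) k
  · filter_upwards [self_mem_nhdsWithin] with h hh
    have hh' : 0 < |h| := abs_pos.2 hh
    rw [norm_smul, norm_inv, Complex.norm_real, Real.norm_eq_abs, inv_mul_le_iff₀ hh']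
    exact hfg.norm_shift_sub_le h
  · have h1 := (hfg.hasDerivAt_inner_shift_test hk (-0)).scomp (0 : ℝ) (hasDerivAt_neg (0 : ℝ))
    have h2 : HasDerivAt (fun h => inner ℂ k (shift d h f)) (inner ℂ k g) 0 := by
      refine (h1.congr_deriv ?_).congr_of_eventuallyEq (.of_forall fun h => ?_)
      · rw [neg_zero, shift_zero]; simp
      · simp only [Function.comp_apply]
        rw [inner_shift_left, neg_neg]
    rw [hasDerivAt_iff_tendsto_slope_zero] at h2
    simpa only [e] using h2

/-- Green's formula in the horizontal direction. -/
theorem IsWeakDeriv.green_horizontal {d : ℝ} {f f' g g' : L2Strip d}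
    (hf : IsWeakDeriv d (1, 0) f f') (hg : IsWeakDeriv d (1, 0) g g') :
    inner ℂ f g' = - inner ℂ f' g := by
  -- Both sides are the derivative at `0` of `h ↦ ⟨f, shift h g⟩ = ⟨shift (-h) f, g⟩`. No cutoff in
  -- `x` is needed.
  have h1 := hg.hasDerivAt_inner_shift f
  have h2 := hf.hasDerivAt_inner_shift g
  have h3 : HasDerivAt (fun h => (inner ℂ (shift d h f) g : ℂ)) (inner ℂ f' g) 0 := by
    have := h2.star
    refine (this.congr_deriv (by simp)).congr_of_eventuallyEq (.of_forall fun h => by simp)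
  have h4 : HasDerivAt (fun h => (inner ℂ f (shift d h g) : ℂ)) (-inner ℂ f' g) 0 := by
    rw [← neg_zero] at h3
    have h5 := h3.scomp (0 : ℝ) (hasDerivAt_neg (0 : ℝ))
    refine (h5.congr_deriv (by simp)).congr_of_eventuallyEq (.of_forall fun h => ?_)
    simp only [Function.comp_apply]
    rw [inner_shift_left, neg_neg]
  exact h1.unique h4

/-- A function with bounded difference quotients has a horizontal weak derivative. -/
theorem exists_isWeakDeriv_of_shift_bound {d C : ℝ} {f : L2Strip d}
    (h : ∀ t, ‖shift d t f - f‖ ≤ C * |t|) : ∃ g, IsWeakDeriv d (1, 0) f g := by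
  have hu : ∀ᶠ t : ℝ in 𝓝[≠] 0, ‖(t : ℂ)⁻¹ • (shift d t f - f)‖ ≤ C := by
    filter_upwards [self_mem_nhdsWithin] with t ht
    have ht' : 0 < |t| := abs_pos.2 ht
    rw [norm_smul, norm_inv, Complex.norm_real, Real.norm_eq_abs, inv_mul_le_iff₀ ht', mul_comm]
    exact h t
  obtain ⟨g, hg⟩ := exists_weak_limit hu
  refine ⟨g, isWeakDeriv_iff_inner.2 fun φ hφ hc hs => ?_⟩
  have hb := IsBoxFun.of_hasCompactSupport hφ hc
  rw [eq_neg_iff_add_eq_zero, ← eq_neg_iff_add_eq_zero, eq_comm, neg_eq_iff_eq_neg]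
  apply hg
  have h1 := (hb.hasDerivAt_inner_shift f (-0)).scomp (0 : ℝ) (hasDerivAt_neg (0 : ℝ))
  have h2 : HasDerivAt (fun h => inner ℂ (hb.toL2 d) (shift d h f))
      (-inner ℂ ((hb.fderiv (1, 0)).toL2 d) f) 0 := by
    refine (h1.congr_deriv ?_).congr_of_eventuallyEq (.of_forall fun h => ?_)
    · rw [neg_zero, shift_zero]; simp
    · simp only [Function.comp_apply]
      rw [inner_shift_left, neg_neg]
  rw [hasDerivAt_iff_tendsto_slope_zero] at h2
  refine h2.congr fun t => ?_
  rw [inner_smul_right, inner_sub_right, zero_add, shift_zero, Complex.real_smul]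
  push_cast; rfl

end Translations

/-! ### The energy space and the resolvent of the Robin Laplacian -/

section Energy

/-- The space `L²(ℝ)` of boundary values. -/
abbrev L2Line : Type := Lp ℂ 2 (volume : Measure ℝ)

/-- Multiplication by a bounded real function on `L²(ℝ)`. -/
noncomputable def mulLine {a : ℝ → ℝ} (ha : MemLp a ⊤ volume) : L2Line →L[ℂ] L2Line :=
  (ContinuousLinearMap.mul ℂ ℂ).holderL volume ⊤ 2 2 (MemLp.toLp _ (ha.ofReal (K := ℂ)))

theorem coeFn_mulLine {a : ℝ → ℝ} (ha : MemLp a ⊤ volume) (f : L2Line) :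
    mulLine ha f =ᵐ[volume] fun x => (a x : ℂ) * f x := by
  filter_upwards [(ContinuousLinearMap.mul ℂ ℂ).coeFn_holder (r := 2)
    (MemLp.toLp _ (ha.ofReal (K := ℂ))) f, MemLp.coeFn_toLp (ha.ofReal (K := ℂ))] with x h1 h2
  refine h1.trans ?_
  rw [h2]; rfl

theorem inner_mulLine_left {a : ℝ → ℝ} (ha : MemLp a ⊤ volume) (f g : L2Line) :
    inner ℂ (mulLine ha f) g = inner ℂ f (mulLine ha g) := by
  simp only [inner_eq_integral_conj_mul]
  refine integral_congr_ae ?_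
  filter_upwards [coeFn_mulLine ha f, coeFn_mulLine ha g] with x h1 h2
  rw [h1, h2, map_mul, Complex.conj_ofReal]
  ring

theorem mulLine_mulLine {a b : ℝ → ℝ} (ha : MemLp a ⊤ volume) (hb : MemLp b ⊤ volume)
    (hab : ∀ x, b x * b x = a x) (f : L2Line) : mulLine hb (mulLine hb f) = mulLine ha f := by
  refine Lp.ext ?_
  filter_upwards [coeFn_mulLine hb (mulLine hb f), coeFn_mulLine hb f, coeFn_mulLine ha f]
    with x h1 h2 h3
  rw [h1, h2, h3, ← hab x]
  push_cast; ring

theorem MemLp.sqrt_top {a : ℝ → ℝ} (ha : MemLp a ⊤ volume) :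
    MemLp (fun x => √(a x)) ⊤ volume := by
  obtain ⟨C, hC⟩ : ∃ C, ∀ᵐ x, ‖a x‖ ≤ C := by
    refine ⟨(eLpNorm a ⊤ volume).toReal, ?_⟩
    have := ae_le_eLpNormEssSup (f := a) (μ := volume)
    filter_upwards [this] with x hx
    rw [eLpNorm_exponent_top, ← toReal_enorm]
    exact ENNReal.toReal_mono (by simpa [eLpNorm_exponent_top] using ha.2.ne) hx
  refine memLp_top_of_bound (Real.continuous_sqrt.comp_aestronglyMeasurable ha.1) (√C) ?_
  filter_upwards [hC] with x hx
  rw [Real.norm_eq_abs, abs_of_nonneg (Real.sqrt_nonneg _)]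
  exact Real.sqrt_le_sqrt ((le_abs_self _).trans hx)

/-- `v` and `w` are the horizontal and the vertical weak derivative of `u`. -/
structure IsWeakGrad (d : ℝ) (u v w : L2Strip d) : Prop where
  horiz : IsWeakDeriv d (1, 0) u v
  vert : IsWeakDeriv d (0, 1) u w

theorem IsWeakGrad.add {d : ℝ} {u v w u' v' w' : L2Strip d} (h : IsWeakGrad d u v w)
    (h' : IsWeakGrad d u' v' w') : IsWeakGrad d (u + u') (v + v') (w + w') :=
  ⟨h.1.add h'.1, h.2.add h'.2⟩

theorem IsWeakGrad.smul {d : ℝ} {u v w : L2Strip d} (c : ℂ) (h : IsWeakGrad d u v w) :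
    IsWeakGrad d (c • u) (c • v) (c • w) := ⟨h.1.smul c, h.2.smul c⟩

theorem IsWeakGrad.sub {d : ℝ} {u v w u' v' w' : L2Strip d} (h : IsWeakGrad d u v w)
    (h' : IsWeakGrad d u' v' w') : IsWeakGrad d (u - u') (v - v') (w - w') := by
  simpa only [neg_one_smul, ← sub_eq_add_neg] using h.add (h'.smul (-1))

theorem IsWeakGrad.translate {d : ℝ} {u v w : L2Strip d} (H : IsWeakGrad d u v w) (h : ℝ) :
    IsWeakGrad d (shift d h u) (shift d h v) (shift d h w) :=
  ⟨H.1.translate h, H.2.translate h⟩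

theorem IsBoxFun.isWeakGrad {F : ℝ × ℝ → ℝ} (hF : IsBoxFun F) (d : ℝ) :
    IsWeakGrad d (hF.toL2 d) ((hF.fderiv (1, 0)).toL2 d) ((hF.fderiv (0, 1)).toL2 d) :=
  ⟨hF.isWeakDeriv d _, hF.isWeakDeriv d _⟩

variable {a : ℝ → ℝ}

/-- The form `⟨u, u'⟩ + ⟨∇u, ∇u'⟩ + ∫ a (ū u')(x, 0) + ∫ a (ū u')(x, d)` of `H + 1`, where
`v, w` and `v', w'` stand for the derivatives of `u` and `u'`. -/
noncomputable def robinForm (d : ℝ) (ha : MemLp a ⊤ volume) (u v w u' v' w' : L2Strip d) : ℂ :=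
  inner ℂ u u' + (inner ℂ v v' + inner ℂ w w') +
    (inner ℂ (mulLine ha (traceOp d 0 (u, w))) (traceOp d 0 (u', w')) +
      inner ℂ (mulLine ha (traceOp d d (u, w))) (traceOp d d (u', w')))

/-- The Hilbert space that contains the energy space. -/
abbrev EnergyAmbient (d : ℝ) : Type :=
  WithLp 2 (L2Strip d × WithLp 2 (WithLp 2 (L2Strip d × L2Strip d) × WithLp 2 (L2Line × L2Line)))

/-- The graph of the map `u ↦ (∂₁u, ∂₂u, b u(·, 0), b u(·, d))`. -/
noncomputable def energySpace (d : ℝ) {b : ℝ → ℝ} (hb : MemLp b ⊤ volume) :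
    Submodule ℂ (EnergyAmbient d) where
  carrier := {z | IsWeakGrad d z.fst z.snd.fst.fst z.snd.fst.snd ∧
    z.snd.snd.fst = mulLine hb (traceOp d 0 (z.fst, z.snd.fst.snd)) ∧
    z.snd.snd.snd = mulLine hb (traceOp d d (z.fst, z.snd.fst.snd))}
  add_mem' := by
    rintro z z' ⟨h1, h2, h3⟩ ⟨k1, k2, k3⟩
    refine ⟨h1.add k1, ?_, ?_⟩
    · simp only [WithLp.add_fst, WithLp.add_snd]
      rw [h2, k2, ← map_add, ← map_add, Prod.mk_add_mk]
    · simp only [WithLp.add_fst, WithLp.add_snd]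
      rw [h3, k3, ← map_add, ← map_add, Prod.mk_add_mk]
  zero_mem' := by
    refine ⟨⟨isWeakDeriv_zero d _, isWeakDeriv_zero d _⟩, ?_, ?_⟩
    · simp only [WithLp.zero_fst, WithLp.zero_snd, Prod.mk_zero_zero, map_zero]
    · simp only [WithLp.zero_fst, WithLp.zero_snd, Prod.mk_zero_zero, map_zero]
  smul_mem' := by
    rintro c z ⟨h1, h2, h3⟩
    refine ⟨h1.smul c, ?_, ?_⟩
    · simp only [WithLp.smul_fst, WithLp.smul_snd]
      rw [h2, ← map_smul, ← map_smul, Prod.smul_mk]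
    · simp only [WithLp.smul_fst, WithLp.smul_snd]
      rw [h3, ← map_smul, ← map_smul, Prod.smul_mk]

/-- Weak derivatives form a closed relation and traces are bounded operators, so the graph is
closed. This is what makes the energy space complete. -/
theorem isClosed_energySpace (d : ℝ) {b : ℝ → ℝ} (hb : MemLp b ⊤ volume) :
    IsClosed (energySpace d hb : Set (EnergyAmbient d)) := by
  have c1 : Continuous fun z : EnergyAmbient d => z.fst := (WithLp.fstL 2 ℂ _ _).continuous
  have c2 : Continuous fun z : EnergyAmbient d => z.snd := (WithLp.sndL 2 ℂ _ _).continuous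
  have c3 : Continuous fun z : EnergyAmbient d => z.snd.fst :=
    ((WithLp.fstL 2 ℂ _ _).continuous).comp c2
  have c4 : Continuous fun z : EnergyAmbient d => z.snd.snd :=
    ((WithLp.sndL 2 ℂ _ _).continuous).comp c2
  have c5 : Continuous fun z : EnergyAmbient d => z.snd.fst.fst :=
    ((WithLp.fstL 2 ℂ _ _).continuous).comp c3
  have c6 : Continuous fun z : EnergyAmbient d => z.snd.fst.snd :=
    ((WithLp.sndL 2 ℂ _ _).continuous).comp c3
  have c7 : Continuous fun z : EnergyAmbient d => z.snd.snd.fst :=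
    ((WithLp.fstL 2 ℂ _ _).continuous).comp c4
  have c8 : Continuous fun z : EnergyAmbient d => z.snd.snd.snd :=
    ((WithLp.sndL 2 ℂ _ _).continuous).comp c4
  have h1 := (isClosed_isWeakDeriv d (1, 0)).preimage (c1.prodMk c5)
  have h2 := (isClosed_isWeakDeriv d (0, 1)).preimage (c1.prodMk c6)
  have h3 : ∀ c, Continuous fun z : EnergyAmbient d =>
      mulLine hb (traceOp d c (z.fst, z.snd.fst.snd)) := fun c =>
    (mulLine hb).continuous.comp ((traceOp d c).continuous.comp (c1.prodMk c6))
  have h4 := isClosed_eq c7 (h3 0)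
  have h5 := isClosed_eq c8 (h3 d)
  convert (h1.inter h2).inter (h4.inter h5) using 1
  ext z
  constructor
  · rintro ⟨⟨h1, h2⟩, h3, h4⟩
    exact ⟨⟨h1, h2⟩, h3, h4⟩
  · rintro ⟨⟨h1, h2⟩, h3, h4⟩
    exact ⟨⟨h1, h2⟩, h3, h4⟩

/-- The element of the energy space given by a function and its gradient. -/
noncomputable def IsWeakGrad.toEnergy {d : ℝ} {b : ℝ → ℝ} (hb : MemLp b ⊤ volume)
    {u v w : L2Strip d} (h : IsWeakGrad d u v w) : energySpace d hb :=
  ⟨WithLp.toLp 2 (u, WithLp.toLp 2 (WithLp.toLp 2 (v, w),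
    WithLp.toLp 2 (mulLine hb (traceOp d 0 (u, w)), mulLine hb (traceOp d d (u, w))))),
    h, rfl, rfl⟩

theorem exists_eq_toEnergy {d : ℝ} {b : ℝ → ℝ} (hb : MemLp b ⊤ volume) (z : energySpace d hb) :
    ∃ u v w, ∃ h : IsWeakGrad d u v w, z = h.toEnergy hb := by
  obtain ⟨z, h1, h2, h3⟩ := z
  refine ⟨_, _, _, h1, Subtype.ext ?_⟩
  simp only [IsWeakGrad.toEnergy]
  rw [← h2, ← h3]
  rfl

theorem IsWeakGrad.inner_toEnergy {d : ℝ} {b : ℝ → ℝ} (ha : MemLp a ⊤ volume)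
    (hb : MemLp b ⊤ volume) (hab : ∀ x, b x * b x = a x) {u v w u' v' w' : L2Strip d}
    (h : IsWeakGrad d u v w) (h' : IsWeakGrad d u' v' w') :
    inner ℂ (h.toEnergy hb) (h'.toEnergy hb) = robinForm d ha u v w u' v' w' := by
  rw [Submodule.coe_inner]
  simp only [IsWeakGrad.toEnergy, WithLp.prod_inner_apply, robinForm,
    ← inner_mulLine_left hb, mulLine_mulLine ha hb hab]
  ring

/-! ### Form inverses from bounded maps between Hilbert spaces -/

section AdjointResolvent

variable {K E : Type*} [NormedAddCommGroup K] [InnerProductSpace ℂ K] [CompleteSpace K]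
  [NormedAddCommGroup E] [InnerProductSpace ℂ E] [CompleteSpace E] (P : K →L[ℂ] E)

theorem norm_self_comp_adjoint : ‖P ∘L P.adjoint‖ = ‖P‖ ^ 2 := by
  have := ContinuousLinearMap.norm_adjoint_comp_self P.adjoint
  rw [ContinuousLinearMap.adjoint_adjoint] at this
  rw [this, LinearIsometryEquiv.norm_map, sq]

theorem norm_sq_apply_le_self_comp_adjoint (z : K) :
    ‖P z‖ ^ 2 ≤ ‖P ∘L P.adjoint‖ * (inner ℂ z z : ℂ).re := by
  have h3 : (inner ℂ z z : ℂ).re = ‖z‖ ^ 2 := inner_self_eq_norm_sq (𝕜 := ℂ) _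
  rw [norm_self_comp_adjoint, h3, ← mul_pow]
  gcongr
  exact P.le_opNorm z

/-- The resolvent is `R = P P*`: the Riesz representative of `z ↦ ⟨f, P z⟩` in the energy space is
`P* f`, and it is the unique weak solution. Since `‖P P*‖ = ‖P‖²`, the bound `‖P z‖² ≤ ‖R‖ ‖z‖²` is
a variational principle for `‖R‖`, and this is what lets a single trial function bound it from
below. -/
theorem exists_resolvent_of_embedding {ι : Type*} (e : ι → K) (he : Function.Surjective e)
    (F : ι → ι → ℂ) (hF : ∀ i j, inner ℂ (e i) (e j) = F i j) :
    ∃ R : E →L[ℂ] E, 0 ≤ R ∧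
      (∀ f, ∃ i, R f = P (e i) ∧ ∀ j, F i j = inner ℂ f (P (e j))) ∧
      (∀ f i, (∀ j, F i j = inner ℂ f (P (e j))) → R f = P (e i)) ∧
      ∀ i, ‖P (e i)‖ ^ 2 ≤ ‖R‖ * (F i i).re := by
  refine ⟨P ∘L P.adjoint, ?_, fun f => ?_, fun f i hi => ?_, fun i => ?_⟩
  · rw [ContinuousLinearMap.nonneg_iff_isPositive]
    exact ContinuousLinearMap.isPositive_self_comp_adjoint P
  · obtain ⟨i, hi⟩ := he (P.adjoint f)
    refine ⟨i, by rw [ContinuousLinearMap.comp_apply, hi], fun j => ?_⟩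
    rw [← hF, hi, P.adjoint_inner_left]
  · have : P.adjoint f = e i := by
      refine ext_inner_right ℂ fun z => ?_
      obtain ⟨j, rfl⟩ := he z
      rw [P.adjoint_inner_left, hF, hi]
    rw [ContinuousLinearMap.comp_apply, this]
  · rw [← hF]
    exact norm_sq_apply_le_self_comp_adjoint P (e i)

end AdjointResolvent

/-- The embedding of the energy space into `L²(Ω)`. -/
noncomputable def energyEmbedding (d : ℝ) {b : ℝ → ℝ} (hb : MemLp b ⊤ volume) :
    energySpace d hb →L[ℂ] L2Strip d :=
  (WithLp.fstL 2 ℂ _ _) ∘L (energySpace d hb).subtypeL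

theorem energyEmbedding_toEnergy {d : ℝ} {b : ℝ → ℝ} (hb : MemLp b ⊤ volume)
    {u v w : L2Strip d} (h : IsWeakGrad d u v w) : energyEmbedding d hb (h.toEnergy hb) = u := rfl

/-- The inverse of `H + 1`, in the form sense. -/
theorem exists_form_resolvent (d : ℝ) (ha : MemLp a ⊤ volume) (hpos : ∀ x, 0 ≤ a x) :
    ∃ R : L2Strip d →L[ℂ] L2Strip d, 0 ≤ R ∧
      (∀ f, ∃ v w, IsWeakGrad d (R f) v w ∧ ∀ u' v' w', IsWeakGrad d u' v' w' →
        robinForm d ha (R f) v w u' v' w' = inner ℂ f u') ∧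
      (∀ f u v w, IsWeakGrad d u v w → (∀ u' v' w', IsWeakGrad d u' v' w' →
        robinForm d ha u v w u' v' w' = inner ℂ f u') → R f = u) ∧
      ∀ u v w, IsWeakGrad d u v w → ‖u‖ ^ 2 ≤ ‖R‖ * (robinForm d ha u v w u v w).re := by
  -- With `b = √a` the boundary integrals are inner products of the last two components, so the
  -- ambient inner product restricts to the form.
  have hb : MemLp (fun x => √(a x)) ⊤ volume := MemLp.sqrt_top ha
  have hab : ∀ x, √(a x) * √(a x) = a x := fun x => Real.mul_self_sqrt (hpos x)
  have : CompleteSpace (energySpace d hb) := (isClosed_energySpace d hb).completeSpace_coe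
  let ι := {q : L2Strip d × L2Strip d × L2Strip d // IsWeakGrad d q.1 q.2.1 q.2.2}
  obtain ⟨R, h0, h1, h2, h3⟩ := exists_resolvent_of_embedding (energyEmbedding d hb) (ι := ι)
    (fun q => q.2.toEnergy hb)
    (fun z => by
      obtain ⟨u, v, w, h, rfl⟩ := exists_eq_toEnergy hb z
      exact ⟨⟨(u, v, w), h⟩, rfl⟩)
    (fun q q' => robinForm d ha q.1.1 q.1.2.1 q.1.2.2 q'.1.1 q'.1.2.1 q'.1.2.2)
    (fun q q' => q.2.inner_toEnergy ha hb hab q'.2)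
  simp only [energyEmbedding_toEnergy] at h1 h2 h3
  refine ⟨R, h0, fun f => ?_, fun f u v w h hf => ?_, fun u v w h => h3 ⟨(u, v, w), h⟩⟩
  · obtain ⟨⟨⟨u, v, w⟩, h⟩, hu, hj⟩ := h1 f
    dsimp only at hu
    rw [hu]
    exact ⟨v, w, h, fun u' v' w' h' => hj ⟨(u', v', w'), h'⟩⟩
  · exact h2 f ⟨(u, v, w), h⟩ fun j => hf _ _ _ j.2

end Energy

/-! ### The operator in terms of weak derivatives and traces -/

section Operator

variable {d : ℝ} {a : ℝ → ℝ}

/-- Uniqueness of traces removes the existential quantifiers; what remains are equations in `L²(ℝ)`.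
-/
theorem robinBC_iff (hd : 0 < d) (ha : MemLp a ⊤ volume) {u w wy : L2Strip d}
    (hu : IsWeakDeriv d (0, 1) u w) (hw : IsWeakDeriv d (0, 1) w wy) :
    RobinBC d a u w ↔ traceOp d 0 (w, wy) = mulLine ha (traceOp d 0 (u, w)) ∧
      traceOp d d (w, wy) = -mulLine ha (traceOp d d (u, w)) := by
  constructor
  · rintro ⟨t₀, n₀, t₁, n₁, h1, h2, h3, h4, h5, h6⟩
    rw [hu.isTrace_iff hd (.inl rfl)] at h1
    rw [hw.isTrace_iff hd (.inl rfl)] at h2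
    rw [hu.isTrace_iff hd (.inr rfl)] at h3
    rw [hw.isTrace_iff hd (.inr rfl)] at h4
    refine ⟨Lp.ext ?_, Lp.ext ?_⟩
    · filter_upwards [h1, h2, h5, coeFn_mulLine ha (traceOp d 0 (u, w))] with x k1 k2 k3 k4
      rw [k4, ← k1, ← k2]
      linear_combination -k3
    · filter_upwards [h3, h4, h6, coeFn_mulLine ha (traceOp d d (u, w)),
        Lp.coeFn_neg (mulLine ha (traceOp d d (u, w)))] with x k1 k2 k3 k4 k5
      rw [k5, Pi.neg_apply, k4, ← k1, ← k2]
      linear_combination k3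
  · rintro ⟨h1, h2⟩
    refine ⟨_, _, _, _, (hu.isTrace_iff hd (.inl rfl)).2 .rfl, (hw.isTrace_iff hd (.inl rfl)).2 .rfl,
      (hu.isTrace_iff hd (.inr rfl)).2 .rfl, (hw.isTrace_iff hd (.inr rfl)).2 .rfl, ?_, ?_⟩
    · filter_upwards [coeFn_mulLine ha (traceOp d 0 (u, w))] with x k
      rw [h1, k]; ring
    · filter_upwards [coeFn_mulLine ha (traceOp d d (u, w)),
        Lp.coeFn_neg (mulLine ha (traceOp d d (u, w)))] with x k k'
      rw [h2, k', Pi.neg_apply, k]; ring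

theorem robinLaplacian_apply_eq (hd : 0 < d) (ha : MemLp a ⊤ volume)
    {u v w vx vy wx wy : L2Strip d} (h : IsWeakGrad d u v w) (hv : IsWeakGrad d v vx vy)
    (hw : IsWeakGrad d w wx wy) (h0 : traceOp d 0 (w, wy) = mulLine ha (traceOp d 0 (u, w)))
    (h1 : traceOp d d (w, wy) = -mulLine ha (traceOp d d (u, w))) :
    ∃ hu : u ∈ (robinLaplacian d a).domain, robinLaplacian d a ⟨u, hu⟩ = -(vx + wy) := by
  have hm : u ∈ W12 d := ⟨⟨v, h.1⟩, ⟨w, h.2⟩⟩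
  have ex : weakDx d ⟨u, hm⟩ = v := h.1.weakDeriv_eq
  have ey : weakDy d ⟨u, hm⟩ = w := h.2.weakDeriv_eq
  have hvm : v ∈ W12 d := ⟨⟨vx, hv.1⟩, ⟨vy, hv.2⟩⟩
  have hwm : w ∈ W12 d := ⟨⟨wx, hw.1⟩, ⟨wy, hw.2⟩⟩
  have h22 : MemW22 d u := ⟨hm, by rw [ex]; exact hvm, by rw [ey]; exact hwm⟩
  refine ⟨⟨h22, ?_⟩, ?_⟩
  · rw [ey]
    exact (robinBC_iff hd ha h.2 hw.2).2 ⟨h0, h1⟩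
  · change -(weakDeriv d (1, 0) (weakDeriv d (1, 0) u) + weakDeriv d (0, 1) (weakDeriv d (0, 1) u))
      = _
    rw [h.1.weakDeriv_eq, h.2.weakDeriv_eq, hv.1.weakDeriv_eq, hw.2.weakDeriv_eq]

theorem exists_of_mem_robinDomain (hd : 0 < d) (ha : MemLp a ⊤ volume)
    (u : (robinLaplacian d a).domain) :
    ∃ v w vx wy : L2Strip d, IsWeakGrad d u v w ∧ IsWeakDeriv d (1, 0) v vx ∧
      IsWeakDeriv d (0, 1) w wy ∧ traceOp d 0 (w, wy) = mulLine ha (traceOp d 0 (u, w)) ∧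
      traceOp d d (w, wy) = -mulLine ha (traceOp d d (u, w)) ∧
      robinLaplacian d a u = -(vx + wy) := by
  obtain ⟨u, h22, hbc⟩ := u
  obtain ⟨v, hv⟩ := h22.mem.1
  obtain ⟨w, hw⟩ := h22.mem.2
  obtain ⟨vx, hvx⟩ := h22.dx_mem.1
  obtain ⟨wy, hwy⟩ := h22.dy_mem.2
  have ex : weakDx d ⟨u, h22.mem⟩ = v := hv.weakDeriv_eq
  have ey : weakDy d ⟨u, h22.mem⟩ = w := hw.weakDeriv_eq
  rw [ex] at hvx
  rw [ey] at hwy hbc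
  obtain ⟨h0, h1⟩ := (robinBC_iff hd ha hw hwy).1 hbc
  refine ⟨v, w, vx, wy, ⟨hv, hw⟩, hvx, hwy, h0, h1, ?_⟩
  change -(weakDeriv d (1, 0) (weakDeriv d (1, 0) u) + weakDeriv d (0, 1) (weakDeriv d (0, 1) u)) = _
  rw [hv.weakDeriv_eq, hw.weakDeriv_eq, hvx.weakDeriv_eq, hwy.weakDeriv_eq]

/-- Integration by parts in the form. -/
theorem robinForm_eq (hd : 0 < d) (ha : MemLp a ⊤ volume) {u v w vx wy u' v' w' : L2Strip d}
    (hvx : IsWeakDeriv d (1, 0) v vx) (hwy : IsWeakDeriv d (0, 1) w wy)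
    (h' : IsWeakGrad d u' v' w') :
    robinForm d ha u v w u' v' w' = inner ℂ (-(vx + wy) + u) u' +
      (inner ℂ (mulLine ha (traceOp d 0 (u, w)) - traceOp d 0 (w, wy)) (traceOp d 0 (u', w')) +
      inner ℂ (mulLine ha (traceOp d d (u, w)) + traceOp d d (w, wy)) (traceOp d d (u', w'))) := by
  have g1 := hvx.green_horizontal h'.1
  have g2 := hwy.green_vertical hd h'.2
  rw [robinForm, inner_add_left, inner_neg_left, inner_add_left, inner_add_left, inner_sub_left]
  linear_combination g1 + g2

theorem robinForm_of_mem_domain (hd : 0 < d) (ha : MemLp a ⊤ volume)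
    (u : (robinLaplacian d a).domain) :
    ∃ v w, IsWeakGrad d u v w ∧ ∀ u' v' w', IsWeakGrad d u' v' w' →
      robinForm d ha u v w u' v' w' = inner ℂ (robinLaplacian d a u + u) u' := by
  obtain ⟨v, w, vx, wy, h, hvx, hwy, h0, h1, h2⟩ := exists_of_mem_robinDomain hd ha u
  refine ⟨v, w, h, fun u' v' w' h' => ?_⟩
  rw [robinForm_eq hd ha hvx hwy h', h0, h1, h2]
  simp

theorem re_inner_mulLine_nonneg (ha : MemLp a ⊤ volume) (hpos : ∀ x, 0 ≤ a x) (f : L2Line) :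
    0 ≤ (inner ℂ (mulLine ha f) f : ℂ).re := by
  rw [← mulLine_mulLine ha (MemLp.sqrt_top ha) (fun x => Real.mul_self_sqrt (hpos x)),
    inner_mulLine_left]
  exact inner_self_nonneg (𝕜 := ℂ)

theorem normSq_le_robinForm (ha : MemLp a ⊤ volume) (hpos : ∀ x, 0 ≤ a x) (u v w : L2Strip d) :
    ‖u‖ ^ 2 + (‖v‖ ^ 2 + ‖w‖ ^ 2) ≤ (robinForm d ha u v w u v w).re := by
  have h : ∀ f : L2Strip d, (inner ℂ f f : ℂ).re = ‖f‖ ^ 2 := fun f =>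
    inner_self_eq_norm_sq (𝕜 := ℂ) f
  simp only [robinForm, Complex.add_re, h]
  have h1 := re_inner_mulLine_nonneg ha hpos (traceOp d 0 (u, w))
  have h2 := re_inner_mulLine_nonneg ha hpos (traceOp d d (u, w))
  linarith

theorem robinForm_sub_left (ha : MemLp a ⊤ volume) (u v w u₁ v₁ w₁ u' v' w' : L2Strip d) :
    robinForm d ha (u - u₁) (v - v₁) (w - w₁) u' v' w' =
      robinForm d ha u v w u' v' w' - robinForm d ha u₁ v₁ w₁ u' v' w' := by
  simp only [robinForm, ← Prod.mk_sub_mk, map_sub, inner_sub_left]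
  ring

/-- The commutator of multiplication and translation. -/
theorem norm_mulLine_shiftLine_sub_le (ha : MemLp a ⊤ volume) {C : ℝ}
    (hC : ∀ h, ∀ᵐ x, |a (x + h) - a x| ≤ C * |h|) (h : ℝ) (f : L2Line) :
    ‖mulLine ha (shiftLine h f) - shiftLine h (mulLine ha f)‖ ≤ C * |h| * ‖f‖ := by
  rw [← (shiftLine h).norm_map f]
  refine Lp.norm_le_mul_norm_of_ae_le_mul ?_
  filter_upwards [hC h, coeFn_mulLine ha (shiftLine h f), coeFn_shiftLine h (mulLine ha f),
    coeFn_shiftLine h f, Lp.coeFn_sub (mulLine ha (shiftLine h f)) (shiftLine h (mulLine ha f)),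
    (measurePreserving_add_right (volume : Measure ℝ) h).quasiMeasurePreserving.ae
      (coeFn_mulLine ha f)] with x h1 h2 h3 h4 h5 h6
  rw [h5, Pi.sub_apply, h2, h3, h6, h4, ← sub_mul, norm_mul, ← Complex.ofReal_sub,
    Complex.norm_real, Real.norm_eq_abs, abs_sub_comm]
  gcongr

/-! ### Regularity of form solutions by horizontal difference quotients -/

theorem robinForm_shift (ha : MemLp a ⊤ volume) (h : ℝ) (u v w u' v' w' : L2Strip d) :
    robinForm d ha (shift d h u) (shift d h v) (shift d h w) u' v' w' =
      robinForm d ha u v w (shift d (-h) u') (shift d (-h) v') (shift d (-h) w') +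
      (inner ℂ (mulLine ha (shiftLine h (traceOp d 0 (u, w)))
          - shiftLine h (mulLine ha (traceOp d 0 (u, w)))) (traceOp d 0 (u', w')) +
        inner ℂ (mulLine ha (shiftLine h (traceOp d d (u, w)))
          - shiftLine h (mulLine ha (traceOp d d (u, w)))) (traceOp d d (u', w'))) := by
  simp only [robinForm, traceOp_shift, inner_shift_left, inner_sub_left, inner_shiftLine_left]
  ring

/-- Nirenberg's difference quotient argument. With `N²` the form of the difference `U = shift h u -
u`, both the source term and the commutator with `a` are at most a constant times `|h| N`. Dividing
by `N` leaves the linear bound. -/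
theorem norm_shift_sub_le_of_form (ha : MemLp a ⊤ volume) (hpos : ∀ x, 0 ≤ a x) {C : ℝ}
    (hC : ∀ h, ∀ᵐ x, |a (x + h) - a x| ≤ C * |h|) {f u v w : L2Strip d} (hu : IsWeakGrad d u v w)
    (hf : ∀ u' v' w', IsWeakGrad d u' v' w' → robinForm d ha u v w u' v' w' = inner ℂ f u') :
    ∃ M, ∀ h, ‖shift d h v - v‖ ≤ M * |h| ∧ ‖shift d h w - w‖ ≤ M * |h| := by
  have hC0 : 0 ≤ C := by
    obtain ⟨x, hx⟩ := (hC 1).exists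
    simpa using (abs_nonneg _).trans hx
  have htr : ∀ c (U W : L2Strip d) N, 0 ≤ N → ‖U‖ ≤ N → ‖W‖ ≤ N →
      ‖traceOp d c (U, W)‖ ≤ ‖traceOp d c‖ * N := by
    intro c U W N hN h1 h2
    refine ((traceOp d c).le_opNorm _).trans ?_
    gcongr
    exact max_le h1 h2
  let M := ‖f‖ + (C * ‖traceOp d 0 (u, w)‖ * ‖traceOp d 0‖ + C * ‖traceOp d d (u, w)‖ * ‖traceOp d d‖)
  refine ⟨M, fun h => ?_⟩
  have hz := (hu.translate h).sub hu
  set U := shift d h u - u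
  set V := shift d h v - v
  set W := shift d h w - w
  have hle := normSq_le_robinForm ha hpos U V W
  let N := √((robinForm d ha U V W U V W).re)
  have hN0 : 0 ≤ N := Real.sqrt_nonneg _
  have hN2 : N * N = (robinForm d ha U V W U V W).re :=
    Real.mul_self_sqrt ((by positivity : (0:ℝ) ≤ _).trans hle)
  have hU : ‖U‖ ≤ N := Real.le_sqrt_of_sq_le (by nlinarith [sq_nonneg ‖V‖, sq_nonneg ‖W‖])
  have hV : ‖V‖ ≤ N := Real.le_sqrt_of_sq_le (by nlinarith [sq_nonneg ‖U‖, sq_nonneg ‖W‖])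
  have hW : ‖W‖ ≤ N := Real.le_sqrt_of_sq_le (by nlinarith [sq_nonneg ‖V‖, sq_nonneg ‖U‖])
  -- Moving one translation onto the test function allows the equation for `u` to be used with
  -- `shift (-h) U - U`, whose norm is at most `|h| ‖V‖`. Only multiplication by `a` fails to
  -- commute with the translation.
  have key : robinForm d ha U V W U V W = inner ℂ f (shift d (-h) U - U) +
      (inner ℂ (mulLine ha (shiftLine h (traceOp d 0 (u, w)))
          - shiftLine h (mulLine ha (traceOp d 0 (u, w)))) (traceOp d 0 (U, W)) +
        inner ℂ (mulLine ha (shiftLine h (traceOp d d (u, w)))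
          - shiftLine h (mulLine ha (traceOp d d (u, w)))) (traceOp d d (U, W))) := by
    conv_lhs => rw [show robinForm d ha U V W U V W = robinForm d ha (shift d h u - u)
      (shift d h v - v) (shift d h w - w) U V W from rfl]
    rw [robinForm_sub_left, robinForm_shift, hf _ _ _ (hz.translate (-h)), hf _ _ _ hz,
      inner_sub_right f (shift d (-h) U) U]
    ring
  have hN : N * N ≤ |h| * M * N := by
    rw [hN2, key]
    refine (Complex.re_le_norm _).trans ((norm_add_le _ _).trans ?_)
    have e1 : ‖(inner ℂ f (shift d (-h) U - U) : ℂ)‖ ≤ ‖f‖ * (|h| * N) := by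
      refine (norm_inner_le_norm _ _).trans ?_
      gcongr
      refine (hz.1.norm_shift_sub_le (-h)).trans ?_
      rw [abs_neg]
      gcongr
    have e2 : ∀ c, ‖(inner ℂ (mulLine ha (shiftLine h (traceOp d c (u, w)))
          - shiftLine h (mulLine ha (traceOp d c (u, w)))) (traceOp d c (U, W)) : ℂ)‖ ≤
        C * |h| * ‖traceOp d c (u, w)‖ * (‖traceOp d c‖ * N) := by
      intro c
      refine (norm_inner_le_norm _ _).trans ?_
      gcongr
      · exact norm_mulLine_shiftLine_sub_le ha hC h _
      · exact htr c U W N hN0 hU hW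
    have e3 := (norm_add_le _ _).trans (add_le_add (e2 0) (e2 d))
    refine (add_le_add e1 e3).trans (le_of_eq ?_)
    simp only [M]
    ring
  have hNM : N ≤ M * |h| := by
    rcases hN0.eq_or_lt with h0 | h0
    · rw [← h0]; positivity
    · rw [mul_comm M]
      exact le_of_mul_le_mul_right hN h0
  exact ⟨hV.trans hNM, hW.trans hNM⟩

/-- Weak derivatives commute. -/
theorem IsWeakDeriv.mixed {v₁ v₂ : ℝ × ℝ} {u f₁ f₂ g : L2Strip d} (h1 : IsWeakDeriv d v₁ u f₁)
    (h2 : IsWeakDeriv d v₂ u f₂) (h3 : IsWeakDeriv d v₁ f₂ g) : IsWeakDeriv d v₂ f₁ g := by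
  rw [isWeakDeriv_iff_inner] at *
  intro φ hφ hc hs
  have hb := IsBoxFun.of_hasCompactSupport hφ hc
  have hsupp : ∀ v, HasCompactSupport (fun p => _root_.fderiv ℝ φ p v) ∧
      tsupport (fun p => _root_.fderiv ℝ φ p v) ⊆ strip d := fun v =>
    ⟨hc.fderiv_apply ℝ v, (tsupport_fderiv_apply_subset ℝ v).trans hs⟩
  have k1 := h1 _ (hb.fderiv v₂).smooth (hsupp v₂).1 (hsupp v₂).2
  have k2 := h2 _ (hb.fderiv v₁).smooth (hsupp v₁).1 (hsupp v₁).2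
  have k3 := h3 φ hφ hc hs
  have e : ((hb.fderiv v₂).fderiv v₁).toL2 d = ((hb.fderiv v₁).fderiv v₂).toL2 d := by
    refine IsBoxFun.toL2_congr _ _ d fun p => ?_
    have hsym : IsSymmSndFDerivAt ℝ φ p :=
      (contDiff_infty.1 hφ 2).contDiffAt.isSymmSndFDerivAt (by simp)
    have hd : DifferentiableAt ℝ (_root_.fderiv ℝ φ) p :=
      ((hφ.fderiv_right (m := ∞) (by simp)).differentiable (by simp)) p
    rw [fderiv_clm_apply hd (differentiableAt_const _),
      fderiv_clm_apply hd (differentiableAt_const _)]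
    simpa using hsym v₁ v₂
  rw [e, k2, neg_inj] at k1
  exact k1.symm.trans k3

theorem robinForm_boxFun_of_boundary_eq_zero (hd : 0 < d) (ha : MemLp a ⊤ volume) {F : ℝ × ℝ → ℝ}
    (hF : IsBoxFun F) (h0 : ∀ x, F (x, 0) = 0) (h1 : ∀ x, F (x, d) = 0) (u v w : L2Strip d) :
    robinForm d ha u v w (hF.toL2 d) ((hF.fderiv (1, 0)).toL2 d) ((hF.fderiv (0, 1)).toL2 d) =
      inner ℂ u (hF.toL2 d) + (inner ℂ v ((hF.fderiv (1, 0)).toL2 d) +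
        inner ℂ w ((hF.fderiv (0, 1)).toL2 d)) := by
  have e0 : traceOp d 0 (hF.toL2 d, (hF.fderiv (0, 1)).toL2 d) = 0 := by
    refine Lp.ext ?_
    filter_upwards [hF.traceOp_ae hd (.inl rfl), Lp.coeFn_zero ℂ 2 (volume : Measure ℝ)]
      with x k1 k2
    rw [k1, k2, h0]; simp
  have e1 : traceOp d d (hF.toL2 d, (hF.fderiv (0, 1)).toL2 d) = 0 := by
    refine Lp.ext ?_
    filter_upwards [hF.traceOp_ae hd (.inr rfl), Lp.coeFn_zero ℂ 2 (volume : Measure ℝ)]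
      with x k1 k2
    rw [k1, k2, h1]; simp
  rw [robinForm, e0, e1, inner_zero_right, inner_zero_right, add_zero, add_zero]

/-- Compactly supported test functions do not see the boundary terms, so the weak equation reads
`-∂_x v - ∂_y w + u = f`. Once `∂_x v` is in `L²`, this equation supplies `∂_y w`. -/
theorem isWeakDeriv_vert_of_form (hd : 0 < d) (ha : MemLp a ⊤ volume) {f u v w vx : L2Strip d}
    (hvx : IsWeakDeriv d (1, 0) v vx)
    (hf : ∀ u' v' w', IsWeakGrad d u' v' w' → robinForm d ha u v w u' v' w' = inner ℂ f u') :
    IsWeakDeriv d (0, 1) w (u - vx - f) := by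
  rw [isWeakDeriv_iff_inner] at hvx ⊢
  intro φ hφ hc hs
  have hb := IsBoxFun.of_hasCompactSupport hφ hc
  have hz : ∀ p, p ∉ strip d → φ p = 0 := fun p hp =>
    image_eq_zero_of_notMem_tsupport fun h => hp (hs h)
  have h1 := hf _ _ _ (hb.isWeakGrad d)
  rw [robinForm_boxFun_of_boundary_eq_zero hd ha hb (fun x => hz _ fun h => lt_irrefl _ h.1)
    (fun x => hz _ fun h => lt_irrefl _ h.2)] at h1
  have h2 := congrArg (starRingEnd ℂ) h1
  simp only [map_add, inner_conj_symm] at h2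
  rw [hvx φ hφ hc hs] at h2
  rw [inner_sub_right, inner_sub_right]
  linear_combination h2

theorem eq_zero_of_forall_inner_line {f : L2Line}
    (h : ∀ ψ : ℝ → ℝ, ContDiff ℝ ∞ ψ → HasCompactSupport ψ → ∀ g : L2Line,
      (g =ᵐ[volume] fun x => (ψ x : ℂ)) → inner ℂ f g = 0) : f = 0 := by
  refine Lp.ext ?_
  have h1 := ae_eq_zero_of_integral_contDiff_smul_eq_zero (f := f) (μ := (volume : Measure ℝ))
    ((Lp.memLp f).locallyIntegrable (by norm_num)) fun ψ hψ hc => by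
    have hm : MemLp (fun x => (ψ x : ℂ)) 2 volume :=
      (hψ.continuous.memLp_of_hasCompactSupport hc).ofReal
    have h2 := congrArg (starRingEnd ℂ) (h ψ hψ hc hm.toLp hm.coeFn_toLp)
    rw [inner_conj_symm, map_zero, inner_eq_integral_conj_mul] at h2
    rw [← h2]
    refine integral_congr_ae ?_
    filter_upwards [hm.coeFn_toLp] with x hx
    rw [hx, Complex.conj_ofReal, Complex.real_smul]
  filter_upwards [h1, Lp.coeFn_zero ℂ 2 (volume : Measure ℝ)] with x k1 k2
  rw [k1, k2, Pi.zero_apply]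

theorem isBoxFun_mul {ψ η : ℝ → ℝ} (hψ : ContDiff ℝ ∞ ψ) (hc : HasCompactSupport ψ)
    (hη : ContDiff ℝ ∞ η) : IsBoxFun fun p => ψ p.1 * η p.2 := by
  refine ⟨(hψ.comp contDiff_fst).mul (hη.comp contDiff_snd), ?_⟩
  obtain ⟨L, hL⟩ := hc.isBounded.exists_norm_le
  refine ⟨L + 1, fun p hp => ?_⟩
  have : ψ p.1 = 0 := image_eq_zero_of_notMem_tsupport fun h => by
    have := hL _ h
    rw [Real.norm_eq_abs] at this
    linarith
  rw [this, zero_mul]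

/-- The Robin conditions are the natural boundary conditions of the form. Test functions `ψ(x) (d -
y)` isolate the lower edge and `ψ(x) y` the upper one. -/
theorem boundary_of_form (hd : 0 < d) (ha : MemLp a ⊤ volume) {u v w vx wy : L2Strip d}
    (hvx : IsWeakDeriv d (1, 0) v vx) (hwy : IsWeakDeriv d (0, 1) w wy)
    (hf : ∀ u' v' w', IsWeakGrad d u' v' w' →
      robinForm d ha u v w u' v' w' = inner ℂ (-(vx + wy) + u) u') :
    traceOp d 0 (w, wy) = mulLine ha (traceOp d 0 (u, w)) ∧
      traceOp d d (w, wy) = -mulLine ha (traceOp d d (u, w)) := by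
  have key : ∀ u' v' w', IsWeakGrad d u' v' w' →
      inner ℂ (mulLine ha (traceOp d 0 (u, w)) - traceOp d 0 (w, wy)) (traceOp d 0 (u', w')) +
      inner ℂ (mulLine ha (traceOp d d (u, w)) + traceOp d d (w, wy)) (traceOp d d (u', w'))
        = 0 := by
    intro u' v' w' h'
    have h1 := hf u' v' w' h'
    rw [robinForm_eq hd ha hvx hwy h'] at h1
    simpa using h1
  have hbox : ∀ ψ : ℝ → ℝ, ContDiff ℝ ∞ ψ → HasCompactSupport ψ → ∀ g : L2Line,
      (g =ᵐ[volume] fun x => (ψ x : ℂ)) → ∀ η : ℝ → ℝ, ContDiff ℝ ∞ η →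
      (η 0 : ℂ) * inner ℂ (mulLine ha (traceOp d 0 (u, w)) - traceOp d 0 (w, wy)) g +
      (η d : ℂ) * inner ℂ (mulLine ha (traceOp d d (u, w)) + traceOp d d (w, wy)) g = 0 := by
    intro ψ hψ hc g hg η hη
    have hF := isBoxFun_mul hψ hc hη
    have e : ∀ c, c = 0 ∨ c = d →
        traceOp d c (hF.toL2 d, (hF.fderiv (0, 1)).toL2 d) = (η c : ℂ) • g := by
      intro c hc
      refine Lp.ext ?_
      filter_upwards [hF.traceOp_ae hd hc, hg, Lp.coeFn_smul (η c : ℂ) g] with x k1 k2 k3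
      rw [k1, k3, Pi.smul_apply, k2, smul_eq_mul]
      push_cast; ring
    have := key _ _ _ (hF.isWeakGrad d)
    rwa [e 0 (.inl rfl), e d (.inr rfl), inner_smul_right, inner_smul_right] at this
  constructor
  · refine (sub_eq_zero.1 (eq_zero_of_forall_inner_line fun ψ hψ hc g hg => ?_)).symm
    have := hbox ψ hψ hc g hg (fun y => d - y) (contDiff_const.sub contDiff_id)
    simpa [hd.ne'] using this
  · rw [eq_neg_iff_add_eq_zero, add_comm]
    refine eq_zero_of_forall_inner_line fun ψ hψ hc g hg => ?_
    have := hbox ψ hψ hc g hg (fun y => y) contDiff_id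
    simpa [hd.ne'] using this

/-- Regularity: the form solution of `(H + 1) u = f` belongs to the domain of `H`. -/
theorem form_solution_mem_domain (hd : 0 < d) (ha : MemLp a ⊤ volume) (hpos : ∀ x, 0 ≤ a x) {C : ℝ}
    (hC : ∀ h, ∀ᵐ x, |a (x + h) - a x| ≤ C * |h|) {f u v w : L2Strip d} (hu : IsWeakGrad d u v w)
    (hf : ∀ u' v' w', IsWeakGrad d u' v' w' → robinForm d ha u v w u' v' w' = inner ℂ f u') :
    ∃ h : u ∈ (robinLaplacian d a).domain, robinLaplacian d a ⟨u, h⟩ + u = f := by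
  obtain ⟨M, hM⟩ := norm_shift_sub_le_of_form ha hpos hC hu hf
  obtain ⟨vx, hvx⟩ := exists_isWeakDeriv_of_shift_bound fun t => (hM t).1
  obtain ⟨wx, hwx⟩ := exists_isWeakDeriv_of_shift_bound fun t => (hM t).2
  -- Difference quotients give only horizontal derivatives; `∂_y v` exists because it is the mixed
  -- derivative `∂_x w`.
  have hvy := hu.1.mixed hu.2 hwx
  have hwy := isWeakDeriv_vert_of_form hd ha hvx hf
  have e : -(vx + (u - vx - f)) + u = f := by abel
  obtain ⟨h0, h1⟩ := boundary_of_form hd ha hvx hwy (by rwa [e])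
  obtain ⟨h, h2⟩ := robinLaplacian_apply_eq hd ha hu ⟨hvx, hvy⟩ ⟨hwx, hwy⟩ h0 h1
  exact ⟨h, by rw [h2, e]⟩

/-- The resolvent of the Robin Laplacian at `-1` and its relation to the form. -/
theorem exists_resolvent (hd : 0 < d) (ha : MemLp a ⊤ volume) (hpos : ∀ x, 0 ≤ a x) {C : ℝ}
    (hC : ∀ h, ∀ᵐ x, |a (x + h) - a x| ≤ C * |h|) :
    ∃ R : L2Strip d →L[ℂ] L2Strip d, 0 ≤ R ∧
      (∀ f, ∃ h : R f ∈ (robinLaplacian d a).domain, robinLaplacian d a ⟨R f, h⟩ + R f = f) ∧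
      (∀ u : (robinLaplacian d a).domain, R (robinLaplacian d a u + u) = u) ∧
      (∀ f, ∃ v w, IsWeakGrad d (R f) v w ∧
        robinForm d ha (R f) v w (R f) v w = inner ℂ f (R f)) ∧
      ∀ u v w, IsWeakGrad d u v w → ‖u‖ ^ 2 ≤ ‖R‖ * (robinForm d ha u v w u v w).re := by
  obtain ⟨R, h0, h1, h2, h3⟩ := exists_form_resolvent d ha hpos
  refine ⟨R, h0, fun f => ?_, fun u => ?_, fun f => ?_, h3⟩
  · obtain ⟨v, w, h, hf⟩ := h1 f
    exact form_solution_mem_domain hd ha hpos hC h hf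
  · obtain ⟨v, w, h, hf⟩ := robinForm_of_mem_domain hd ha u
    exact h2 _ _ v w h hf
  · obtain ⟨v, w, h, hf⟩ := h1 f
    exact ⟨v, w, h, hf _ _ _ h⟩

end Operator

/-! ### Regularity and decay of the coupling function -/

section Coupling

open Filter Topology
open scoped NNReal

theorem MemLp.exists_ae_abs_le {f : ℝ → ℝ} (hf : MemLp f ⊤ volume) :
    ∃ C : ℝ≥0, ∀ᵐ x, |f x| ≤ C := by
  refine ⟨(eLpNorm f ⊤ volume).toNNReal, ?_⟩
  filter_upwards [ae_le_eLpNormEssSup (f := f) (μ := volume)] with x hx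
  rw [← Real.norm_eq_abs, ← toReal_enorm]
  refine ENNReal.toReal_mono hf.2.ne ?_
  rwa [eLpNorm_exponent_top]

theorem exists_zero_of_abs_ge {φ : ℝ → ℝ} (hc : HasCompactSupport φ) :
    ∃ L > 0, ∀ x, x ∉ Ioo (-L) L → φ x = 0 := by
  obtain ⟨L, hL⟩ := hc.isBounded.exists_norm_le
  refine ⟨|L| + 1, by positivity, fun x hx => image_eq_zero_of_notMem_tsupport fun h => hx ?_⟩
  have := (hL x h).trans (le_abs_self L)
  rw [Real.norm_eq_abs, abs_le] at this
  exact ⟨by linarith, by linarith⟩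

theorem exists_test_primitive {θ : ℝ → ℝ} (hθ : ContDiff ℝ ∞ θ) (hc : HasCompactSupport θ)
    (h0 : ∫ x, θ x = 0) :
    ∃ ψ : ℝ → ℝ, ContDiff ℝ ∞ ψ ∧ HasCompactSupport ψ ∧ ∀ x, deriv ψ x = θ x := by
  obtain ⟨L, hL0, hL⟩ := exists_zero_of_abs_ge hc
  have hder : ∀ x, HasDerivAt (fun x => ∫ s in (-L)..x, θ s) (θ x) x := fun x =>
    intervalIntegral.integral_hasDerivAt_right (hθ.continuous.intervalIntegrable _ _)
      (hθ.continuous.stronglyMeasurableAtFilter _ _) hθ.continuous.continuousAt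
  have hd : deriv (fun x => ∫ s in (-L)..x, θ s) = θ := funext fun x => (hder x).deriv
  refine ⟨fun x => ∫ s in (-L)..x, θ s, ?_, ?_, fun x => (hder x).deriv⟩
  · rw [contDiff_infty_iff_deriv, hd]
    exact ⟨fun x => (hder x).differentiableAt, hθ⟩
  · refine HasCompactSupport.intro (isCompact_Icc (a := -L) (b := L)) fun x hx => ?_
    simp only [mem_Icc, not_and_or, not_le] at hx
    rcases hx with hx | hx
    · rw [intervalIntegral.integral_congr (g := fun _ => 0), intervalIntegral.integral_zero]
      intro y hy
      rw [uIcc_of_ge hx.le] at hy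
      exact hL y fun h => by linarith [h.1, hy.2]
    · rw [intervalIntegral.integral_eq_integral_of_support_subset, h0]
      intro y hy
      by_contra hy'
      exact hy (hL y fun h => hy' ⟨h.1, h.2.le.trans hx.le⟩)

/-- The du Bois-Reymond lemma. -/
theorem ae_const_of_integral_mul_deriv_eq_zero {D : ℝ → ℝ} (hD : LocallyIntegrable D)
    (h : ∀ ψ : ℝ → ℝ, ContDiff ℝ ∞ ψ → HasCompactSupport ψ → ∫ x, D x * deriv ψ x = 0) :
    ∃ c, ∀ᵐ x, D x = c := by
  let b : ContDiffBump (0 : ℝ) := default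
  let η := b.normed volume
  have hη : ContDiff ℝ ∞ η := b.contDiff_normed
  have hηc : HasCompactSupport η := b.hasCompactSupport_normed
  have hη1 : ∫ x, η x = 1 := b.integral_normed
  have hi : ∀ {φ : ℝ → ℝ}, Continuous φ → HasCompactSupport φ → Integrable fun x => φ x * D x :=
    fun hφ hc => hD.integrable_smul_left_of_hasCompactSupport hφ hc
  refine ⟨∫ x, η x * D x, ?_⟩
  have := ae_eq_zero_of_integral_contDiff_smul_eq_zero (f := fun x => D x - ∫ x, η x * D x)
    (μ := (volume : Measure ℝ)) (hD.sub (locallyIntegrable_const _)) fun φ hφ hc => by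
    -- Subtracting a multiple of the normalized bump gives mean zero, exactly what makes the
    -- primitive compactly supported.
    have hθ : ContDiff ℝ ∞ fun x => φ x - (∫ x, φ x) * η x := hφ.sub (contDiff_const.mul hη)
    have hθc : HasCompactSupport fun x => φ x - (∫ x, φ x) * η x := hc.sub hηc.mul_left
    have hφi := hφ.continuous.integrable_of_hasCompactSupport (μ := volume) hc
    have hηi := hη.continuous.integrable_of_hasCompactSupport (μ := volume) hηc
    obtain ⟨ψ, h1, h2, h3⟩ := exists_test_primitive hθ hθc (by
      rw [integral_sub hφi (hηi.const_mul _), integral_const_mul, hη1, mul_one, sub_self])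
    have h4 := h ψ h1 h2
    have h5 : ∀ x, D x * deriv ψ x = φ x * D x - (∫ x, φ x) * (η x * D x) := fun x => by
      rw [h3]; ring
    simp only [h5] at h4
    rw [integral_sub (hi hφ.continuous hc) ((hi hη.continuous hηc).const_mul _),
      integral_const_mul] at h4
    simp only [smul_eq_mul, mul_sub]
    rw [integral_sub (hi hφ.continuous hc) (hφi.mul_const _), integral_mul_const]
    exact h4
  filter_upwards [this] with x hx
  exact sub_eq_zero.1 hx

theorem integral_primitive_mul_deriv {β : ℝ → ℝ} (hβ : LocallyIntegrable β) {φ : ℝ → ℝ}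
    (hφ : ContDiff ℝ ∞ φ) (hc : HasCompactSupport φ) :
    ∫ x, (∫ s in (0 : ℝ)..x, β s) * deriv φ x = - ∫ x, β x * φ x := by
  obtain ⟨L, hL0, hL⟩ := exists_zero_of_abs_ge hc
  obtain ⟨L', hL0', hL'⟩ := exists_zero_of_abs_ge hc.deriv
  have hcd : Continuous (deriv φ) := hφ.continuous_deriv (by simp)
  let M := max L L'
  have hM : ∀ x, x ∉ Ioo (-M) M → φ x = 0 ∧ deriv φ x = 0 := fun x hx =>
    ⟨hL x fun h => hx ⟨by linarith [h.1, le_max_left L L'], h.2.trans_le (le_max_left _ _)⟩,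
      hL' x fun h => hx ⟨by linarith [h.1, le_max_right L L'], h.2.trans_le (le_max_right _ _)⟩⟩
  have hM0 : 0 < M := hL0.trans_le (le_max_left _ _)
  have hsupp : ∀ {G : ℝ → ℝ}, (∀ x, φ x = 0 → deriv φ x = 0 → G x = 0) →
      ∫ x, G x = ∫ x in (-M)..M, G x := fun {G} hG => by
    rw [intervalIntegral.integral_eq_integral_of_support_subset]
    intro y hy
    by_contra hy'
    obtain ⟨h1, h2⟩ := hM y fun h => hy' ⟨h.1, h.2.le⟩
    exact hy (hG y h1 h2)
  rw [hsupp fun x _ h2 => by rw [h2, mul_zero], hsupp fun x h1 _ => by rw [h1, mul_zero],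
    eq_neg_iff_add_eq_zero]
  have hβi : ∀ a b, IntervalIntegrable β volume a b := fun a b =>
    (hβ.integrableOn_isCompact isCompact_uIcc).intervalIntegrable
  have hΓ : Continuous fun x => ∫ s in (0 : ℝ)..x, β s :=
    intervalIntegral.continuous_primitive hβi 0
  have hΓi : IntervalIntegrable (fun x => (∫ s in (0 : ℝ)..x, β s) * deriv φ x) volume (-M) M :=
    (hΓ.mul hcd).intervalIntegrable _ _
  rw [← intervalIntegral.integral_add hΓi ((hβi _ _).mul_continuousOn hφ.continuous.continuousOn)]
  have key := integral_primitive_mul_add (a := -M) (b := M) (by linarith)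
    (g₁ := fun x => (β x : ℂ)) (g₂ := fun x => ((deriv φ x : ℝ) : ℂ))
    ⟨(hβi (-M) M).1.ofReal, (hβi (-M) M).2.ofReal⟩ ((Complex.continuous_ofReal.comp hcd).intervalIntegrable _ _)
    ((∫ s in (0 : ℝ)..(-M), β s : ℝ) : ℂ) 0
  have e1 : ∀ y, ((∫ s in (0 : ℝ)..(-M), β s : ℝ) : ℂ) + ∫ s in (-M)..y, (β s : ℂ)
      = ((∫ s in (0 : ℝ)..y, β s : ℝ) : ℂ) := fun y => by
    rw [intervalIntegral.integral_ofReal, ← Complex.ofReal_add,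
      intervalIntegral.integral_add_adjacent_intervals (hβi _ _) (hβi _ _)]
  have e2 : ∀ y, (0 : ℂ) + ∫ s in (-M)..y, ((deriv φ s : ℝ) : ℂ) = (φ y : ℂ) := fun y => by
    rw [intervalIntegral.integral_ofReal, intervalIntegral.integral_deriv_eq_sub
      (fun x _ => hφ.differentiable (by simp) x) (hcd.intervalIntegrable _ _),
      (hM (-M) fun h => lt_irrefl _ h.1).1, sub_zero, zero_add]
  simp only [e1, e2] at key
  rw [(hM M fun h => lt_irrefl _ h.2).1] at key
  have := congrArg Complex.re key
  simp only [Complex.ofReal_zero, mul_zero, sub_zero, Complex.zero_re] at this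
  refine Eq.trans ?_ this
  rw [← Complex.ofReal_re (∫ x in (-M)..M, _), ← intervalIntegral.integral_ofReal]
  simp only [Complex.ofReal_add, Complex.ofReal_mul]

/-- The primitive of the bounded weak derivative is Lipschitz and has the same weak derivative as
`α`, so by the du Bois-Reymond lemma the two differ by a constant almost everywhere. -/
theorem MemW1Infty.exists_lipschitz {α : ℝ → ℝ} (hα : MemW1Infty α) :
    ∃ C : ℝ≥0, ∃ γ : ℝ → ℝ, LipschitzWith C γ ∧ ∀ᵐ x, α x = γ x := by
  obtain ⟨hm, β, hβ, hw⟩ := hα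
  obtain ⟨C, hC⟩ := MemLp.exists_ae_abs_le hβ
  have hβl : LocallyIntegrable β := hβ.locallyIntegrable (by norm_num)
  have hβi : ∀ a b, IntervalIntegrable β volume a b := fun a b =>
    (hβl.integrableOn_isCompact isCompact_uIcc).intervalIntegrable
  have hΓ : LipschitzWith C fun x => ∫ s in (0 : ℝ)..x, β s := by
    refine LipschitzWith.of_dist_le_mul fun x y => ?_
    rw [Real.dist_eq, Real.dist_eq, intervalIntegral.integral_interval_sub_left (hβi _ _) (hβi _ _)]
    refine intervalIntegral.norm_integral_le_of_norm_le_const_ae (f := β) (C := C) ?_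
    filter_upwards [hC] with t ht _
    exact ht
  obtain ⟨c, hc⟩ := ae_const_of_integral_mul_deriv_eq_zero
    (D := fun x => α x - ∫ s in (0 : ℝ)..x, β s)
    ((hm.locallyIntegrable (by norm_num)).sub hΓ.continuous.locallyIntegrable) fun φ hφ hcs => by
      have hd : Continuous (deriv φ) := hφ.continuous_deriv (by simp)
      have i1 : Integrable fun x => α x * deriv φ x := by
        simpa only [mul_comm, smul_eq_mul] using
          (hm.locallyIntegrable (by norm_num)).integrable_smul_left_of_hasCompactSupport hd hcs.deriv
      have i2 : Integrable fun x => (∫ s in (0 : ℝ)..x, β s) * deriv φ x :=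
        (hΓ.continuous.mul hd).integrable_of_hasCompactSupport hcs.deriv.mul_left
      simp only [sub_mul]
      rw [integral_sub i1 i2, hw φ hφ hcs, integral_primitive_mul_deriv hβl hφ hcs, sub_self]
  refine ⟨C, fun x => c + ∫ s in (0 : ℝ)..x, β s, ?_, ?_⟩
  · refine LipschitzWith.of_dist_le_mul fun x y => ?_
    rw [dist_add_left]
    exact hΓ.dist_le_mul x y
  · filter_upwards [hc] with x hx
    rw [← hx]; ring

theorem ae_abs_shift_sub_le {α γ : ℝ → ℝ} {C : ℝ≥0} (hγ : LipschitzWith C γ)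
    (h : ∀ᵐ x, α x = γ x) (t : ℝ) : ∀ᵐ x, |α (x + t) - α x| ≤ C * |t| := by
  filter_upwards [h, (measurePreserving_add_right volume t).quasiMeasurePreserving.ae h]
    with x h1 h2
  rw [h1, h2]
  simpa [Real.dist_eq] using hγ.dist_le_mul (x + t) x

theorem Integrable.exists_tail_lt {f : ℝ → ℝ} (hf : Integrable f) {η : ℝ} (hη : 0 < η) :
    ∃ L > 0, ∫ x in {x : ℝ | L ≤ |x|}, |f x| < η := by
  have hmeas : ∀ n : ℕ, MeasurableSet {x : ℝ | (n : ℝ) ≤ |x|} := fun n =>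
    measurableSet_le measurable_const measurable_norm
  have h1 := tendsto_setIntegral_of_antitone (μ := volume) (f := fun x => |f x|)
    (s := fun n : ℕ => {x : ℝ | (n : ℝ) ≤ |x|}) hmeas
    (fun m n hmn x (hx : (n : ℝ) ≤ |x|) =>
      show (m : ℝ) ≤ |x| from le_trans (by exact_mod_cast hmn) hx) ⟨0, hf.abs.integrableOn⟩
  have h2 : ⋂ n : ℕ, {x : ℝ | (n : ℝ) ≤ |x|} = ∅ := by
    refine eq_empty_of_forall_notMem fun x hx => ?_
    obtain ⟨n, hn⟩ := exists_nat_gt |x|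
    exact absurd (mem_iInter.1 hx n) (not_le.2 hn)
  rw [h2, setIntegral_empty] at h1
  obtain ⟨n, hn1, hn2⟩ := ((h1.eventually (gt_mem_nhds hη)).and (eventually_gt_atTop 0)).exists
  exact ⟨n, by exact_mod_cast hn2, hn1⟩

/-- A Lipschitz function that differs from a constant by an integrable function tends to this
constant at infinity. -/
theorem LipschitzWith.exists_abs_sub_le_of_integrable {γ : ℝ → ℝ} {C : ℝ≥0}
    (hγ : LipschitzWith C γ) {c : ℝ} (hi : Integrable fun x => γ x - c) {ε : ℝ} (hε : 0 < ε) :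
    ∃ L > 0, ∀ x, L ≤ |x| → |γ x - c| ≤ ε := by
  -- Within distance `δ` the function moves by at most `C δ ≤ ε / 2`. A deviation above `ε` at one
  -- point would therefore contribute more than `2 δ · ε / 2 = δ ε` to the tail integral. The
  -- summand `1` covers `C = 0`.
  let δ := ε / (2 * (C + 1))
  have hδ : 0 < δ := by positivity
  obtain ⟨L, hL0, hL⟩ := Integrable.exists_tail_lt hi (η := δ * ε) (by positivity)
  refine ⟨L + δ, by positivity, fun x hx => ?_⟩
  have hsub : Ioo (x - δ) (x + δ) ⊆ {x : ℝ | L ≤ |x|} := fun t ht => by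
    have h1 := abs_sub_abs_le_abs_sub x t
    have h2 : |x - t| < δ := abs_lt.2 ⟨by linarith [ht.2], by linarith [ht.1]⟩
    simp only [mem_ofPred_eq]
    linarith
  have h1 : ∫ t in Ioo (x - δ) (x + δ), |γ t - c| ≤ ∫ t in {x : ℝ | L ≤ |x|}, |γ t - c| :=
    setIntegral_mono_set hi.abs.integrableOn (.of_forall fun _ => abs_nonneg _)
      (LE.le.eventuallyLE hsub)
  have h2 : ∫ t in Ioo (x - δ) (x + δ), (|γ x - c| - C * δ) ≤
      ∫ t in Ioo (x - δ) (x + δ), |γ t - c| := by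
    refine setIntegral_mono_on (by simp) hi.abs.integrableOn measurableSet_Ioo fun t ht => ?_
    have h3 := abs_sub_abs_le_abs_sub (γ x - c) (γ t - c)
    have h4 : |γ x - γ t| ≤ C * |x - t| := by simpa [Real.dist_eq] using hγ.dist_le_mul x t
    have h5 : |x - t| ≤ δ := abs_le.2 ⟨by linarith [ht.2], by linarith [ht.1]⟩
    have h6 : (C : ℝ) * |x - t| ≤ C * δ := by gcongr
    rw [sub_sub_sub_cancel_right] at h3
    linarith
  rw [setIntegral_const, measureReal_def, Real.volume_Ioo, ENNReal.toReal_ofReal (by linarith),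
    smul_eq_mul] at h2
  have h3 : (C : ℝ) * δ ≤ ε / 2 := by
    simp only [δ]
    rw [mul_div_assoc', div_le_div_iff₀ (by positivity) (by norm_num)]
    nlinarith [C.coe_nonneg]
  by_contra! hcon
  have h4 : δ * ε < 2 * δ * (|γ x - c| - C * δ) := by nlinarith
  linarith

end Coupling

/-! ### The Poincaré inequality on rectangles and a finite rank Rellich lemma -/

section Rectangles

theorem MemLp.sub_fiber_average {μ ν : Measure ℝ} [SFinite μ] [IsFiniteMeasure ν] {u : ℝ × ℝ → ℂ}
    (hu : MemLp u 2 (μ.prod ν)) (c : ℝ) :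
    MemLp (fun p : ℝ × ℝ => u p - c • ∫ s, u (p.1, s) ∂ν) 2 (μ.prod ν) :=
  hu.sub (((memLp_integral_right hu).1.const_smul c).comp_fst ν)

theorem MemLp.prod_swap {μ ν : Measure ℝ} [SFinite μ] [SFinite ν] {u : ℝ × ℝ → ℂ}
    (hu : MemLp u 2 (μ.prod ν)) : MemLp (fun p => u p.swap) 2 (ν.prod μ) :=
  hu.comp_measurePreserving Measure.measurePreserving_swap

/-- A function of mean zero is controlled by its deviations from the averages in the two
coordinate directions. -/
theorem integral_norm_sq_le_fiber_deviations {μ ν : Measure ℝ} [IsFiniteMeasure μ]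
    [IsFiniteMeasure ν] (hν : 0 < ν.real univ) {u : ℝ × ℝ → ℂ}
    (hu : MemLp u 2 (μ.prod ν)) (h0 : ∫ p, u p ∂(μ.prod ν) = 0) :
    ∫ p, ‖u p‖ ^ 2 ∂(μ.prod ν) ≤
      2 * ∫ p, ‖u p - (ν.real univ)⁻¹ • ∫ s, u (p.1, s) ∂ν‖ ^ 2 ∂(μ.prod ν) +
      2 * ∫ p, ‖u p - (μ.real univ)⁻¹ • ∫ t, u (t, p.2) ∂μ‖ ^ 2 ∂(μ.prod ν) := by
  set n : ℝ → ℂ := fun x => (ν.real univ)⁻¹ • ∫ s, u (x, s) ∂ν with hn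
  set m : ℝ → ℂ := fun y => (μ.real univ)⁻¹ • ∫ t, u (t, y) ∂μ with hm
  have hui : Integrable u (μ.prod ν) := hu.integrable (by norm_num)
  have hnL : MemLp n 2 μ := (memLp_integral_right hu).1.const_smul (ν.real univ)⁻¹
  have hmL : MemLp m 2 ν :=
    (memLp_integral_right (MemLp.prod_swap hu)).1.const_smul (μ.real univ)⁻¹
  have h1 : MemLp (fun p : ℝ × ℝ => u p - n p.1) 2 (μ.prod ν) := hu.sub (hnL.comp_fst ν)
  have h2 : MemLp (fun p : ℝ × ℝ => u p - m p.2) 2 (μ.prod ν) := hu.sub (hmL.comp_snd μ)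
  have hm0 : ∫ y, m y ∂ν = 0 := by
    rw [integral_smul, ← integral_prod_symm _ hui, h0, smul_zero]
  -- Since `m` has mean zero, `n x` is also the average of `u(x, y) - m(y)` over `y`; Cauchy-Schwarz
  -- bounds it by the deviation in the other direction.
  have hnm : ∀ᵐ x ∂μ, ν.real univ * ‖n x‖ ^ 2 ≤ ∫ y, ‖u (x, y) - m y‖ ^ 2 ∂ν := by
    filter_upwards [memLp_two_prod_right_ae hu, memLp_two_prod_right_ae h2] with x hx hx2
    have e : ∫ s, u (x, s) ∂ν = ∫ s, (u (x, s) - m s) ∂ν := by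
      rw [integral_sub (hx.integrable (by norm_num)) (hmL.integrable (by norm_num)), hm0, sub_zero]
    have h3 := norm_integral_sq_le hx2
    rw [← e] at h3
    simp only [hn, norm_smul, norm_inv, mul_pow, Real.norm_of_nonneg hν.le]
    rw [← mul_assoc, inv_pow, sq, mul_inv, ← mul_assoc, mul_inv_cancel₀ hν.ne', one_mul,
      inv_mul_le_iff₀ hν]
    exact h3
  have s0 := (memLp_two_iff_integrable_sq_norm hu.1).1 hu
  have s1 := (memLp_two_iff_integrable_sq_norm h1.1).1 h1
  have s2 := (memLp_two_iff_integrable_sq_norm h2.1).1 h2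
  have s3 := (memLp_two_iff_integrable_sq_norm hnL.1).1 hnL
  have s3' : Integrable (fun p : ℝ × ℝ => ‖n p.1‖ ^ 2) (μ.prod ν) := s3.comp_fst ν
  have k1 : ∫ p, ‖u p‖ ^ 2 ∂(μ.prod ν) ≤
      ∫ p, (2 * ‖u p - n p.1‖ ^ 2 + 2 * ‖n p.1‖ ^ 2) ∂(μ.prod ν) := by
    refine integral_mono s0 ((s1.const_mul 2).add (s3'.const_mul 2)) fun p => ?_
    have := norm_add_le (u p - n p.1) (n p.1)
    rw [sub_add_cancel] at this
    simp only
    nlinarith [sq_nonneg (‖u p - n p.1‖ - ‖n p.1‖), norm_nonneg (u p)]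
  rw [integral_add (s1.const_mul 2) (s3'.const_mul 2), integral_const_mul, integral_const_mul] at k1
  refine k1.trans (add_le_add le_rfl (mul_le_mul_of_nonneg_left ?_ (by norm_num)))
  rw [integral_prod _ s3', integral_prod _ s2]
  simp only [integral_const, smul_eq_mul]
  exact integral_mono_ae (s3.const_mul _) s2.integral_prod_left hnm

theorem integral_fiber_deviation_le {A : Set ℝ} (hA : IsOpen A) (hA' : volume A ≠ ⊤) {a b : ℝ}
    (hab : a < b) {f g : ℝ × ℝ → ℂ}
    (hf : MemLp f 2 ((volume.restrict A).prod (volume.restrict (Ioo a b))))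
    (hg : MemLp g 2 ((volume.restrict A).prod (volume.restrict (Ioo a b))))
    (hw : ∀ φ : ℝ × ℝ → ℝ, ContDiff ℝ ∞ φ → HasCompactSupport φ → tsupport φ ⊆ A ×ˢ Ioo a b →
      ∫ p in A ×ˢ Ioo a b, (fderiv ℝ φ p (0, 1)) • f p = - ∫ p in A ×ˢ Ioo a b, φ p • g p) :
    ∫ p, ‖f p - (b - a)⁻¹ • ∫ s in Ioo a b, f (p.1, s)‖ ^ 2
        ∂((volume.restrict A).prod (volume.restrict (Ioo a b)))
      ≤ (b - a) ^ 2 * ∫ p, ‖g p‖ ^ 2 ∂((volume.restrict A).prod (volume.restrict (Ioo a b))) := by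
  have : IsFiniteMeasure (volume.restrict A) := ⟨by simpa using hA'.lt_top⟩
  obtain ⟨t, ht⟩ := exists_primitive_of_weakDeriv_snd hA hab (hf.integrable (by norm_num))
    (hg.integrable (by norm_num)) hw
  have h1 := MemLp.sub_fiber_average hf (b - a)⁻¹
  have s1 := (memLp_two_iff_integrable_sq_norm h1.1).1 h1
  have s2 := (memLp_two_iff_integrable_sq_norm hg.1).1 hg
  rw [integral_prod _ s1, integral_prod _ s2, ← integral_const_mul]
  refine integral_mono_ae s1.integral_prod_left (s2.integral_prod_left.const_mul _) ?_
  filter_upwards [memLp_two_prod_right_ae hg, Measure.ae_ae_of_ae_prod ht] with x hx hx'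
  exact integral_sub_average_sq_le hab hx (t x) hx'

theorem fderiv_comp_swap {φ : ℝ × ℝ → ℝ} (hφ : Differentiable ℝ φ) (p : ℝ × ℝ) :
    fderiv ℝ (fun q : ℝ × ℝ => φ q.swap) p (1, 0) = fderiv ℝ φ p.swap (0, 1) := by
  have h : HasFDerivAt (fun q : ℝ × ℝ => φ q.swap)
      ((fderiv ℝ φ p.swap).comp (ContinuousLinearEquiv.prodComm ℝ ℝ ℝ : ℝ × ℝ →L[ℝ] ℝ × ℝ)) p :=
    (hφ p.swap).hasFDerivAt.comp p
      (ContinuousLinearEquiv.prodComm ℝ ℝ ℝ : ℝ × ℝ →L[ℝ] ℝ × ℝ).hasFDerivAt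
  rw [h.fderiv]
  rfl

theorem restrict_Ioo_prod_Ioo (p p' q q' : ℝ) :
    (volume : Measure (ℝ × ℝ)).restrict (Ioo p p' ×ˢ Ioo q q') =
      (volume.restrict (Ioo p p')).prod (volume.restrict (Ioo q q')) := by
  rw [Measure.volume_eq_prod, Measure.prod_restrict]

variable {d : ℝ}

theorem rect_subset_strip {p p' q q' : ℝ} (hq : 0 ≤ q) (hq' : q' ≤ d) :
    Ioo p p' ×ˢ Ioo q q' ⊆ strip d :=
  fun _ h => ⟨hq.trans_lt h.2.1, h.2.2.trans_le hq'⟩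

theorem memLp_rect (f : L2Strip d) {p p' q q' : ℝ} (hq : 0 ≤ q) (hq' : q' ≤ d) :
    MemLp f 2 ((volume : Measure (ℝ × ℝ)).restrict (Ioo p p' ×ˢ Ioo q q')) :=
  (Lp.memLp f).mono_measure (Measure.restrict_mono (rect_subset_strip hq hq') le_rfl)

theorem IsWeakDeriv.on_rect {v : ℝ × ℝ} {f g : L2Strip d} (h : IsWeakDeriv d v f g)
    {p p' q q' : ℝ} (hq : 0 ≤ q) (hq' : q' ≤ d) {φ : ℝ × ℝ → ℝ} (hφ : ContDiff ℝ ∞ φ)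
    (hc : HasCompactSupport φ) (hs : tsupport φ ⊆ Ioo p p' ×ˢ Ioo q q') :
    ∫ z in Ioo p p' ×ˢ Ioo q q', (_root_.fderiv ℝ φ z v) • f z
      = - ∫ z in Ioo p p' ×ˢ Ioo q q', φ z • g z := by
  have hsub := rect_subset_strip (d := d) (p := p) (p' := p') hq hq'
  have h0 := h φ hφ hc (hs.trans hsub)
  rw [setIntegral_eq_of_subset_of_forall_sdiff_eq_zero (isOpen_strip d).measurableSet hsub,
    setIntegral_eq_of_subset_of_forall_sdiff_eq_zero (isOpen_strip d).measurableSet hsub] at h0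
  · exact h0
  · intro z hz
    rw [image_eq_zero_of_notMem_tsupport fun h => hz.2 (hs h), zero_smul]
  · intro z hz
    have : _root_.fderiv ℝ φ z v = 0 := by
      have h1 : z ∉ tsupport (_root_.fderiv ℝ φ) := fun h => hz.2 (hs (tsupport_fderiv_subset ℝ h))
      rw [image_eq_zero_of_notMem_tsupport h1]; rfl
    rw [this, zero_smul]

/-- The Poincaré inequality on rectangles. -/
theorem IsWeakGrad.poincare_rect {u v w : L2Strip d} (h : IsWeakGrad d u v w) {p p' q q' : ℝ}
    (hp : p < p') (hq : 0 ≤ q) (hqq : q < q') (hq' : q' ≤ d)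
    (h0 : ∫ z in Ioo p p' ×ˢ Ioo q q', u z = 0) :
    ∫ z in Ioo p p' ×ˢ Ioo q q', ‖u z‖ ^ 2 ≤
      2 * (q' - q) ^ 2 * (∫ z in Ioo p p' ×ˢ Ioo q q', ‖w z‖ ^ 2) +
      2 * (p' - p) ^ 2 * ∫ z in Ioo p p' ×ˢ Ioo q q', ‖v z‖ ^ 2 := by
  have hu := memLp_rect u (p := p) (p' := p') hq hq'
  have hv := memLp_rect v (p := p) (p' := p') hq hq'
  have hw := memLp_rect w (p := p) (p' := p') hq hq'
  rw [restrict_Ioo_prod_Ioo] at hu hv hw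
  have e1 : (volume.restrict (Ioo p p')).real univ = p' - p := by
    simp [measureReal_def, hp.le]
  have e2 : (volume.restrict (Ioo q q')).real univ = q' - q := by
    simp [measureReal_def, hqq.le]
  have k1 := integral_fiber_deviation_le isOpen_Ioo (by simp) hqq hu hw
    fun φ hφ hc hs => h.2.on_rect hq hq' hφ hc hs
  -- The horizontal estimate is the vertical one after exchanging the coordinates, which sends `∂_x`
  -- to `∂_y`.
  have k2 := integral_fiber_deviation_le isOpen_Ioo (by simp) hp (MemLp.prod_swap hu) (MemLp.prod_swap hv)
    fun φ hφ hc hs => by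
      have hφ' : ContDiff ℝ ∞ fun q : ℝ × ℝ => φ q.swap := hφ.comp (contDiff_snd.prodMk contDiff_fst)
      have hts : tsupport (fun q : ℝ × ℝ => φ q.swap) = Prod.swap ⁻¹' tsupport φ :=
        tsupport_comp_eq_preimage φ (Homeomorph.prodComm ℝ ℝ)
      have := h.1.on_rect (p := p) (p' := p') hq hq' hφ'
        (hc.comp_homeomorph (Homeomorph.prodComm ℝ ℝ)) (by
          rw [hts]
          intro z hz
          have := hs hz
          exact ⟨this.2, this.1⟩)
      simp only [fderiv_comp_swap (hφ.differentiable (by simp))] at this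
      rw [restrict_Ioo_prod_Ioo] at this ⊢
      rw [← integral_prod_swap, ← integral_prod_swap (fun z : ℝ × ℝ => φ z.swap • v z)] at this
      simpa only [Prod.swap_swap] using this
  have k3 := integral_norm_sq_le_fiber_deviations (by rw [e2]; linarith)
    hu (by rwa [← restrict_Ioo_prod_Ioo])
  rw [e1, e2] at k3
  have e3 : ∫ z, ‖v z.swap‖ ^ 2 ∂((volume.restrict (Ioo q q')).prod (volume.restrict (Ioo p p'))) =
      ∫ z, ‖v z‖ ^ 2 ∂((volume.restrict (Ioo p p')).prod (volume.restrict (Ioo q q'))) :=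
    integral_prod_swap (fun z => ‖v z‖ ^ 2)
  rw [e3, ← integral_prod_swap] at k2
  simp only [Prod.swap_swap, Prod.fst_swap, Prod.swap_prod_mk] at k2
  rw [restrict_Ioo_prod_Ioo]
  linarith

theorem setIntegral_rect_split_fst {p m p' q q' : ℝ} (h1 : p < m) (h2 : m < p') {f : ℝ × ℝ → ℝ}
    (hf : IntegrableOn f (Ioo p p' ×ˢ Ioo q q')) :
    ∫ z in Ioo p p' ×ˢ Ioo q q', f z =
      (∫ z in Ioo p m ×ˢ Ioo q q', f z) + ∫ z in Ioo m p' ×ˢ Ioo q q', f z := by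
  have e : Ioo p p' ×ˢ Ioo q q' =ᵐ[volume] ((Ioo p m ×ˢ Ioo q q') ∪ (Ioo m p' ×ˢ Ioo q q') :
      Set (ℝ × ℝ)) := by
    rw [← union_prod]
    refine Measure.set_prod_ae_eq ?_ .rfl
    rw [← Ioc_union_Ioo_eq_Ioo h1.le h2]
    exact Ioo_ae_eq_Ioc.symm.union .rfl
  have hd : Disjoint (Ioo p m ×ˢ Ioo q q') (Ioo m p' ×ˢ Ioo q q') := by
    rw [disjoint_left]
    intro z hz hz'
    exact lt_asymm hz.1.2 hz'.1.1
  rw [setIntegral_congr_set e, setIntegral_union hd (measurableSet_Ioo.prod measurableSet_Ioo)]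
  · exact hf.mono_set (prod_mono (Ioo_subset_Ioo_right h2.le) le_rfl)
  · exact hf.mono_set (prod_mono (Ioo_subset_Ioo_left h1.le) le_rfl)

theorem setIntegral_rect_split_snd {p p' q m q' : ℝ} (h1 : q < m) (h2 : m < q') {f : ℝ × ℝ → ℝ}
    (hf : IntegrableOn f (Ioo p p' ×ˢ Ioo q q')) :
    ∫ z in Ioo p p' ×ˢ Ioo q q', f z =
      (∫ z in Ioo p p' ×ˢ Ioo q m, f z) + ∫ z in Ioo p p' ×ˢ Ioo m q', f z := by
  have e : Ioo p p' ×ˢ Ioo q q' =ᵐ[volume] ((Ioo p p' ×ˢ Ioo q m) ∪ (Ioo p p' ×ˢ Ioo m q') :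
      Set (ℝ × ℝ)) := by
    rw [← prod_union]
    refine Measure.set_prod_ae_eq .rfl ?_
    rw [← Ioc_union_Ioo_eq_Ioo h1.le h2]
    exact Ioo_ae_eq_Ioc.symm.union .rfl
  have hd : Disjoint (Ioo p p' ×ˢ Ioo q m) (Ioo p p' ×ˢ Ioo m q') := by
    rw [disjoint_left]
    intro z hz hz'
    exact lt_asymm hz.2.2 hz'.2.1
  rw [setIntegral_congr_set e, setIntegral_union hd (measurableSet_Ioo.prod measurableSet_Ioo)]
  · exact hf.mono_set (prod_mono le_rfl (Ioo_subset_Ioo_right h2.le))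
  · exact hf.mono_set (prod_mono le_rfl (Ioo_subset_Ioo_left h1.le))

/-- The Poincaré inequality with constant `ε` holds on the set `Q` up to finitely many
orthogonality conditions. -/
def PoincareOn (d : ℝ) (Q : Set (ℝ × ℝ)) (ε : ℝ) : Prop :=
  ∃ W : Submodule ℂ (L2Strip d), FiniteDimensional ℂ W ∧ ∀ u v w, IsWeakGrad d u v w → u ∈ Wᗮ →
    ∫ z in Q, ‖u z‖ ^ 2 ≤ ε * ((∫ z in Q, ‖v z‖ ^ 2) + ∫ z in Q, ‖w z‖ ^ 2)

theorem PoincareOn.of_split {Q Q₁ Q₂ : Set (ℝ × ℝ)} {ε : ℝ} (h1 : PoincareOn d Q₁ ε)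
    (h2 : PoincareOn d Q₂ ε) (h : ∀ f : L2Strip d,
      ∫ z in Q, ‖f z‖ ^ 2 = (∫ z in Q₁, ‖f z‖ ^ 2) + ∫ z in Q₂, ‖f z‖ ^ 2) :
    PoincareOn d Q ε := by
  obtain ⟨W₁, i1, h1⟩ := h1
  obtain ⟨W₂, i2, h2⟩ := h2
  refine ⟨W₁ ⊔ W₂, inferInstance, fun u v w hu hW => ?_⟩
  have k1 := h1 u v w hu (Submodule.orthogonal_le le_sup_left hW)
  have k2 := h2 u v w hu (Submodule.orthogonal_le le_sup_right hW)
  rw [h, h, h]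
  linarith

theorem integrableOn_rect (f : L2Strip d) {p p' q q' : ℝ} (hq : 0 ≤ q) (hq' : q' ≤ d) :
    IntegrableOn (fun z => ‖f z‖ ^ 2) (Ioo p p' ×ˢ Ioo q q') :=
  (memLp_two_iff_integrable_sq_norm (memLp_rect f hq hq').1).1 (memLp_rect f hq hq')

/-- One condition suffices: orthogonality to the indicator of the rectangle means mean zero there.
-/
theorem poincareOn_rect_of_small {p p' q q' ε : ℝ} (hp : p < p') (hq : 0 ≤ q) (hqq : q < q')
    (hq' : q' ≤ d) (h1 : 2 * (p' - p) ^ 2 ≤ ε) (h2 : 2 * (q' - q) ^ 2 ≤ ε) :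
    PoincareOn d (Ioo p p' ×ˢ Ioo q q') ε := by
  have hm : MeasurableSet (Ioo p p' ×ˢ Ioo q q') := measurableSet_Ioo.prod measurableSet_Ioo
  have hfin : (volume.restrict (strip d)) (Ioo p p' ×ˢ Ioo q q') ≠ ⊤ := by
    refine ((Measure.restrict_apply_le _ _).trans_lt ?_).ne
    rw [Measure.volume_eq_prod, Measure.prod_prod, Real.volume_Ioo, Real.volume_Ioo]
    exact ENNReal.mul_lt_top ENNReal.ofReal_lt_top ENNReal.ofReal_lt_top
  refine ⟨Submodule.span ℂ {indicatorConstLp 2 hm hfin (1 : ℂ)}, inferInstance,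
    fun u v w hu hW => ?_⟩
  have h0 : inner ℂ (indicatorConstLp 2 hm hfin (1 : ℂ)) u = 0 :=
    (Submodule.mem_orthogonal _ _).1 hW _ (Submodule.mem_span_singleton_self _)
  rw [L2.inner_indicatorConstLp_one, Measure.restrict_restrict hm,
    inter_eq_self_of_subset_left (rect_subset_strip hq hq')] at h0
  refine (hu.poincare_rect hp hq hqq hq' h0).trans ?_
  rw [mul_add, add_comm]
  have i1 : 0 ≤ ∫ z in Ioo p p' ×ˢ Ioo q q', ‖v z‖ ^ 2 := integral_nonneg fun _ => by positivity
  have i2 : 0 ≤ ∫ z in Ioo p p' ×ˢ Ioo q q', ‖w z‖ ^ 2 := integral_nonneg fun _ => by positivity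
  gcongr

/-- Cutting a rectangle into quarters halves both sides and divides the Poincaré constant by `4`,
while the orthogonality conditions of the pieces add up. This plays the role of Rellich's
compactness theorem. -/
theorem poincareOn_rect_of_pow {ε : ℝ} (n : ℕ) : ∀ {p p' q q' : ℝ}, p < p' → 0 ≤ q → q < q' →
    q' ≤ d → 2 * (p' - p) ^ 2 ≤ 4 ^ n * ε → 2 * (q' - q) ^ 2 ≤ 4 ^ n * ε →
    PoincareOn d (Ioo p p' ×ˢ Ioo q q') ε := by
  induction n with
  | zero =>
    intro p p' q q' hp hq hqq hq' h1 h2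
    rw [pow_zero, one_mul] at h1 h2
    exact poincareOn_rect_of_small hp hq hqq hq' h1 h2
  | succ n ih =>
    intro p p' q q' hp hq hqq hq' h1 h2
    rw [pow_succ (4 : ℝ)] at h1 h2
    have hsplit : ∀ {a b : ℝ}, a < b → 2 * (b - a) ^ 2 ≤ 4 ^ n * ε →
        PoincareOn d (Ioo a b ×ˢ Ioo q q') ε := by
      intro a b hab h3
      refine PoincareOn.of_split (Q₁ := Ioo a b ×ˢ Ioo q ((q + q') / 2))
        (Q₂ := Ioo a b ×ˢ Ioo ((q + q') / 2) q')
        (ih hab hq (by linarith) (by linarith) h3 (by nlinarith))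
        (ih hab (by linarith) (by linarith) hq' h3 (by nlinarith)) fun f => ?_
      exact setIntegral_rect_split_snd (by linarith) (by linarith) (integrableOn_rect f hq hq')
    refine PoincareOn.of_split (hsplit (a := p) (b := (p + p') / 2) (by linarith) (by nlinarith))
      (hsplit (a := (p + p') / 2) (b := p') (by linarith) (by nlinarith)) fun f => ?_
    exact setIntegral_rect_split_fst (by linarith) (by linarith) (integrableOn_rect f hq hq')

theorem poincareOn_box (hd : 0 < d) {L ε : ℝ} (hL : 0 < L) (hε : 0 < ε) :
    PoincareOn d (Ioo (-L) L ×ˢ Ioo 0 d) ε := by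
  obtain ⟨n, hn⟩ := pow_unbounded_of_one_lt (max (2 * (L - -L) ^ 2 / ε) (2 * (d - 0) ^ 2 / ε))
    (by norm_num : (1 : ℝ) < 4)
  rw [max_lt_iff, div_lt_iff₀ hε, div_lt_iff₀ hε] at hn
  exact poincareOn_rect_of_pow n (by linarith) le_rfl hd le_rfl hn.1.le hn.2.le

end Rectangles

/-! ### Lower bound for the form off a finite dimensional space -/

section LowerBound

variable {d : ℝ}

/-- The squared norm of the restriction to a vertical fibre. -/
noncomputable def fiberNormSq (f : L2Strip d) (x : ℝ) : ℝ := ∫ y in Ioo 0 d, ‖f (x, y)‖ ^ 2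

theorem integrable_norm_sq_strip (f : L2Strip d) :
    Integrable (fun p => ‖f p‖ ^ 2) (volume.restrict (strip d)) :=
  (memLp_two_iff_integrable_sq_norm (Lp.memLp f).1).1 (Lp.memLp f)

theorem integrable_fiberNormSq (f : L2Strip d) : Integrable (fiberNormSq f) := by
  have h := integrable_norm_sq_strip f
  have h' : Integrable (fun p => ‖f p‖ ^ 2)
      ((volume : Measure ℝ).prod (volume.restrict (Ioo 0 d))) := by
    have h2 := MemLp.strip_prod (Lp.memLp f)
    exact (memLp_two_iff_integrable_sq_norm h2.1).1 h2
  exact h'.integral_prod_left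

theorem norm_sq_eq_integral_fiberNormSq (f : L2Strip d) : ‖f‖ ^ 2 = ∫ x, fiberNormSq f x := by
  rw [Lp_norm_sq_eq_integral, integral_strip (integrable_norm_sq_strip f)]
  rfl

theorem setIntegral_box_eq (f : L2Strip d) (p p' : ℝ) :
    ∫ z in Ioo p p' ×ˢ Ioo 0 d, ‖f z‖ ^ 2 = ∫ x in Ioo p p', fiberNormSq f x := by
  exact setIntegral_prod _ (integrableOn_rect f (p := p) (p' := p') le_rfl le_rfl)

theorem fiberNormSq_nonneg (f : L2Strip d) (x : ℝ) : 0 ≤ fiberNormSq f x :=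
  integral_nonneg fun _ => by positivity

theorem integrable_mul_norm_sq {a : ℝ → ℝ} (ha : MemLp a ⊤ volume) (f : L2Line) :
    Integrable fun x => a x * ‖f x‖ ^ 2 := by
  obtain ⟨C, hC⟩ := MemLp.exists_ae_abs_le ha
  have h := (memLp_two_iff_integrable_sq_norm (Lp.memLp f).1).1 (Lp.memLp f)
  exact h.bdd_mul ha.1 (c := C) hC

theorem re_inner_mulLine {a : ℝ → ℝ} (ha : MemLp a ⊤ volume) (f : L2Line) :
    (inner ℂ (mulLine ha f) f : ℂ).re = ∫ x, a x * ‖f x‖ ^ 2 := by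
  have h : (inner ℂ (mulLine ha f) f : ℂ) = ∫ x, ((a x * ‖f x‖ ^ 2 : ℝ) : ℂ) := by
    rw [inner_eq_integral_conj_mul]
    refine integral_congr_ae ?_
    filter_upwards [coeFn_mulLine ha f] with x hx
    rw [hx, map_mul, Complex.conj_ofReal, mul_assoc, Complex.conj_mul']
    push_cast; ring
  rw [h, integral_complex_ofReal, Complex.ofReal_re]

theorem re_robinForm_self {a : ℝ → ℝ} (ha : MemLp a ⊤ volume) (u v w : L2Strip d) :
    (robinForm d ha u v w u v w).re = ‖u‖ ^ 2 + (‖v‖ ^ 2 + ‖w‖ ^ 2) +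
      ((∫ x, a x * ‖traceOp d 0 (u, w) x‖ ^ 2) + ∫ x, a x * ‖traceOp d d (u, w) x‖ ^ 2) := by
  have h : ∀ f : L2Strip d, (inner ℂ f f : ℂ).re = ‖f‖ ^ 2 := fun f =>
    inner_self_eq_norm_sq (𝕜 := ℂ) f
  simp only [robinForm, Complex.add_re, h, re_inner_mulLine]

theorem IsWeakDeriv.ae_transversal_inequality (hd : 0 < d) {k : ℝ} (hk : 0 < k)
    (hkd : k * d < Real.pi) {u w : L2Strip d} (h : IsWeakDeriv d (0, 1) u w) :
    ∀ᵐ x : ℝ, k ^ 2 * fiberNormSq u x ≤ fiberNormSq w x + k * Real.tan (k * d / 2) *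
      (‖traceOp d 0 (u, w) x‖ ^ 2 + ‖traceOp d d (u, w) x‖ ^ 2) := by
  filter_upwards [ae_fiber (h.ae_eq_primitive hd), h.traceOp_ae hd, ae_fiber_memLp w]
    with x h1 h2 h3
  have h4 := transversal_inequality hd hk hkd h3 (traceOp d 0 (u, w) x)
    (w := fun y => traceOp d 0 (u, w) x + ∫ s in (0 : ℝ)..y, w (x, s)) fun _ => rfl
  rw [intervalIntegral.integral_same, add_zero, ← h2] at h4
  have h5 : fiberNormSq u x = ∫ y in Ioo 0 d,
      ‖traceOp d 0 (u, w) x + ∫ s in (0 : ℝ)..y, w (x, s)‖ ^ 2 := by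
    refine integral_congr_ae ?_
    filter_upwards [h1] with y hy
    rw [hy]
  rw [h5]
  exact h4

/-- If the coupling function is bounded below at infinity by the one that corresponds to the
transversal wave number `k`, then the form is bounded below by `k² + 1` up to finitely many
orthogonality conditions. -/
theorem exists_finiteDimensional_form_lower_bound (hd : 0 < d) {k : ℝ} (hk : 0 < k)
    (hkd : k * d < Real.pi) {a : ℝ → ℝ} (ha : MemLp a ⊤ volume) (hpos : ∀ x, 0 ≤ a x) {L : ℝ}
    (hL : 0 < L) (hout : ∀ᵐ x : ℝ, L ≤ |x| → k * Real.tan (k * d / 2) ≤ a x) :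
    ∃ W : Submodule ℂ (L2Strip d), FiniteDimensional ℂ W ∧ ∀ u v w, IsWeakGrad d u v w →
      u ∈ Wᗮ → (k ^ 2 + 1) * ‖u‖ ^ 2 ≤ (robinForm d ha u v w u v w).re := by
  -- This constant makes the full gradient on the box dominate `k² ‖u‖²` there, without any help
  -- from the boundary terms.
  obtain ⟨W, hW, h⟩ := poincareOn_box hd hL (ε := (k ^ 2)⁻¹) (by positivity)
  refine ⟨W, hW, fun u v w hu huW => ?_⟩
  have h1 := h u v w hu huW
  simp only [setIntegral_box_eq] at h1
  rw [le_inv_mul_iff₀ (by positivity)] at h1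
  have hb : Integrable fun x => a x * ‖traceOp d 0 (u, w) x‖ ^ 2 +
      a x * ‖traceOp d d (u, w) x‖ ^ 2 := (integrable_mul_norm_sq ha (traceOp d 0 (u, w))).add
    (integrable_mul_norm_sq ha (traceOp d d (u, w)))
  have hb0 : ∀ x, 0 ≤ a x * ‖traceOp d 0 (u, w) x‖ ^ 2 + a x * ‖traceOp d d (u, w) x‖ ^ 2 :=
    fun x => by have := hpos x; positivity
  have hS : MeasurableSet (Ioo (-L) L) := measurableSet_Ioo
  -- Outside the box the vertical derivative and the boundary terms suffice, fibre by fibre. The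
  -- horizontal derivative outside and the boundary terms inside are nonnegative and are dropped.
  have h2 : ∫ x in (Ioo (-L) L)ᶜ, k ^ 2 * fiberNormSq u x ≤ ∫ x in (Ioo (-L) L)ᶜ,
      (fiberNormSq w x + (a x * ‖traceOp d 0 (u, w) x‖ ^ 2 +
        a x * ‖traceOp d d (u, w) x‖ ^ 2)) := by
    refine setIntegral_mono_on_ae ((integrable_fiberNormSq u).const_mul _).integrableOn
      ((integrable_fiberNormSq w).add hb).integrableOn hS.compl ?_
    filter_upwards [hu.2.ae_transversal_inequality hd hk hkd, hout] with x k1 k2 hx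
    have hx' : L ≤ |x| := by
      by_contra! hcon
      exact hx (abs_lt.1 hcon)
    refine k1.trans ?_
    rw [← mul_add]
    gcongr
    exact k2 hx'
  rw [integral_add (integrable_fiberNormSq w).integrableOn hb.integrableOn, integral_const_mul] at h2
  have h3 : ∫ x in (Ioo (-L) L)ᶜ, (a x * ‖traceOp d 0 (u, w) x‖ ^ 2 +
        a x * ‖traceOp d d (u, w) x‖ ^ 2) ≤ ∫ x, (a x * ‖traceOp d 0 (u, w) x‖ ^ 2 +
        a x * ‖traceOp d d (u, w) x‖ ^ 2) := setIntegral_le_integral hb (.of_forall hb0)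
  have h4 : ∫ x in Ioo (-L) L, fiberNormSq v x ≤ ∫ x, fiberNormSq v x :=
    setIntegral_le_integral (integrable_fiberNormSq v) (.of_forall fun x => fiberNormSq_nonneg v x)
  have h5 := integral_add_compl hS (integrable_fiberNormSq u)
  have h6 := integral_add_compl hS (integrable_fiberNormSq w)
  have h7 := integral_add (integrable_mul_norm_sq ha (traceOp d 0 (u, w)))
    (integrable_mul_norm_sq ha (traceOp d d (u, w)))
  rw [re_robinForm_self, add_mul, one_mul]
  rw [← norm_sq_eq_integral_fiberNormSq] at h4 h5 h6
  rw [← h5, mul_add, h5, ← h6]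
  linarith

end LowerBound

/-! ### Trial functions -/

section TrialFunctions

open Filter Topology

theorem fderiv_mul_fst_snd {ψ η : ℝ → ℝ} (hψ : Differentiable ℝ ψ) (hη : Differentiable ℝ η)
    (p v : ℝ × ℝ) : fderiv ℝ (fun q : ℝ × ℝ => ψ q.1 * η q.2) p v =
      v.1 * (deriv ψ p.1 * η p.2) + v.2 * (ψ p.1 * deriv η p.2) := by
  have h1 : HasFDerivAt (fun q : ℝ × ℝ => ψ q.1)
      (deriv ψ p.1 • ContinuousLinearMap.fst ℝ ℝ ℝ) p :=
    (hψ p.1).hasDerivAt.comp_hasFDerivAt p hasFDerivAt_fst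
  have h2 : HasFDerivAt (fun q : ℝ × ℝ => η q.2)
      (deriv η p.2 • ContinuousLinearMap.snd ℝ ℝ ℝ) p :=
    (hη p.2).hasDerivAt.comp_hasFDerivAt p hasFDerivAt_snd
  have h3 : HasFDerivAt (fun q : ℝ × ℝ => ψ q.1 * η q.2) _ p := h1.mul h2
  rw [h3.fderiv]
  simp
  ring

theorem IsBoxFun.norm_toL2_sq {F : ℝ × ℝ → ℝ} (hF : IsBoxFun F) (d : ℝ) {ψ η : ℝ → ℝ}
    (h : ∀ p, F p = ψ p.1 * η p.2) :
    ‖hF.toL2 d‖ ^ 2 = (∫ x, ψ x ^ 2) * ∫ y in Ioo 0 d, η y ^ 2 := by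
  have h1 : ‖hF.toL2 d‖ ^ 2 = ∫ p in strip d, ψ p.1 ^ 2 * η p.2 ^ 2 := by
    rw [Lp_norm_sq_eq_integral]
    refine integral_congr_ae ?_
    filter_upwards [hF.coeFn_toL2 d] with p hp
    rw [hp, Complex.norm_real, Real.norm_eq_abs, sq_abs, h, mul_pow]
  rw [h1, volume_restrict_strip]
  exact integral_prod_mul (fun x => ψ x ^ 2) (fun y => η y ^ 2)

theorem re_robinForm_product {d : ℝ} (hd : 0 < d) {a : ℝ → ℝ} (ha : MemLp a ⊤ volume)
    {ψ η : ℝ → ℝ} (hψ : ContDiff ℝ ∞ ψ) (hc : HasCompactSupport ψ) (hη : ContDiff ℝ ∞ η) :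
    (robinForm d ha ((isBoxFun_mul hψ hc hη).toL2 d)
      (((isBoxFun_mul hψ hc hη).fderiv (1, 0)).toL2 d)
      (((isBoxFun_mul hψ hc hη).fderiv (0, 1)).toL2 d) ((isBoxFun_mul hψ hc hη).toL2 d)
      (((isBoxFun_mul hψ hc hη).fderiv (1, 0)).toL2 d)
      (((isBoxFun_mul hψ hc hη).fderiv (0, 1)).toL2 d)).re =
    (∫ x, ψ x ^ 2) * (∫ y in Ioo 0 d, η y ^ 2) + ((∫ x, deriv ψ x ^ 2) * (∫ y in Ioo 0 d, η y ^ 2) +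
      (∫ x, ψ x ^ 2) * ∫ y in Ioo 0 d, deriv η y ^ 2) +
      (η 0 ^ 2 + η d ^ 2) * ∫ x, a x * ψ x ^ 2 := by
  have hF := isBoxFun_mul hψ hc hη
  have hψd : Differentiable ℝ ψ := hψ.differentiable (by simp)
  have hηd : Differentiable ℝ η := hη.differentiable (by simp)
  have htr : ∀ c, c = 0 ∨ c = d →
      ∫ x, a x * ‖traceOp d c (hF.toL2 d, (hF.fderiv (0, 1)).toL2 d) x‖ ^ 2 =
        η c ^ 2 * ∫ x, a x * ψ x ^ 2 := by
    intro c hc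
    rw [← integral_const_mul]
    refine integral_congr_ae ?_
    filter_upwards [hF.traceOp_ae hd hc] with x hx
    rw [hx, Complex.norm_real, Real.norm_eq_abs, sq_abs]
    ring
  rw [re_robinForm_self, htr 0 (.inl rfl), htr d (.inr rfl),
    IsBoxFun.norm_toL2_sq hF d (ψ := ψ) (η := η) fun p => rfl,
    IsBoxFun.norm_toL2_sq (hF.fderiv (1, 0)) d (ψ := deriv ψ) (η := η) fun p => by
      rw [fderiv_mul_fst_snd hψd hηd]; simp,
    IsBoxFun.norm_toL2_sq (hF.fderiv (0, 1)) d (ψ := ψ) (η := deriv η) fun p => by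
      rw [fderiv_mul_fst_snd hψd hηd]; simp]
  ring

theorem deriv_cos_centered (k d : ℝ) :
    (deriv fun y : ℝ => Real.cos (k * (y - d / 2))) = fun y => -(k * Real.sin (k * (y - d / 2))) := by
  funext y
  have h : HasDerivAt (fun y : ℝ => k * (y - d / 2)) k y := by
    simpa using ((hasDerivAt_id y).sub_const (d / 2)).const_mul k
  rw [h.cos.deriv]; ring

/-- The transversal ground state. -/
theorem transversal_ground_state {d k : ℝ} (hd : 0 < d) (hk : 0 < k) (hkd : k * d < Real.pi) :
    (∫ y in Ioo 0 d, (k * Real.sin (k * (y - d / 2))) ^ 2) +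
      k * Real.tan (k * d / 2) * (2 * Real.cos (k * d / 2) ^ 2) =
    k ^ 2 * ∫ y in Ioo 0 d, Real.cos (k * (y - d / 2)) ^ 2 := by
  have hc : Real.cos (k * d / 2) ≠ 0 :=
    (Real.cos_pos_of_mem_Ioo ⟨by nlinarith [Real.pi_pos, mul_pos hk hd], by linarith⟩).ne'
  -- This is the antiderivative `-η η'` for the ground state `η`, that is, `-η'' = k² η` multiplied
  -- by `η` and integrated by parts.
  have hder : ∀ y ∈ uIcc 0 d, HasDerivAt
      (fun y : ℝ => k * (Real.sin (k * (y - d / 2)) * Real.cos (k * (y - d / 2))))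
      (k ^ 2 * Real.cos (k * (y - d / 2)) ^ 2 - (k * Real.sin (k * (y - d / 2))) ^ 2) y := by
    intro y _
    have h : HasDerivAt (fun y : ℝ => k * (y - d / 2)) k y := by
      simpa using ((hasDerivAt_id y).sub_const (d / 2)).const_mul k
    exact ((h.sin.mul h.cos).const_mul k).congr_deriv (by ring)
  have c1 : Continuous fun y : ℝ => k ^ 2 * Real.cos (k * (y - d / 2)) ^ 2 := by fun_prop
  have c2 : Continuous fun y : ℝ => (k * Real.sin (k * (y - d / 2))) ^ 2 := by fun_prop
  have h1 := intervalIntegral.integral_eq_sub_of_hasDerivAt hder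
    ((c1.sub c2).intervalIntegrable _ _)
  rw [intervalIntegral.integral_sub (c1.intervalIntegrable _ _) (c2.intervalIntegrable _ _),
    intervalIntegral.integral_const_mul] at h1
  have e1 : k * (d - d / 2) = k * d / 2 := by ring
  have e2 : k * (0 - d / 2) = -(k * d / 2) := by ring
  rw [e1, e2, Real.sin_neg, Real.cos_neg] at h1
  simp only [← integral_Ioc_eq_integral_Ioo, ← intervalIntegral.integral_of_le hd.le]
  have h2 : Real.tan (k * d / 2) * Real.cos (k * d / 2) ^ 2 =
      Real.sin (k * d / 2) * Real.cos (k * d / 2) := by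
    rw [Real.tan_eq_sin_div_cos]; field_simp
  linear_combination -h1 + 2 * k * h2

/-- A long plateau function. -/
theorem exists_plateau {g : ℝ → ℝ} (hg : Integrable g) (hneg : ∫ x, g x < 0) {A B : ℝ}
    (hB : 0 < B) : ∃ ψ : ℝ → ℝ, ContDiff ℝ ∞ ψ ∧ HasCompactSupport ψ ∧
      A * (∫ x, deriv ψ x ^ 2) + B * (∫ x, g x * ψ x ^ 2) < 0 := by
  let χ : ContDiffBump (0 : ℝ) := default
  have hχ : ContDiff ℝ ∞ χ := χ.contDiff
  have hχc : HasCompactSupport χ := χ.hasCompactSupport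
  -- In one dimension, stretching by a factor `n + 1` divides the kinetic energy by `n + 1`; the
  -- shift by one avoids division by zero.
  have hscale : ∀ n : ℕ, ∫ x, deriv (fun x => χ (x / (n + 1 : ℝ))) x ^ 2 =
      (n + 1 : ℝ)⁻¹ * ∫ x, deriv χ x ^ 2 := by
    intro n
    have hn : (0 : ℝ) < n + 1 := by positivity
    have h1 : ∀ x, deriv (fun x => χ (x / (n + 1 : ℝ))) x ^ 2 =
        ((n + 1 : ℝ)⁻¹) ^ 2 * (deriv χ (x / (n + 1 : ℝ)) ^ 2) := fun x => by
      have h2 : HasDerivAt (fun x => χ (x / (n + 1 : ℝ)))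
          (deriv χ (x / (n + 1 : ℝ)) * (1 / (n + 1 : ℝ))) x :=
        (hχ.differentiable (by simp) _).hasDerivAt.comp x ((hasDerivAt_id x).div_const _)
      rw [h2.deriv]
      ring
    simp only [h1]
    rw [integral_const_mul, Measure.integral_comp_div (fun x => deriv χ x ^ 2), abs_of_pos hn,
      smul_eq_mul]
    field_simp
  have hlim1 : Tendsto (fun n : ℕ => ∫ x, deriv (fun x => χ (x / (n + 1 : ℝ))) x ^ 2) atTop
      (𝓝 0) := by
    simp only [hscale]
    have := (tendsto_one_div_add_atTop_nhds_zero_nat (𝕜 := ℝ)).mul_const (∫ x, deriv χ x ^ 2)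
    simpa only [one_div, zero_mul] using this
  -- The stretched bumps tend pointwise to `χ 0 = 1` and stay below `1`, so `|g|` dominates.
  have hlim2 : Tendsto (fun n : ℕ => ∫ x, g x * χ (x / (n + 1 : ℝ)) ^ 2) atTop
      (𝓝 (∫ x, g x)) := by
    refine tendsto_integral_of_dominated_convergence (fun x => |g x|) (fun n => ?_) hg.abs
      (fun n => .of_forall fun x => ?_) (.of_forall fun x => ?_)
    · refine hg.1.mul (Continuous.aestronglyMeasurable ?_)
      exact (hχ.continuous.comp (continuous_id.div_const _)).pow 2
    · rw [norm_mul, Real.norm_eq_abs, Real.norm_of_nonneg (sq_nonneg _)]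
      exact mul_le_of_le_one_right (abs_nonneg _) (pow_le_one₀ χ.nonneg χ.le_one)
    · have h1 : Tendsto (fun n : ℕ => x / (n + 1 : ℝ)) atTop (𝓝 0) := by
        have := (tendsto_one_div_add_atTop_nhds_zero_nat (𝕜 := ℝ)).const_mul x
        simpa only [mul_one_div, mul_zero] using this
      have h2 : Tendsto (fun n : ℕ => χ (x / (n + 1 : ℝ))) atTop (𝓝 1) := by
        have h3 : χ (0 : ℝ) = 1 := χ.one_of_mem_closedBall (Metric.mem_closedBall_self χ.rIn_pos.le)
        have h4 := (hχ.continuous.tendsto 0).comp h1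
        rwa [h3] at h4
      simpa using (h2.pow 2).const_mul (g x)
  have hlim := (hlim1.const_mul A).add (hlim2.const_mul B)
  rw [mul_zero, zero_add] at hlim
  obtain ⟨n, hn⟩ := (hlim.eventually (gt_mem_nhds (mul_neg_of_pos_of_neg hB hneg))).exists
  have hn0 : (n + 1 : ℝ) ≠ 0 := by positivity
  refine ⟨fun x => χ (x / (n + 1 : ℝ)), hχ.comp (contDiff_id.div_const _), ?_, hn⟩
  exact hχc.comp_homeomorph ((Homeomorph.mulRight₀ (n + 1 : ℝ)⁻¹ (inv_ne_zero hn0)))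

/-- For `u = ψ(x) η(y)` with the transversal ground state `η`, the transversal energy cancels
exactly. The form minus `(k² + 1) ‖u‖²` equals `∫ η² ∫ ψ'² + 2 cos² (k d / 2) ∫ (a - k tan (k d /
2)) ψ²`, which `exists_plateau` makes negative. -/
theorem exists_trial_function {d : ℝ} (hd : 0 < d) {k : ℝ} (hk : 0 < k) (hkd : k * d < Real.pi)
    {a : ℝ → ℝ} (ha : MemLp a ⊤ volume)
    (hint : Integrable fun x => a x - k * Real.tan (k * d / 2))
    (hneg : ∫ x, (a x - k * Real.tan (k * d / 2)) < 0) :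
    ∃ u v w : L2Strip d, IsWeakGrad d u v w ∧
      (robinForm d ha u v w u v w).re < (k ^ 2 + 1) * ‖u‖ ^ 2 := by
  have hc : 0 < Real.cos (k * d / 2) :=
    Real.cos_pos_of_mem_Ioo ⟨by nlinarith [Real.pi_pos, mul_pos hk hd], by linarith⟩
  let η : ℝ → ℝ := fun y => Real.cos (k * (y - d / 2))
  have hη : ContDiff ℝ ∞ η := by simp only [η]; fun_prop
  obtain ⟨ψ, hψ, hψc, h⟩ := exists_plateau hint hneg (A := ∫ y in Ioo 0 d, η y ^ 2)
    (B := 2 * Real.cos (k * d / 2) ^ 2) (by positivity)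
  refine ⟨_, _, _, (isBoxFun_mul hψ hψc hη).isWeakGrad d, ?_⟩
  rw [re_robinForm_product hd ha hψ hψc hη,
    IsBoxFun.norm_toL2_sq (isBoxFun_mul hψ hψc hη) d (ψ := ψ) (η := η) fun p => rfl]
  have e0 : η 0 = Real.cos (k * d / 2) := by
    simp only [η]; rw [← Real.cos_neg]; congr 1; ring
  have e1 : η d = Real.cos (k * d / 2) := by
    simp only [η]; congr 1; ring
  have e2 : ∫ y in Ioo 0 d, deriv η y ^ 2 =
      ∫ y in Ioo 0 d, (k * Real.sin (k * (y - d / 2))) ^ 2 := by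
    rw [deriv_cos_centered]; simp only [neg_sq]
  have e3 := transversal_ground_state hd hk hkd
  rw [← e2] at e3
  have hψ2 : Integrable fun x => ψ x ^ 2 :=
    (hψ.continuous.pow 2).integrable_of_hasCompactSupport (by
      simpa only [sq] using hψc.mul_left (f := ψ))
  obtain ⟨M, hM⟩ : ∃ M, ∀ x, ‖ψ x‖ ≤ M := hψc.exists_bound_of_continuous hψ.continuous
  have e4 : ∫ x, (a x - k * Real.tan (k * d / 2)) * ψ x ^ 2 =
      (∫ x, a x * ψ x ^ 2) - k * Real.tan (k * d / 2) * ∫ x, ψ x ^ 2 := by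
    have i1 : Integrable fun x => (a x - k * Real.tan (k * d / 2)) * ψ x ^ 2 := by
      refine hint.mul_bdd (c := M ^ 2) (hψ.continuous.pow 2).aestronglyMeasurable
        (.of_forall fun x => ?_)
      rw [norm_pow]
      exact pow_le_pow_left₀ (norm_nonneg _) (hM x) 2
    have e5 : ∫ x, a x * ψ x ^ 2 = ∫ x, ((a x - k * Real.tan (k * d / 2)) * ψ x ^ 2 +
        k * Real.tan (k * d / 2) * ψ x ^ 2) := by
      congr 1; ext x; ring
    rw [e5, integral_add i1 (hψ2.const_mul _), integral_const_mul]
    ring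
  rw [e4] at h
  rw [e0, e1]
  have e6 : (∫ x, ψ x ^ 2) * (∫ y in Ioo 0 d, deriv η y ^ 2) = (∫ x, ψ x ^ 2) *
      (k ^ 2 * (∫ y in Ioo 0 d, η y ^ 2) -
        k * Real.tan (k * d / 2) * (2 * Real.cos (k * d / 2) ^ 2)) := by
    rw [← e3]; ring
  rw [e6]
  linarith

end TrialFunctions

/-! ### The eigenvalue below the transversal threshold -/

theorem theorem3p5 (d : ℝ) (hd : 0 < d) (α₀ : ℝ) (hα₀ : 0 < α₀)
    (α : ℝ → ℝ) (hα : MemW1Infty α) (hpos : ∀ x, 0 < α x)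
    (hint : Integrable (fun x => α x - α₀))
    (hneg : (∫ x, (α x - α₀)) < 0) :
    ({r : ℝ | (r : ℂ) ∈ UnboundedOp.spectrum (robinLaplacian d α)}.Nonempty ∧
      BddBelow {r : ℝ | (r : ℂ) ∈ UnboundedOp.spectrum (robinLaplacian d α)} ∧
      sInf {r : ℝ | (r : ℂ) ∈ UnboundedOp.spectrum (robinLaplacian d α)}
        < firstTransversalEigenvalue d α₀) ∧
    ∃ r : ℝ, (r : ℂ) ∈ UnboundedOp.discreteSpectrum (robinLaplacian d α) ∧
      r < firstTransversalEigenvalue d α₀ ∧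
      ∀ s : ℝ, (s : ℂ) ∈ UnboundedOp.essentialSpectrum (robinLaplacian d α) → r < s := by
  have hnn : ∀ x, 0 ≤ α x := fun x => (hpos x).le
  obtain ⟨C, γ, hγ, hαγ⟩ := hα.exists_lipschitz
  obtain ⟨R, hR0, hRdom, hRinv, hRform, hRnorm⟩ :=
    exists_resolvent hd hα.1 hnn (ae_abs_shift_sub_le hγ hαγ)
  obtain ⟨k, hk, hkd, rfl⟩ := exists_transversal_wavenumber hd hα₀
  have hk1 : 1 < ‖R‖ * (k ^ 2 + 1) := by
    obtain ⟨u, v, w, hu, hlt⟩ := exists_trial_function hd hk hkd hα.1 hint hneg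
    have h1 := hRnorm u v w hu
    have h2 := normSq_le_robinForm hα.1 hnn u v w
    -- The trial function is nonzero because the strict inequality would otherwise make the
    -- nonnegative form negative.
    have h3 : 0 < ‖u‖ := by
      by_contra! hcon
      rw [le_antisymm hcon (norm_nonneg u)] at h2 hlt
      nlinarith [sq_nonneg ‖v‖, sq_nonneg ‖w‖]
    have h4 : 0 < ‖R‖ := by
      by_contra! hcon
      rw [le_antisymm hcon (norm_nonneg R)] at h1
      nlinarith
    have h5 : ‖R‖ * (robinForm d hα.1 u v w u v w).re < ‖R‖ * ((k ^ 2 + 1) * ‖u‖ ^ 2) := by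
      gcongr
    by_contra! hcon
    nlinarith [mul_le_mul_of_nonneg_right hcon (sq_nonneg ‖u‖)]
  -- Strictness leaves room to lower the wave number. The gap in the coupling constants is needed
  -- since `α` approaches `α₀` at infinity, possibly from below.
  obtain ⟨k', ⟨hk', hk1'⟩, hkk⟩ : ∃ k', (0 < k' ∧ 1 < ‖R‖ * (k' ^ 2 + 1)) ∧ k' < k := by
    have hc : Continuous fun t : ℝ => ‖R‖ * (t ^ 2 + 1) := by fun_prop
    have h1 := (lt_mem_nhds hk).and (hc.continuousAt.eventually (lt_mem_nhds hk1))
    exact ((h1.filter_mono nhdsWithin_le_nhds).and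
      (eventually_mem_nhdsWithin (s := Iio k))).exists
  have hcoup := transversal_coupling_strictMono hd hk' hkk hkd
  obtain ⟨L, hL0, hL⟩ := LipschitzWith.exists_abs_sub_le_of_integrable hγ
    (hint.congr (by filter_upwards [hαγ] with x hx; rw [hx])) (sub_pos.2 hcoup)
  obtain ⟨W, hW, hWform⟩ := exists_finiteDimensional_form_lower_bound hd hk'
    ((mul_lt_mul_of_pos_right hkk hd).trans hkd) hα.1 hnn hL0 (by
      filter_upwards [hαγ] with x hx hxL
      rw [hx]
      linarith [(abs_le.1 (hL x hxL)).1])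
  have hRsymm : ∀ f g, inner ℂ (R f) g = inner ℂ f (R g) := fun f g =>
    ((ContinuousLinearMap.nonneg_iff_isPositive R).1 hR0).isSymmetric f g
  have hm : 0 < k' ^ 2 + 1 := by positivity
  have hRnorm_pos : 0 < ‖R‖ := by
    by_contra! hcon
    nlinarith
  -- The form bound holds for `R f ∈ Wᗮ`, and by symmetry of `R` this means `f` orthogonal to the
  -- image `R W`, again finite dimensional. For such `f`, `(k'² + 1) ‖R f‖² ≤ ⟨f, R f⟩ ≤ ‖f‖ ‖R f‖`.
  obtain ⟨hdisc, hlow⟩ := UnboundedOp.lowest_mem_discreteSpectrum (T := robinLaplacian d α)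
    hRdom hRinv hR0 (W.map (R : L2Strip d →ₗ[ℂ] L2Strip d)) (m := (k' ^ 2 + 1)⁻¹)
    (inv_nonneg.2 hm.le) (by rwa [inv_lt_iff_one_lt_mul₀ hm]) (fun f hf => by
      obtain ⟨v, w, hg, hform⟩ := hRform f
      have hfW : R f ∈ Wᗮ := fun w hw => by
        rw [← hRsymm]
        exact hf _ (Submodule.mem_map_of_mem hw)
      have h1 := hWform _ v w hg hfW
      rw [hform] at h1
      have h2 := h1.trans ((Complex.re_le_norm _).trans (norm_inner_le_norm _ _))
      rw [le_inv_mul_iff₀ hm]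
      rcases (norm_nonneg (R f)).eq_or_lt with h0 | h0
      · rw [← h0, mul_zero]; exact norm_nonneg f
      · refine le_of_mul_le_mul_right ?_ h0
        rw [mul_assoc, ← sq]
        exact h2)
  have hlt : ‖R‖⁻¹ - 1 < firstTransversalEigenvalue d (k * Real.tan (k * d / 2)) := by
    refine lt_of_lt_of_le ?_ (sq_le_firstTransversalEigenvalue hd hk hkd)
    rw [sub_lt_iff_lt_add]
    rwa [inv_lt_iff_one_lt_mul₀ hRnorm_pos, mul_comm]
  -- The eigenvalue is the lowest real spectral point, and it is not in the essential spectrum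
  -- because it is discrete; hence the strict inequality.
  refine ⟨⟨⟨_, hdisc.1⟩, ⟨_, hlow⟩, (csInf_le ⟨_, hlow⟩ hdisc.1).trans_lt hlt⟩, _, hdisc, hlt,
    fun s hs => (hlow s hs.1).lt_of_ne ?_⟩
  rintro rfl
  exact hs.2 hdisc
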